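/- Let $\eta,\tau\in\mathbb C$ with $\operatorname{Im}\eta,\operatorname{Im}\tau>0$ be such that $1,\tau,2\eta$ are linearly independent over $\mathbb Z$, put $p=e^{2\pi i\tau}$, $q=e^{4\pi i\eta}$ (so $p^s=e^{2\pi i\tau s}$, $q^s=e^{4\pi i\eta s}$) and $\Lambda=\mathbb Z+\mathbb Z\tau+\mathbb Z2\eta$. **Notation.** $(t;r)_\infty=\prod_{k\ge0}(1-tr^k)$, $\theta(t;r)=(t;r)_\infty(rt^{-1};r)_\infty$, $\theta(a,b;r)=\theta(a;r)\theta(b;r)$; $$\theta_1(z|\omega)=-\sum_{k\in\mathbb Z}e^{\pi i(k+\frac12)^2\omega}e^{2\pi i(k+\frac12)(z+\frac12)},\quad \theta_2(z|\omega)=\theta_1(z+\tfrac12|\omega),\quad \theta_3(z|\omega)=e^{\frac{\pi i\omega}4+\pi iz}\theta_2(z+\tfrac\omega2|\omega),\quad \theta_4(z|\omega)=\theta_3(z+\tfrac12|\omega);$$ $\mathrm R(\omega)=e^{-\pi i\omega/4}/\bigl(i\,(e^{2\pi i\omega};e^{2\pi i\omega})_\infty\bigr)$, $c_A=e^{\pi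 i\eta}/\mathrm R(\tau)$, $c_B=e^{\pi i\tau/2}/\mathrm R(2\eta)$; $$\Gamma(z)=\prod_{i,j\ge0}\frac{1-e^{-2\pi iz}p^{i+1}q^{j+1}}{1-e^{2\pi iz}p^iq^j}.$$ A function $F$ has the *transformation law of modulus $\omega$ and order $2N$* if $F(z+\omega a)=e^{-2Na[\pi i\omega a+2\pi iz]}F(z)$ for all $z\in\mathbb C$, $a\in\mathbb Z$; it is a *theta function of modulus $\omega$ and order $2N$* if moreover it is entire and $F(z+1)=F(z)$. **The operator $\mathrm M$.** For a 1-periodic entire $\Phi$ and $\operatorname{Im}(-g\pm z)>0$, $$[\mathrm M(g)\Phi](z)=\frac{(q;q)_\infty(p;p)_\infty}2\int_0^1\frac{\Gamma(z+x-g)\Gamma(z-x-g)\Gamma(-z+x-g)\Gamma(-z-x-g)}{\Gamma(-2g)\Gamma(2x)\Gamma(-2x)}\Phi(x)\,dx,$$ and for other $g$ (with $z$ fixed) $[\mathrm M(g)\Phi](z)$ is defined by meromorphic continuation in $g$, to half-planes $\operatorname{Im}g<c$, at points where the continuation is regular. At $g=n\eta+m\frac\tau2$, $n,m\in\mathbb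 Z_{\ge0}$, there is also the finite-difference operator $$\mathrm M^{(k)}\!\left(n\eta+m\tfrac\tau2\right)=\mathrm A_k(n\eta-\eta+m\tfrac\tau2)\cdots\mathrm A_k(m\tfrac\tau2)\;\mathrm B_k(m\tfrac\tau2-\tfrac\tau2)\cdots\mathrm B_k(0)\;\theta_k(z|\eta)^{-m}\theta_k(z|\tfrac\tau2)^{-n},\qquad k=3,4,$$ which solves the contiguous relations with initial condition $\mathrm M(0)=1$, where $$\mathrm A_k(g)=e^{\pi i z^2/\eta}\frac{c_A}{\theta_1(2z|\tau)}\left[\theta_k(z+g+\eta|\tfrac\tau2)e^{\eta\partial_z}-\theta_k(z-g-\eta|\tfrac\tau2)e^{-\eta\partial_z}\right]e^{-\pi iz^2/\eta},$$ and $\mathrm B_k(g)$ is obtained from $\mathrm A_k(g)$ by exchanging $\eta$ and $\tau/2$ (so that $c_A$ becomes $c_B$), with $e^{\pm s\partial_z}f(z)=f(z\pm s)$. **Coefficients.** $$\alpha_k^{(n)}(z)=c_A^n\,\frac{\prod_{j=1}^n\theta_1(2\eta j|\tau)}{\prod_{j=1}^k\theta_1(2\eta j|\tau)\prod_{j=1}^{n-k}\theta_1(2\eta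 j|\tau)}\cdot\frac{\theta_1(2z+2\eta(n-2k)|\tau)}{\prod_{j=0}^n\theta_1(2z-2\eta(k-j)|\tau)},$$ and $\beta_\ell^{(m)}(z)$ is the same expression with $n,k,\eta,\tau,c_A$ replaced by $m,\ell,\tau/2,2\eta,c_B$. **Claim.** Let $n,m\in\mathbb Z_{\ge0}$ and let $\alpha,\beta\in\{0,1,-1\}$ be such that $n-\alpha$ and $m-\beta$ are even. Let $F,G:\mathbb C\to\mathbb C$. Then $$\begin{aligned}\mathrm M\!\left(n\eta+m\tfrac\tau2\right)F(z)G(z)=\;&(-1)^{nm}e^{-\frac{\pi i\tau}2m^2n-\pi i\eta n^2m}\\ &\cdot e^{\frac{\pi i\tau}2\beta^2(n-1)}e^{2\pi i\eta\beta(n-1)n}e^{2\pi i\beta(n-1)z}\left[\sum_{k=0}^n(-1)^k\alpha_k^{(n)}(z)e^{-4\pi i\eta\beta(n-1)k}F\!\left(z+\beta\tfrac\tau2+(n-2k)\eta\right)\right]\\ &\cdot e^{\pi i\eta\alpha^2(m-1)}e^{\pi i\tau\alpha(m-1)m}e^{2\pi i\alpha(m-1)z}\left[\sum_{\ell=0}^m(-1)^\ell\beta_\ell^{(m)}(z)e^{-2\pi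 i\tau\alpha(m-1)\ell}G\!\left(z+\alpha\eta+(m-2\ell)\tfrac\tau2\right)\right]\end{aligned}\tag{1}$$ and, in multiplicative notation, $$\begin{aligned}\mathrm M\!\left(n\eta+m\tfrac\tau2\right)F(z)G(z)=\;&(-1)^{nm}e^{2\pi iz[n+m+4+\alpha(m-1)+\beta(n-1)]}\cdot\frac{q^{\frac{(n^2-\alpha^2)(1-m)}4+\beta\frac{n(n-1)}2+n}}{\prod_{j=0}^n\theta(e^{4\pi iz}q^j;p)}\cdot\frac{p^{\frac{(m^2-\beta^2)(1-n)}4+\alpha\frac{m(m-1)}2+m}}{\prod_{j=0}^m\theta(e^{4\pi iz}p^j;q)}\\ &\cdot\left[\sum_{k=0}^nq^{kn(1-\beta)+\beta k}\theta(e^{-4\pi iz}q^{2k-n};p)\prod_{b=1}^k\frac{\theta(e^{-4\pi iz}q^{b-n-1},q^{b-n-1};p)}{\theta(e^{-4\pi iz}q^b,q^b;p)}F\!\left(z+\beta\tfrac\tau2+(n-2k)\eta\right)\right]\\ &\cdot\left[\sum_{\ell=0}^mp^{\ell m(1-\alpha)+\alpha\ell}\theta(e^{-4\pi iz}p^{2\ell-m};q)\prod_{b=1}^\ell\frac{\theta(e^{-4\pi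 iz}p^{b-m-1},p^{b-m-1};q)}{\theta(e^{-4\pi iz}p^b,p^b;q)}G\!\left(z+\alpha\eta+(m-2\ell)\tfrac\tau2\right)\right],\end{aligned}\tag{2}$$ and, if $\alpha=\beta=1$, the right-hand side takes the form known from the residue calculus: $$\begin{aligned}&\frac{(-1)^{nm}e^{4\pi iz[n+m+1]}q^{\frac{(n^2-1)(1-m)}4+\frac{(n+1)n}2}p^{\frac{(m^2-1)(1-n)}4+\frac{m(m+1)}2}}{\prod_{j=0}^n\theta(e^{4\pi iz}q^j;p)\prod_{j=0}^m\theta(e^{4\pi iz}p^j;q)}\\ &\cdot\left[\sum_{k=0}^nq^k\theta(e^{-4\pi iz}q^{2k-n};p)\prod_{b=1}^k\frac{\theta(e^{-4\pi iz}q^{b-n-1},q^{b-n-1};p)}{\theta(e^{-4\pi iz}q^b,q^b;p)}F\!\left(z+\tfrac\tau2+(n-2k)\eta\right)\right]\\ &\cdot\left[\sum_{\ell=0}^mp^\ell\theta(e^{-4\pi iz}p^{2\ell-m};q)\prod_{b=1}^\ell\frac{\theta(e^{-4\pi iz}p^{b-m-1},p^{b-m-1};q)}{\theta(e^{-4\pi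 iz}p^b,p^b;q)}G\!\left(z+\eta+(m-2\ell)\tfrac\tau2\right)\right].\end{aligned}\tag{3}$$ These formulas hold in both of the following senses. (a) If $F$ is a theta function of modulus $\tau$ and order $2n-2$ and $G$ is a theta function of modulus $2\eta$ and order $2m-2$, they hold for the meromorphically continued integral operator (which is regular at $g=n\eta+m\frac\tau2$), for every $z$ with $2z\notin\Lambda$. (b) If $F$ and $G$ are arbitrary functions with the transformation laws of modulus $\tau$, order $2n-2$ and of modulus $2\eta$, order $2m-2$, respectively, they hold for the finite-difference operator $\mathrm M^{(k)}(n\eta+m\frac\tau2)$, $k=3,4$, for every $z$ with $4z\notin\Lambda$. -/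

import Mathlib

open scoped BigOperators

namespace EllipticDouble

noncomputable section

/-! ## Theta functions -/

/-- `θ₁(z|ω) = -∑_{k∈ℤ} exp(πi(k+1/2)²ω) exp(2πi(k+1/2)(z+1/2))`. -/
def theta1 (z ω : ℂ) : ℂ :=
  -∑' k : ℤ, Complex.exp (Real.pi * Complex.I * ((k : ℂ) + 1 / 2) ^ 2 * ω)
    * Complex.exp (2 * Real.pi * Complex.I * ((k : ℂ) + 1 / 2) * (z + 1 / 2))

/-- `θ₂(z|ω) = θ₁(z+1/2|ω)`. -/
def theta2 (z ω : ℂ) : ℂ := theta1 (z + 1 / 2) ω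

/-- `θ₃(z|ω) = exp(πiω/4 + πiz) θ₂(z+ω/2|ω)`. -/
def theta3 (z ω : ℂ) : ℂ :=
  Complex.exp (Real.pi * Complex.I * ω / 4 + Real.pi * Complex.I * z) * theta2 (z + ω / 2) ω

/-- `θ₄(z|ω) = θ₃(z+1/2|ω)`. -/
def theta4 (z ω : ℂ) : ℂ := theta3 (z + 1 / 2) ω

/-- `nomePow ω s = exp(2πiωs)`: with `p = exp(2πiτ)` and `q = exp(4πiη)`, the power `p^s` is
`nomePow τ s` and the power `q^s` is `nomePow (2η) s`. -/
def nomePow (ω s : ℂ) : ℂ := Complex.exp (2 * Real.pi * Complex.I * ω * s)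

/-- `(t;r)_∞ = ∏_{k≥0} (1 - t r^k)` with `r = exp(2πiω)`. -/
def qPoch (t ω : ℂ) : ℂ := ∏' k : ℕ, (1 - t * nomePow ω k)

/-- `θ(t;r) = (t;r)_∞ (r t⁻¹;r)_∞` with `r = exp(2πiω)`. -/
def thetaM (t ω : ℂ) : ℂ := qPoch t ω * qPoch (nomePow ω 1 * t⁻¹) ω

/-- `R(ω) = r^{-1/8} / (i (r;r)_∞)` with `r = exp(2πiω)`. -/
def thetaR (ω : ℂ) : ℂ := nomePow ω (-1 / 8) / (Complex.I * qPoch (nomePow ω 1) ω)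

/-- The transformation law of theta functions of modulus `ω` and order `2N`:
`F(z+ωa) = exp(-2Na(πiωa + 2πiz)) F(z)` for all integers `a`. -/
def HasThetaQuasiPeriod (ω : ℂ) (N : ℤ) (F : ℂ → ℂ) : Prop :=
  ∀ (z : ℂ) (a : ℤ), F (z + ω * a) =
    Complex.exp (-2 * N * a * (Real.pi * Complex.I * ω * a + 2 * Real.pi * Complex.I * z)) * F z

/-- A (holomorphic) theta function of modulus `ω` and order `2N`, with quasiperiods `1`, `ω`. -/
structure IsThetaFunction (ω : ℂ) (N : ℤ) (F : ℂ → ℂ) : Prop where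
  holomorphic : Differentiable ℂ F
  period_one : ∀ z : ℂ, F (z + 1) = F z
  quasiPeriod : HasThetaQuasiPeriod ω N F

/-- The group `ℤ + ℤτ + ℤ2η`. -/
def periodGroup (η τ : ℂ) : Set ℂ := {w | ∃ a b c : ℤ, w = a + b * τ + c * (2 * η)}

/-! ## The intertwining operator as an integral operator -/

/-- The elliptic gamma function `Γ(z|τ,2η) =
∏_{i,j≥0} (1 - exp(-2πiz) p^{i+1} q^{j+1}) / (1 - exp(2πiz) p^i q^j)`. -/
def ellGamma (η τ z : ℂ) : ℂ :=
  ∏' ij : ℕ × ℕ,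
    (1 - Complex.exp (-2 * Real.pi * Complex.I * z)
        * nomePow τ (ij.1 + 1) * nomePow (2 * η) (ij.2 + 1))
      / (1 - Complex.exp (2 * Real.pi * Complex.I * z)
        * nomePow τ ij.1 * nomePow (2 * η) ij.2)

/-- The integral `[M(g)Φ](z) = (q;q)_∞(p;p)_∞/2 ∫₀¹ Γ(±z±x-g)/Γ(-2g,±2x) Φ(x) dx`, meaningful for
`Im(-g±z) > 0`. -/
def intertwinerIntegral (η τ g : ℂ) (Φ : ℂ → ℂ) (z : ℂ) : ℂ :=
  qPoch (nomePow (2 * η) 1) (2 * η) * qPoch (nomePow τ 1) τ / 2 *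
    ∫ x in (0 : ℝ)..1,
      ellGamma η τ (z + x - g) * ellGamma η τ (z - x - g)
          * ellGamma η τ (-z + x - g) * ellGamma η τ (-z - x - g)
        / (ellGamma η τ (-2 * g) * ellGamma η τ (2 * x) * ellGamma η τ (-2 * x)) * Φ x

/-- `IsIntertwinerValue η τ g₀ Φ z v`: the analytic continuation in the spin `g` of the function
`[M(g)Φ](z)`, given by the integral for `Im(-g±z) > 0`, is regular at `g₀` and has the value `v`
there, i.e. `[M(g₀)Φ](z) = v`. The continuation is meromorphic in a half-plane `Im g < c` that
contains `g₀` (and, for small enough imaginary part of `g`, all points of the original domain).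
The value of a meromorphic function at its poles is immaterial. -/
def IsIntertwinerValue (η τ g₀ : ℂ) (Φ : ℂ → ℂ) (z v : ℂ) : Prop :=
  ∃ (h : ℂ → ℂ) (c : ℝ), g₀.im < c ∧ MeromorphicOn h {g : ℂ | g.im < c} ∧ AnalyticAt ℂ h g₀ ∧
    (∀ g : ℂ, g.im < c → 0 < (-g + z).im → 0 < (-g - z).im →
      h g = intertwinerIntegral η τ g Φ z) ∧
    h g₀ = v

/-! ## The intertwining operator as a finite-difference operator -/

/-- With `ϑ = θ₃` or `θ₄`, the operator
`exp(πiz²/s) (c/θ₁(2z|ω)) [ϑ(z+g+s|ω/2) e^{s∂} - ϑ(z-g-s|ω/2) e^{-s∂}] exp(-πiz²/s)`,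
`c = exp(πis)/R(ω)`. It is `A_k(g)` for `(s,ω) = (η,τ)` and `B_k(g)` for `(s,ω) = (τ/2,2η)`. -/
def contigOp (ϑ : ℂ → ℂ → ℂ) (s ω g : ℂ) (Φ : ℂ → ℂ) : ℂ → ℂ := fun z =>
  Complex.exp (Real.pi * Complex.I * z ^ 2 / s)
    * ((Complex.exp (Real.pi * Complex.I * s) / thetaR ω) / theta1 (2 * z) ω)
    * (ϑ (z + g + s) (ω / 2)
          * (Complex.exp (-(Real.pi * Complex.I * (z + s) ^ 2 / s)) * Φ (z + s))
        - ϑ (z - g - s) (ω / 2)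
          * (Complex.exp (-(Real.pi * Complex.I * (z - s) ^ 2 / s)) * Φ (z - s)))

/-- The product `C(g₀+(n-1)s) ⋯ C(g₀+s) C(g₀)` of the operators `C(g) = contigOp ϑ s ω g`. -/
def contigProd (ϑ : ℂ → ℂ → ℂ) (s ω g₀ : ℂ) : ℕ → (ℂ → ℂ) → (ℂ → ℂ)
  | 0, Φ => Φ
  | n + 1, Φ => contigOp ϑ s ω (g₀ + n * s) (contigProd ϑ s ω g₀ n Φ)

/-- The finite-difference operator `M^{(k)}(nη+mτ/2) =
A_k(nη-η+mτ/2)⋯A_k(mτ/2) · B_k((m-1)τ/2)⋯B_k(0) · θ_k(z|η)^{-m} θ_k(z|τ/2)^{-n}`, obtained by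
solving the contiguous relations with `M(0) = 1`; here `ϑ = θ_k`, `k = 3, 4`. -/
def intertwinerDiff (ϑ : ℂ → ℂ → ℂ) (η τ : ℂ) (n m : ℕ) (Φ : ℂ → ℂ) : ℂ → ℂ :=
  contigProd ϑ η τ (m * (τ / 2)) n
    (contigProd ϑ (τ / 2) (2 * η) 0 m
      (fun z => (ϑ z η ^ m)⁻¹ * (ϑ z (τ / 2) ^ n)⁻¹ * Φ z))

/-! ## The factorized expressions -/

/-- The elliptic binomial coefficient
`∏_{j=1}^n θ₁(2sj|ω) / (∏_{j=1}^k θ₁(2sj|ω) ∏_{j=1}^{n-k} θ₁(2sj|ω))`. -/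
def ellBinom (s ω : ℂ) (n k : ℕ) : ℂ :=
  (∏ j ∈ Finset.Icc 1 n, theta1 (2 * s * j) ω)
    / ((∏ j ∈ Finset.Icc 1 k, theta1 (2 * s * j) ω)
        * ∏ j ∈ Finset.Icc 1 (n - k), theta1 (2 * s * j) ω)

/-- The coefficient `c^n · [n,k] · θ₁(2z+2s(n-2k)|ω) / ∏_{j=0}^n θ₁(2z-2s(k-j)|ω)`,
`c = exp(πis)/R(ω)`. It is `α_k^{(n)}(z)` for `(s,ω) = (η,τ)` and `β_k^{(n)}(z)` for
`(s,ω) = (τ/2,2η)`. -/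
def shiftCoeff (s ω : ℂ) (n k : ℕ) (z : ℂ) : ℂ :=
  (Complex.exp (Real.pi * Complex.I * s) / thetaR ω) ^ n * ellBinom s ω n k
    * (theta1 (2 * z + 2 * s * (n - 2 * k)) ω
      / ∏ j ∈ Finset.range (n + 1), theta1 (2 * z - 2 * s * ((k : ℂ) - j)) ω)

/-- `∑_{k=0}^n (-1)^k α_k^{(n)}(z) exp(-4πisγ(n-1)k) F(z + γω/2 + (n-2k)s)`. -/
def additiveSum (s ω : ℂ) (n : ℕ) (γ : ℤ) (F : ℂ → ℂ) (z : ℂ) : ℂ :=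
  ∑ k ∈ Finset.range (n + 1), (-1) ^ k * shiftCoeff s ω n k z
    * Complex.exp (-4 * Real.pi * Complex.I * s * γ * (n - 1) * k)
    * F (z + γ * (ω / 2) + (n - 2 * k) * s)

/-- The factorized expression in additive notation. -/
def additiveForm (η τ : ℂ) (n m : ℕ) (α β : ℤ) (F G : ℂ → ℂ) (z : ℂ) : ℂ :=
  (-1) ^ (n * m)
    * Complex.exp (-(Real.pi * Complex.I * τ / 2) * m ^ 2 * n
        - Real.pi * Complex.I * η * n ^ 2 * m)
    * (Complex.exp (Real.pi * Complex.I * τ / 2 * β ^ 2 * (n - 1))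
        * Complex.exp (2 * Real.pi * Complex.I * η * β * (n - 1) * n)
        * Complex.exp (2 * Real.pi * Complex.I * β * (n - 1) * z)
        * additiveSum η τ n β F z)
    * (Complex.exp (Real.pi * Complex.I * η * α ^ 2 * (m - 1))
        * Complex.exp (Real.pi * Complex.I * τ * α * (m - 1) * m)
        * Complex.exp (2 * Real.pi * Complex.I * α * (m - 1) * z)
        * additiveSum (τ / 2) (2 * η) m α G z)

/-- With `r = exp(4πis)`, `o = exp(2πiω)` and `X = exp(-4πiz)`, the sum
`∑_{k=0}^n r^{e(k)} θ(X r^{2k-n};o) ∏_{b=1}^k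
  [θ(X r^{b-n-1};o) θ(r^{b-n-1};o)] / [θ(X r^b;o) θ(r^b;o)] F(z + γω/2 + (n-2k)s)`. -/
def multiplicativeSum (s ω : ℂ) (n : ℕ) (γ : ℤ) (e : ℕ → ℂ) (F : ℂ → ℂ) (z : ℂ) : ℂ :=
  ∑ k ∈ Finset.range (n + 1), nomePow (2 * s) (e k)
    * thetaM (Complex.exp (-4 * Real.pi * Complex.I * z) * nomePow (2 * s) (2 * k - n)) ω
    * (∏ b ∈ Finset.Icc 1 k,
        (thetaM (Complex.exp (-4 * Real.pi * Complex.I * z) * nomePow (2 * s) (b - n - 1)) ω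
            * thetaM (nomePow (2 * s) (b - n - 1)) ω)
          / (thetaM (Complex.exp (-4 * Real.pi * Complex.I * z) * nomePow (2 * s) b) ω
            * thetaM (nomePow (2 * s) b) ω))
    * F (z + γ * (ω / 2) + (n - 2 * k) * s)

/-- `∏_{j=0}^n θ(exp(4πiz) r^j;o)` with `r = exp(4πis)`, `o = exp(2πiω)`. -/
def thetaDenom (s ω : ℂ) (n : ℕ) (z : ℂ) : ℂ :=
  ∏ j ∈ Finset.range (n + 1),
    thetaM (Complex.exp (4 * Real.pi * Complex.I * z) * nomePow (2 * s) j) ω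

/-- The factorized expression in multiplicative notation. -/
def multiplicativeForm (η τ : ℂ) (n m : ℕ) (α β : ℤ) (F G : ℂ → ℂ) (z : ℂ) : ℂ :=
  (-1) ^ (n * m)
    * Complex.exp (2 * Real.pi * Complex.I * z
        * (n + m + 4 + α * (m - 1) + β * (n - 1)))
    * (nomePow (2 * η)
          (((n : ℂ) ^ 2 - α ^ 2) * (1 - m) / 4 + β * (n * (n - 1) / 2) + n)
        / thetaDenom η τ n z)
    * (nomePow τ
          (((m : ℂ) ^ 2 - β ^ 2) * (1 - n) / 4 + α * (m * (m - 1) / 2) + m)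
        / thetaDenom (τ / 2) (2 * η) m z)
    * multiplicativeSum η τ n β (fun k => k * n * (1 - β) + β * k) F z
    * multiplicativeSum (τ / 2) (2 * η) m α (fun l => l * m * (1 - α) + α * l) G z

/-- The expression known from the residue calculus. -/
def residueForm (η τ : ℂ) (n m : ℕ) (F G : ℂ → ℂ) (z : ℂ) : ℂ :=
  (-1) ^ (n * m)
    * Complex.exp (4 * Real.pi * Complex.I * z * (n + m + 1))
    * nomePow (2 * η) (((n : ℂ) ^ 2 - 1) * (1 - m) / 4 + (n + 1) * n / 2)
    * nomePow τ (((m : ℂ) ^ 2 - 1) * (1 - n) / 4 + m * (m + 1) / 2)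
    / (thetaDenom η τ n z * thetaDenom (τ / 2) (2 * η) m z)
    * multiplicativeSum η τ n 1 (fun k => k) F z
    * multiplicativeSum (τ / 2) (2 * η) m 1 (fun l => l) G z

end

/-- The value of the continued intertwining operator is unique. -/
theorem IsIntertwinerValue.unique {η τ g₀ : ℂ} {Φ : ℂ → ℂ} {z v w : ℂ}
    (hv : IsIntertwinerValue η τ g₀ Φ z v) (hw : IsIntertwinerValue η τ g₀ Φ z w) : v = w := by
  obtain ⟨h, c, hc, hm, ha, hh, rfl⟩ := hv
  obtain ⟨k, d, hd, km, ka, kk, rfl⟩ := hw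
  set U : Set ℂ := {g : ℂ | g.im < min c d} with hU
  have hUc : IsPreconnected U := by
    have : U = Complex.imLm ⁻¹' Set.Iio (min c d) := rfl
    rw [this]
    exact ((convex_Iio (min c d)).linear_preimage Complex.imLm).isPreconnected
  have hg₀ : g₀ ∈ U := lt_min hc hd
  have hmU : MeromorphicOn h U := fun x hx =>
    hm x (show x.im < c from lt_of_lt_of_le hx (min_le_left c d))
  have kmU : MeromorphicOn k U := fun x hx =>
    km x (show x.im < d from lt_of_lt_of_le hx (min_le_right c d))
  have hdU : MeromorphicOn (h - k) U := hmU.sub kmU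
  set e : ℝ := min (min c d) (-|z.im|) with he
  set y : ℂ := ⟨0, e - 1⟩ with hy
  have hlt : ∀ g : ℂ, g.im < e → g ∈ U ∧ 0 < (-g + z).im ∧ 0 < (-g - z).im := by
    intro g hg
    have h1 : g.im < min c d := lt_of_lt_of_le hg (min_le_left _ _)
    have h2 : g.im < -|z.im| := lt_of_lt_of_le hg (min_le_right _ _)
    have h3 := neg_abs_le z.im
    have h4 := le_abs_self z.im
    refine ⟨h1, ?_, ?_⟩
    · simp only [Complex.add_im, Complex.neg_im]; linarith
    · simp only [Complex.sub_im, Complex.neg_im]; linarith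
  have hye : y.im < e := by simp [hy]
  have hopen : IsOpen {g : ℂ | g.im < e} := isOpen_lt Complex.continuous_im continuous_const
  have hytop : meromorphicOrderAt (h - k) y = ⊤ := by
    rw [meromorphicOrderAt_eq_top_iff]
    refine Filter.Eventually.filter_mono nhdsWithin_le_nhds ?_
    filter_upwards [hopen.mem_nhds hye] with g hg
    obtain ⟨h1, h2, h3⟩ := hlt g hg
    have e1 := hh g (lt_of_lt_of_le h1 (min_le_left _ _)) h2 h3
    have e2 := kk g (lt_of_lt_of_le h1 (min_le_right _ _)) h2 h3
    simp [e1, e2]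
  have hgtop : meromorphicOrderAt (h - k) g₀ = ⊤ := by
    by_contra hne
    exact hdU.meromorphicOrderAt_ne_top_of_isPreconnected hUc hg₀ (hlt y hye).1 hne hytop
  rw [meromorphicOrderAt_eq_top_iff] at hgtop
  have hcont : ContinuousAt (h - k) g₀ := (ha.sub ka).continuousAt
  have hlim : Filter.Tendsto (h - k) (nhdsWithin g₀ {g₀}ᶜ) (nhds 0) :=
    (Filter.tendsto_congr' hgtop).mpr tendsto_const_nhds
  have := tendsto_nhds_unique (hcont.tendsto.mono_left nhdsWithin_le_nhds) hlim
  exact sub_eq_zero.mp this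

end EllipticDouble

open EllipticDouble

open EllipticDouble

namespace EllipticDouble
open Complex Filter Topology
open scoped Real

/-! ## Theta functions -/

/-! Both operators are brought to the same bilinear expression. Let `coreSum s ω n F z` be the sum
of (-1)^k α_k^{(n)}(z) F(z+(n-2k)s). Up to an explicit exponential, the additive form is a `coreSum`
for (η, τ) times a `coreSum` for (τ/2, 2η), applied to normalized half-period shifts of F and G
(`additiveForm_eq`). For F of modulus τ, the values F(x+Mτ/2) depend on M only through its parity
and an exponential (`HasThetaQuasiPeriod.apply_add_half`). This separates the two directions of
shift, and the orders 2n-2 and 2m-2 are those for which the leftover exponentials cancel.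

Finite-difference operator. The three-term relation between θ₁ of modulus ω and θ₃, θ₄ of modulus
ω/2 shows that one more contiguity operator turns the `coreSum` with index n into the one with index
n+1 (`coreSum_succ`). Hence a product of n operators starting at spin 0 is a Gaussian-conjugated
`coreSum`. Starting at spin mω/2 only adds another Gaussian conjugation, by quasi-periodicity of θ₃,
θ₄ (`contigProd_add_half`). In the composition of the A- and B-products the B-shifts act on F, and
the A-shifts act on the G-sum, through exponentials only (`coreSum_add_half`), so the result
factorizes.

Integral operator. The factors of the gamma functions whose poles can cross the contour are split
off, leaving a kernel holomorphic in x and g. Partial fractions in e(x-g) and in e(-x-g), where e(u)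
= exp(2πiu), reduce the integral to a double sum over poles. A product of two simple fractions is
1/(1-e(b_i+b_j-2g)) times a sum of two terms, each with poles on one side of the contour only.
Moving the contour up in one and down in the other continues both in g (`integral_mul_prod_inv_eq`).
The prefactor 1/Γ(-2g) cancels the explicit pole for pairs of opposite sign. At g = nη+mτ/2 it kills
every pair except those with b_i+b_j = 2g, for which the two integrals add up to a residue
(`contourUp_add_contourDown`, `exists_isIntertwinerValue_sum`).

The shift equations of the gamma function turn these residues into products of θ₁, and each equals
the product of a term of one `coreSum` and a term of the other (`residueWeight_eq_shiftCoeff`). The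
poles of the two signs give the additive form at z and at -z. These agree because each `coreSum` is
odd in z, which amounts to the vanishing of the sum on even theta functions, an interpolation
identity (`IsThetaFunction.sum_div_prod_eq_zero`).

The multiplicative forms follow from the additive one through the product formula for θ₁, that is,
the Jacobi triple product (`thetaM_exp`, `multiplicativeSum_eq`). -/

theorem theta1_eq_jacobiTheta₂ (z ω : ℂ) :
    theta1 z ω = -(cexp (π * I * ω / 4 + π * I * (z + 1 / 2))
      * jacobiTheta₂ (z + 1 / 2 + ω / 2) ω) := by
  rw [theta1, jacobiTheta₂, ← tsum_mul_left]
  congr 1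
  refine tsum_congr fun k => ?_
  rw [jacobiTheta₂_term, ← Complex.exp_add, ← Complex.exp_add]
  congr 1
  ring

theorem exp_pi_mul_I_int (a : ℤ) : cexp (π * I * a) = (-1) ^ a := by
  rw [mul_comm, Complex.exp_int_mul, Complex.exp_pi_mul_I]

theorem exp_two_pi_mul_I_int (a : ℤ) : cexp (2 * π * I * a) = 1 := by
  rw [mul_comm]; exact Complex.exp_int_mul_two_pi_mul_I a

theorem theta3_eq_jacobiTheta₂ (z ω : ℂ) : theta3 z ω = jacobiTheta₂ z ω := by
  rw [theta3, theta2, theta1_eq_jacobiTheta₂,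
    show z + ω / 2 + 1 / 2 + 1 / 2 + ω / 2 = (z + 1) + ω by ring, jacobiTheta₂_add_left',
    jacobiTheta₂_add_left, mul_neg, ← mul_assoc, ← mul_assoc, ← Complex.exp_add,
    ← Complex.exp_add]
  have : cexp (π * I * ω / 4 + π * I * z + (π * I * ω / 4 + π * I * (z + ω / 2 + 1 / 2 + 1 / 2))
      + -π * I * (ω + 2 * (z + 1))) = -1 := by
    rw [show (π * I * ω / 4 + π * I * z + (π * I * ω / 4 + π * I * (z + ω / 2 + 1 / 2 + 1 / 2))
      + -π * I * (ω + 2 * (z + 1))) = -(π * I) by ring, Complex.exp_neg, Complex.exp_pi_mul_I]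
    norm_num
  rw [this]
  ring

theorem theta4_eq_jacobiTheta₂ (z ω : ℂ) : theta4 z ω = jacobiTheta₂ (z + 1 / 2) ω := by
  rw [theta4, theta3_eq_jacobiTheta₂]

theorem differentiable_theta1 {ω : ℂ} (hω : 0 < ω.im) : Differentiable ℂ fun z => theta1 z ω := by
  have : (fun z => theta1 z ω) = fun z => -(cexp (π * I * ω / 4 + π * I * (z + 1 / 2))
      * jacobiTheta₂ (z + 1 / 2 + ω / 2) ω) := by
    ext z; exact theta1_eq_jacobiTheta₂ z ω
  rw [this]
  have h2 : Differentiable ℂ fun z : ℂ => jacobiTheta₂ (z + 1 / 2 + ω / 2) ω := fun z =>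
    (differentiableAt_jacobiTheta₂_fst (z + 1 / 2 + ω / 2) hω).comp z
      (f := fun z : ℂ => z + 1 / 2 + ω / 2) (by fun_prop)
  fun_prop

theorem theta1_add_one (z ω : ℂ) : theta1 (z + 1) ω = -theta1 z ω := by
  rw [theta1_eq_jacobiTheta₂, theta1_eq_jacobiTheta₂,
    show z + 1 + 1 / 2 + ω / 2 = z + 1 / 2 + ω / 2 + 1 by ring, jacobiTheta₂_add_left,
    show π * I * ω / 4 + π * I * (z + 1 + 1 / 2)
      = π * I * ω / 4 + π * I * (z + 1 / 2) + π * I by ring, Complex.exp_add _ (π * I),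
    Complex.exp_pi_mul_I]
  ring

theorem theta1_add_period (z ω : ℂ) :
    theta1 (z + ω) ω = -1 * cexp (-(π * I * ω) - 2 * π * I * z) * theta1 z ω := by
  rw [theta1_eq_jacobiTheta₂, theta1_eq_jacobiTheta₂,
    show z + ω + 1 / 2 + ω / 2 = z + 1 / 2 + ω / 2 + ω by ring, jacobiTheta₂_add_left',
    ← mul_assoc, ← Complex.exp_add]
  rw [show -1 * cexp (-(π * I * ω) - 2 * π * I * z)
      * -(cexp (π * I * ω / 4 + π * I * (z + 1 / 2)) * jacobiTheta₂ (z + 1 / 2 + ω / 2) ω)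
      = cexp (-(π * I * ω) - 2 * π * I * z) * cexp (π * I * ω / 4 + π * I * (z + 1 / 2))
        * jacobiTheta₂ (z + 1 / 2 + ω / 2) ω by ring, ← Complex.exp_add, ← neg_mul]
  congr 1
  rw [show π * I * ω / 4 + π * I * (z + ω + 1 / 2) + -π * I * (ω + 2 * (z + 1 / 2 + ω / 2))
    = -(π * I * ω) - 2 * π * I * z + (π * I * ω / 4 + π * I * (z + 1 / 2)) - π * I by ring,
    Complex.exp_sub _ (π * I), Complex.exp_pi_mul_I]
  ring

theorem theta1_neg (z ω : ℂ) : theta1 (-z) ω = -theta1 z ω := by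
  rw [theta1_eq_jacobiTheta₂, theta1_eq_jacobiTheta₂, ← jacobiTheta₂_neg_left (-z + 1 / 2 + ω / 2),
    show z + 1 / 2 + ω / 2 = -(-z + 1 / 2 + ω / 2) + 1 + ω by ring, jacobiTheta₂_add_left',
    jacobiTheta₂_add_left, ← mul_assoc, ← Complex.exp_add, neg_neg, ← neg_mul]
  congr 1
  rw [show π * I * ω / 4 + π * I * (z + 1 / 2) + -π * I * (ω + 2 * (-(-z + 1 / 2 + ω / 2) + 1))
    = π * I * ω / 4 + π * I * (-z + 1 / 2) - π * I by ring,
    Complex.exp_sub _ (π * I), Complex.exp_pi_mul_I]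
  ring

theorem theta1_zero (ω : ℂ) : theta1 0 ω = 0 := by
  have := theta1_neg 0 ω
  rw [neg_zero] at this
  exact self_eq_neg.mp this

/-- One induction serves θ₁, θ₃ and θ₄, whose quasi-periods differ only in the sign ε. -/
theorem quasiPeriod_int {f : ℂ → ℂ} {ω ε : ℂ} (hε : ε ≠ 0)
    (h : ∀ z, f (z + ω) = ε * cexp (-(π * I * ω) - 2 * π * I * z) * f z) (z : ℂ) (a : ℤ) :
    f (z + a * ω) = ε ^ a * cexp (-(π * I * a ^ 2 * ω) - 2 * π * I * a * z) * f z := by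
  induction a using Int.induction_on generalizing z with
  | zero => simp
  | succ a ih =>
    rw [show z + ((a : ℤ) + 1 : ℤ) * ω = (z + ω) + (a : ℤ) * ω by push_cast; ring, ih, h,
      zpow_add₀ hε, zpow_one]
    rw [show ε ^ (a : ℤ) * cexp (-(π * I * ((a : ℤ) : ℂ) ^ 2 * ω) - 2 * π * I * (a : ℤ) * (z + ω))
      * (ε * cexp (-(π * I * ω) - 2 * π * I * z) * f z)
      = ε ^ (a : ℤ) * ε * (cexp (-(π * I * ((a : ℤ) : ℂ) ^ 2 * ω) - 2 * π * I * (a : ℤ) * (z + ω))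
      * cexp (-(π * I * ω) - 2 * π * I * z)) * f z by ring, ← Complex.exp_add]
    congr 3
    push_cast
    ring
  | pred a ih =>
    have h1 := ih (z - ω)
    have h2 := h (z - ω)
    rw [sub_add_cancel] at h2
    rw [show z + (-(a : ℤ) - 1 : ℤ) * ω = (z - ω) + (-(a : ℤ) : ℤ) * ω by push_cast; ring, h1, h2,
      show (-(a : ℤ)) = (-(a : ℤ) - 1) + 1 by ring, zpow_add₀ hε, zpow_one, add_sub_cancel_right]
    rw [show ε ^ (-(a : ℤ) - 1) * cexp (-(π * I * ((-(a : ℤ) - 1 : ℤ) : ℂ) ^ 2 * ω)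
      - 2 * π * I * (-(a : ℤ) - 1 : ℤ) * z) * (ε * cexp (-(π * I * ω) - 2 * π * I * (z - ω))
        * f (z - ω)) = ε ^ (-(a : ℤ) - 1) * ε * (cexp (-(π * I * ((-(a : ℤ) - 1 : ℤ) : ℂ) ^ 2 * ω)
      - 2 * π * I * (-(a : ℤ) - 1 : ℤ) * z) * cexp (-(π * I * ω) - 2 * π * I * (z - ω)))
        * f (z - ω) by ring, ← Complex.exp_add]
    congr 3
    push_cast
    ring

theorem theta1_add_int_mul (z ω : ℂ) (a : ℤ) :
    theta1 (z + a * ω) ω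
      = (-1) ^ a * cexp (-(π * I * a ^ 2 * ω) - 2 * π * I * a * z) * theta1 z ω :=
  quasiPeriod_int (f := fun z => theta1 z ω) (by norm_num) (fun z => theta1_add_period z ω) z a

theorem theta1_add_int (z ω : ℂ) (a : ℤ) : theta1 (z + a) ω = (-1) ^ a * theta1 z ω := by
  induction a using Int.induction_on generalizing z with
  | zero => simp
  | succ a ih =>
    rw [show z + ((a : ℤ) + 1 : ℤ) = (z + 1) + (a : ℤ) by push_cast; ring, ih, theta1_add_one,
      zpow_add₀ (by norm_num), zpow_one]
    ring
  | pred a ih =>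
    have h2 := theta1_add_one (z - 1) ω
    rw [sub_add_cancel] at h2
    rw [show z + (-(a : ℤ) - 1 : ℤ) = (z - 1) + (-(a : ℤ) : ℤ) by push_cast; ring, ih,
      h2, zpow_sub₀ (by norm_num : (-1 : ℂ) ≠ 0), zpow_one]
    ring

/-- The functions `θ₃` and `θ₄`, with the sign of their quasi-period. -/
def IsEvenTheta (ϑ : ℂ → ℂ → ℂ) (ε : ℂ) : Prop :=
  (ϑ = theta3 ∧ ε = 1) ∨ (ϑ = theta4 ∧ ε = -1)

theorem IsEvenTheta.sq_eq_one {ϑ : ℂ → ℂ → ℂ} {ε : ℂ} (h : IsEvenTheta ϑ ε) : ε ^ 2 = 1 := by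
  rcases h with ⟨-, rfl⟩ | ⟨-, rfl⟩ <;> norm_num

theorem IsEvenTheta.ne_zero {ϑ : ℂ → ℂ → ℂ} {ε : ℂ} (h : IsEvenTheta ϑ ε) : ε ≠ 0 := by
  rcases h with ⟨-, rfl⟩ | ⟨-, rfl⟩ <;> norm_num

theorem IsEvenTheta.add_int_mul {ϑ : ℂ → ℂ → ℂ} {ε : ℂ} (h : IsEvenTheta ϑ ε) (z ω : ℂ) (a : ℤ) :
    ϑ (z + a * ω) ω = ε ^ a * cexp (-(π * I * a ^ 2 * ω) - 2 * π * I * a * z) * ϑ z ω := by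
  refine quasiPeriod_int h.ne_zero (f := fun z => ϑ z ω) (fun z => ?_) z a
  rcases h with ⟨rfl, rfl⟩ | ⟨rfl, rfl⟩
  · simp only [theta3_eq_jacobiTheta₂]
    rw [jacobiTheta₂_add_left', one_mul]
    congr 2
    ring
  · simp only [theta4_eq_jacobiTheta₂]
    rw [show z + ω + 1 / 2 = z + 1 / 2 + ω by ring, jacobiTheta₂_add_left',
      show -π * I * (ω + 2 * (z + 1 / 2)) = -(π * I * ω) - 2 * π * I * z - π * I by ring,
      Complex.exp_sub _ (π * I), Complex.exp_pi_mul_I]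
    ring

/-! ### Quadratic relations between theta functions of moduli ω and ω/2 -/

theorem hasSum_theta1 (z : ℂ) {ω : ℂ} (hω : 0 < ω.im) :
    HasSum (fun k : ℤ => -cexp (π * I * (k + 1 / 2) ^ 2 * ω + 2 * π * I * (k + 1 / 2) * (z + 1 / 2)))
      (theta1 z ω) := by
  rw [theta1_eq_jacobiTheta₂]
  refine HasSum.neg ?_
  have := (hasSum_jacobiTheta₂_term (z + 1 / 2 + ω / 2) hω).mul_left
    (cexp (π * I * ω / 4 + π * I * (z + 1 / 2)))
  refine this.congr_fun fun k => ?_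
  rw [jacobiTheta₂_term, ← Complex.exp_add]
  congr 1
  ring

theorem hasSum_theta3 (z : ℂ) {ω : ℂ} (hω : 0 < ω.im) :
    HasSum (fun k : ℤ => cexp (2 * π * I * k * z + π * I * k ^ 2 * ω)) (theta3 z ω) := by
  rw [theta3_eq_jacobiTheta₂]
  exact hasSum_jacobiTheta₂_term z hω

theorem hasSum_theta4 (z : ℂ) {ω : ℂ} (hω : 0 < ω.im) :
    HasSum (fun k : ℤ => (-1) ^ k * cexp (2 * π * I * k * z + π * I * k ^ 2 * ω)) (theta4 z ω) := by
  rw [theta4_eq_jacobiTheta₂]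
  refine (hasSum_jacobiTheta₂_term (z + 1 / 2) hω).congr_fun fun k => ?_
  rw [jacobiTheta₂_term, ← exp_pi_mul_I_int, ← Complex.exp_add]
  congr 1
  ring

theorem hasSum_mul_int {f g : ℤ → ℂ} {a b : ℂ} (hf : HasSum f a) (hg : HasSum g b) :
    HasSum (fun x : ℤ × ℤ => f x.1 * g x.2) (a * b) :=
  hf.mul hg (summable_mul_of_summable_norm hf.summable.norm hg.summable.norm)

/-- Multiplication of the series: with a = j+k+1 and b = j-k the form (j+1/2)²+(k+1/2)² becomes
(a²+b²)/2, which halves the modulus. The pairs (a,b) so obtained are those with a+b odd. On the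
right the terms with a+b even cancel and the others are doubled. -/
theorem two_mul_theta1_mul_theta1 (x y : ℂ) {ω : ℂ} (hω : 0 < ω.im) :
    2 * (theta1 (x + y) ω * theta1 (x - y) ω)
      = theta4 x (ω / 2) * theta3 y (ω / 2) - theta3 x (ω / 2) * theta4 y (ω / 2) := by
  have hω2 : 0 < (ω / 2).im := by rw [Complex.div_ofNat_im]; positivity
  have h1 := (hasSum_mul_int (hasSum_theta1 (x + y) hω) (hasSum_theta1 (x - y) hω)).mul_left 2
  have h2 := (hasSum_mul_int (hasSum_theta4 x hω2) (hasSum_theta3 y hω2)).sub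
    (hasSum_mul_int (hasSum_theta3 x hω2) (hasSum_theta4 y hω2))
  let e : ℤ × ℤ → ℤ × ℤ := fun j => (j.1 + j.2 + 1, j.1 - j.2)
  have he : Function.Injective e := by
    rintro ⟨a, b⟩ ⟨c, d⟩ h
    simp only [e, Prod.mk.injEq] at h ⊢
    omega
  rw [← he.hasSum_iff] at h2
  · refine (h1.unique ?_)
    refine h2.congr_fun fun j => ?_
    obtain ⟨j, k⟩ := j
    simp only [e, Function.comp]
    have hs : ((-1 : ℂ)) ^ (j - k) = -(-1) ^ (j + k + 1) := by
      rw [show j - k = (j + k + 1) + (-1) + 2 * (-k) by ring, zpow_add₀ (by norm_num),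
        zpow_add₀ (by norm_num), zpow_mul]
      norm_num
    have hl : ∀ c A B : ℂ, c * A * B - A * (-c * B) = 2 * (c * (A * B)) := fun c A B => by ring
    rw [hs, neg_mul_neg, hl, ← Complex.exp_add, ← Complex.exp_add, ← exp_pi_mul_I_int,
      ← Complex.exp_add]
    congr 2
    push_cast
    ring
  · rintro ⟨a, b⟩ hab
    have : Even (a + b) := by
      by_contra hodd
      rw [Int.not_even_iff_odd] at hodd
      obtain ⟨c, hc⟩ := hodd
      exact hab ⟨(c, a - 1 - c), by simp only [e, Prod.mk.injEq]; omega⟩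
    obtain ⟨c, hc⟩ := this
    have hs : ((-1 : ℂ)) ^ a = (-1) ^ b := by
      rw [show a = b + 2 * (c - b) by omega, zpow_add₀ (by norm_num), zpow_mul]
      norm_num
    simp only [hs]
    ring

/-- The three-term relation between `θ₁` of modulus `ω` and `ϑ = θ₃, θ₄` of modulus `ω/2`. -/
theorem IsEvenTheta.three_term {ϑ : ℂ → ℂ → ℂ} {ε : ℂ} (h : IsEvenTheta ϑ ε) (a b c : ℂ) {ω : ℂ}
    (hω : 0 < ω.im) :
    ϑ a (ω / 2) * (theta1 (c - b) ω * theta1 (b + c) ω)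
      + ϑ b (ω / 2) * (theta1 (a - c) ω * theta1 (a + c) ω)
      = ϑ c (ω / 2) * (theta1 (a - b) ω * theta1 (a + b) ω) := by
  -- Each product of two θ₁ is half a 2×2 determinant in (θ₄, θ₃), so the relation is the vanishing
  -- of a 3×3 determinant with a repeated row.
  have h1 := two_mul_theta1_mul_theta1 c b hω
  have h2 := two_mul_theta1_mul_theta1 a c hω
  have h3 := two_mul_theta1_mul_theta1 a b hω
  rw [add_comm c b] at h1
  rcases h with ⟨rfl, -⟩ | ⟨rfl, -⟩
  · linear_combination theta3 a (ω / 2) / 2 * h1 + theta3 b (ω / 2) / 2 * h2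
      - theta3 c (ω / 2) / 2 * h3
  · linear_combination theta4 a (ω / 2) / 2 * h1 + theta4 b (ω / 2) / 2 * h2
      - theta4 c (ω / 2) / 2 * h3


/-! ## The Jacobi triple product -/

theorem nomePow_add (ω s t : ℂ) : nomePow ω (s + t) = nomePow ω s * nomePow ω t := by
  rw [nomePow, nomePow, nomePow, ← Complex.exp_add, mul_add]

theorem nomePow_zero (ω : ℂ) : nomePow ω 0 = 1 := by
  rw [nomePow, mul_zero, Complex.exp_zero]

theorem nomePow_ne_zero (ω s : ℂ) : nomePow ω s ≠ 0 := Complex.exp_ne_zero _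

theorem nomePow_natCast (ω : ℂ) (k : ℕ) : nomePow ω k = nomePow ω 1 ^ k := by
  rw [nomePow, nomePow, ← Complex.exp_nat_mul]
  congr 1
  ring

theorem nomePow_natCast_add_one (ω : ℂ) (k : ℕ) :
    nomePow ω (k + 1) = nomePow ω 1 ^ (k + 1) := by
  rw [← nomePow_natCast]; push_cast; rfl

theorem norm_nomePow_one_lt {ω : ℂ} (hω : 0 < ω.im) : ‖nomePow ω 1‖ < 1 := by
  rw [nomePow, Complex.norm_exp, Real.exp_lt_one_iff]
  have : (2 * π * I * ω * 1).re = -(2 * π * ω.im) := by simp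
  rw [this]
  have := Real.pi_pos
  nlinarith [mul_pos this hω]

theorem multipliable_one_sub_mul_pow (t : ℂ) {r : ℂ} (hr : ‖r‖ < 1) :
    Multipliable fun k : ℕ => 1 - t * r ^ k := by
  have := multipliable_one_add_of_summable (f := fun k : ℕ => -(t * r ^ k)) (by
    simp only [norm_neg, norm_mul, norm_pow]
    exact (summable_geometric_of_lt_one (norm_nonneg _) hr).mul_left _)
  simpa [sub_eq_add_neg] using this

theorem qPoch_eq (t ω : ℂ) : qPoch t ω = ∏' k : ℕ, (1 - t * nomePow ω 1 ^ k) := by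
  simp only [qPoch, nomePow_natCast]

theorem tendsto_prod_qPoch (t : ℂ) {ω : ℂ} (hω : 0 < ω.im) :
    Tendsto (fun N => ∏ k ∈ Finset.range N, (1 - t * nomePow ω 1 ^ k)) atTop (𝓝 (qPoch t ω)) := by
  rw [qPoch_eq]
  exact (multipliable_one_sub_mul_pow t (norm_nomePow_one_lt hω)).hasProd.tendsto_prod_nat

theorem qPoch_ne_zero {t ω : ℂ} (hω : 0 < ω.im) (h : ∀ k : ℕ, t * nomePow ω 1 ^ k ≠ 1) :
    qPoch t ω ≠ 0 := by
  rw [qPoch_eq]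
  have := tprod_one_add_ne_zero_of_summable (f := fun k : ℕ => -(t * nomePow ω 1 ^ k))
    (fun k => by rw [← sub_eq_add_neg, sub_ne_zero]; exact (h k).symm) (by
    simp only [norm_neg, norm_mul, norm_pow]
    exact (summable_geometric_of_lt_one (norm_nonneg _) (norm_nomePow_one_lt hω)).mul_left _)
  simpa [sub_eq_add_neg] using this

theorem pow_succ_ne_one_of_norm_lt_one {r : ℂ} (hr : ‖r‖ < 1) (k : ℕ) : r ^ (k + 1) ≠ 1 := by
  intro h
  have := congrArg norm h
  rw [norm_pow, norm_one] at this
  exact absurd this (pow_lt_one₀ (norm_nonneg _) hr (by omega)).ne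

theorem qPoch_nomePow_one_ne_zero {ω : ℂ} (hω : 0 < ω.im) : qPoch (nomePow ω 1) ω ≠ 0 :=
  qPoch_ne_zero hω fun k => by
    rw [mul_comm, ← pow_succ]
    exact pow_succ_ne_one_of_norm_lt_one (norm_nomePow_one_lt hω) k

/-- The finite product `(r;r)_n`. -/
noncomputable def finPoch (r : ℂ) (n : ℕ) : ℂ := ∏ j ∈ Finset.range n, (1 - r ^ (j + 1))

theorem finPoch_succ (r : ℂ) (n : ℕ) : finPoch r (n + 1) = finPoch r n * (1 - r ^ (n + 1)) :=
  Finset.prod_range_succ _ _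

theorem finPoch_ne_zero {r : ℂ} (hr : ‖r‖ < 1) (n : ℕ) : finPoch r n ≠ 0 :=
  Finset.prod_ne_zero_iff.mpr fun j _ =>
    sub_ne_zero.mpr (pow_succ_ne_one_of_norm_lt_one hr j).symm

/-- The Gaussian binomial theorem. -/
theorem prod_one_add_mul_pow {r : ℂ} (hr : ‖r‖ < 1) (x : ℂ) (M : ℕ) :
    ∏ j ∈ Finset.range M, (1 + x * r ^ j)
      = ∑ k ∈ Finset.range (M + 1),
        finPoch r M / (finPoch r k * finPoch r (M - k)) * r ^ (k.choose 2) * x ^ k := by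
  have hne := finPoch_ne_zero hr
  induction M with
  | zero => simp [finPoch]
  | succ M ih =>
    rw [Finset.prod_range_succ, ih, mul_add, mul_one, Finset.sum_mul]
    rw [Finset.sum_range_succ' _ M, Finset.sum_range_succ _ M,
      Finset.sum_range_succ' _ (M + 1), Finset.sum_range_succ _ M]
    have h0 : finPoch r 0 = 1 := by simp [finPoch]
    -- Pascal's rule for Gaussian binomials. The indices 0 and M+1 have a single parent and are
    -- split off.
    have hstep : ∀ k ∈ Finset.range M,
        finPoch r (M + 1) / (finPoch r (k + 1) * finPoch r (M + 1 - (k + 1)))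
          * r ^ ((k + 1).choose 2) * x ^ (k + 1)
        = finPoch r M / (finPoch r (k + 1) * finPoch r (M - (k + 1)))
          * r ^ ((k + 1).choose 2) * x ^ (k + 1)
        + finPoch r M / (finPoch r k * finPoch r (M - k)) * r ^ (k.choose 2) * x ^ k
          * (x * r ^ M) := by
      intro k hk
      rw [Finset.mem_range] at hk
      obtain ⟨d, rfl⟩ : ∃ d, M = k + 1 + d := ⟨M - (k + 1), by omega⟩
      rw [show k + 1 + d + 1 - (k + 1) = d + 1 by omega, show k + 1 + d - (k + 1) = d by omega,
        show k + 1 + d - k = d + 1 by omega, Nat.choose_succ_succ' k 1, Nat.choose_one_right,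
        finPoch_succ r (k + 1 + d), finPoch_succ r k, finPoch_succ r d]
      have h1 := hne k
      have h2 := hne d
      have h3 := hne (k + 1 + d)
      have h4 : 1 - r ^ (k + 1) ≠ 0 := sub_ne_zero.mpr (pow_succ_ne_one_of_norm_lt_one hr k).symm
      have h5 : 1 - r ^ (d + 1) ≠ 0 := sub_ne_zero.mpr (pow_succ_ne_one_of_norm_lt_one hr d).symm
      field_simp
      ring
    rw [Finset.sum_congr rfl hstep, Finset.sum_add_distrib]
    simp only [Nat.sub_self, h0, Nat.sub_zero, Nat.choose_zero_succ, pow_zero, mul_one, one_mul]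
    rw [div_self (hne _), div_self (hne _), Nat.choose_succ_succ' M 1,
      Nat.choose_one_right]
    ring

/-- The coefficients of the finite form of the triple product. -/
noncomputable def tripleCoeff (r : ℂ) (N : ℕ) (κ : ℤ) : ℂ :=
  if -(N : ℤ) ≤ κ ∧ κ ≤ N then
    finPoch r (2 * N) / (finPoch r (N + κ).toNat * finPoch r (N - κ).toNat) else 0

/-- The Gaussian binomial theorem with 2N factors and variable -w r^{-N}. The upper N factors are 1
- w r^j; the lower N, reflected, are 1 - r^{j+1}/w up to monomials. The index k = κ+N is then
centred at 0 and the powers become terms of a theta series. -/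
theorem prod_mul_prod_eq_tsum (z : ℂ) {ω : ℂ} (hω : 0 < ω.im) (N : ℕ) :
    (∏ j ∈ Finset.range N, (1 - cexp (2 * π * I * z) * nomePow ω 1 ^ j))
        * ∏ j ∈ Finset.range N, (1 - nomePow ω 1 * (cexp (2 * π * I * z))⁻¹ * nomePow ω 1 ^ j)
      = ∑' κ : ℤ, tripleCoeff (nomePow ω 1) N κ * jacobiTheta₂_term κ (z + 1 / 2 - ω / 2) ω := by
  set r := nomePow ω 1 with hr
  set w := cexp (2 * π * I * z) with hw
  have hr1 : ‖r‖ < 1 := norm_nomePow_one_lt hω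
  have hr0 : r ≠ 0 := nomePow_ne_zero _ _
  have hw0 : w ≠ 0 := Complex.exp_ne_zero _
  have key := prod_one_add_mul_pow hr1 (-w * (r ^ N)⁻¹) (2 * N)
  have hsplit : ∏ j ∈ Finset.range (2 * N), (1 + -w * (r ^ N)⁻¹ * r ^ j)
      = (∏ j ∈ Finset.range N, (-w * (r ^ (j + 1))⁻¹))
        * ((∏ j ∈ Finset.range N, (1 - w * r ^ j)) * ∏ j ∈ Finset.range N, (1 - r * w⁻¹ * r ^ j)) := by
    have e1 : ∏ j ∈ Finset.range N, (1 + -w * (r ^ N)⁻¹ * r ^ (N + j))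
        = ∏ j ∈ Finset.range N, (1 - w * r ^ j) := by
      refine Finset.prod_congr rfl fun j _ => ?_
      rw [pow_add]
      field_simp
      ring
    have e2 : ∏ j ∈ Finset.range N, (1 + -w * (r ^ N)⁻¹ * r ^ j)
        = (∏ j ∈ Finset.range N, (-w * (r ^ (j + 1))⁻¹))
          * ∏ j ∈ Finset.range N, (1 - r * w⁻¹ * r ^ j) := by
      rw [← Finset.prod_range_reflect, ← Finset.prod_mul_distrib]
      refine Finset.prod_congr rfl fun j hj => ?_
      rw [Finset.mem_range] at hj
      have : r ^ N = r ^ (N - 1 - j) * r ^ (j + 1) := by rw [← pow_add]; congr 1; omega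
      rw [this]
      field_simp
      ring
    rw [two_mul, Finset.prod_range_add, e1, e2]
    ring
  have hpre : ∏ j ∈ Finset.range N, (-w * (r ^ (j + 1))⁻¹)
      = cexp (π * I * N + 2 * π * I * z * N - π * I * ω * N * (N + 1)) := by
    clear key hsplit
    induction N with
    | zero => simp
    | succ N ih =>
      rw [Finset.prod_range_succ, ih, ← neg_one_mul, ← Complex.exp_pi_mul_I, hw, hr, nomePow,
        ← Complex.exp_nat_mul, ← Complex.exp_neg, ← Complex.exp_add, ← Complex.exp_add,
        ← Complex.exp_add]
      congr 1
      push_cast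
      ring
  rw [hsplit, hpre] at key
  have key2 := congrArg (fun x => cexp (-(π * I * N + 2 * π * I * z * N - π * I * ω * N * (N + 1))) * x) key
  rw [← mul_assoc, ← Complex.exp_add, neg_add_cancel, Complex.exp_zero, one_mul] at key2
  rw [key2, tsum_eq_sum (s := Finset.Icc (-(N : ℤ)) N), Finset.mul_sum]
  · refine Finset.sum_nbij' (fun k : ℕ => (k : ℤ) - N) (fun κ : ℤ => (κ + N).toNat) ?_ ?_ ?_ ?_ ?_
    · intro k hk
      simp only [Finset.mem_range, Finset.mem_Icc] at *
      omega
    · intro k hk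
      simp only [Finset.mem_range, Finset.mem_Icc] at *
      omega
    · intro k hk
      simp
    · intro k hk
      simp only [Finset.mem_Icc] at *
      omega
    · intro k hk
      rw [Finset.mem_range] at hk
      have hc : -(N : ℤ) ≤ (k : ℤ) - N ∧ (k : ℤ) - N ≤ N := by omega
      rw [tripleCoeff, if_pos hc, show ((N : ℤ) + (k - N)).toNat = k by omega,
        show ((N : ℤ) - (k - N)).toNat = 2 * N - k by omega, mul_left_comm, mul_assoc, mul_left_comm,
        mul_left_comm, ← mul_assoc _ _ (_ * _), mul_comm (cexp _), mul_assoc]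
      congr 1
      rw [mul_pow, ← neg_one_mul, ← Complex.exp_pi_mul_I, hw, hr, nomePow, ← Complex.exp_add,
        ← Complex.exp_nat_mul, ← Complex.exp_nat_mul, ← Complex.exp_nat_mul, ← Complex.exp_neg,
        ← Complex.exp_nat_mul, jacobiTheta₂_term,
        ← Complex.exp_add, ← Complex.exp_add, ← Complex.exp_add]
      congr 1
      rw [Nat.cast_choose_two]
      push_cast
      ring
  · intro κ hκ
    rw [tripleCoeff, if_neg (by simpa using hκ), zero_mul]

theorem tendsto_finPoch {ω : ℂ} (hω : 0 < ω.im) :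
    Tendsto (finPoch (nomePow ω 1)) atTop (𝓝 (qPoch (nomePow ω 1) ω)) := by
  refine (tendsto_prod_qPoch (nomePow ω 1) hω).congr fun N => ?_
  exact Finset.prod_congr rfl fun j _ => by rw [pow_succ']

/-- Limit of the finite form. Since (r;r)_n converges to a nonzero limit, the coefficients are
uniformly bounded and tend to 1/(r;r)_∞, so dominated convergence applies against the theta series.
-/
theorem jacobi_triple_product (z : ℂ) {ω : ℂ} (hω : 0 < ω.im) :
    qPoch (nomePow ω 1) ω * thetaM (cexp (2 * π * I * z)) ω
      = jacobiTheta₂ (z + 1 / 2 - ω / 2) ω := by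
  set r := nomePow ω 1 with hr
  have hr1 : ‖r‖ < 1 := norm_nomePow_one_lt hω
  have hL := qPoch_nomePow_one_ne_zero hω
  have hf := tendsto_finPoch hω
  have hne := finPoch_ne_zero hr1
  obtain ⟨A, hA⟩ := (Metric.isBounded_range_of_tendsto _ hf).exists_norm_le
  obtain ⟨B, hB⟩ := (Metric.isBounded_range_of_tendsto _ (hf.inv₀ hL)).exists_norm_le
  have hA' : ∀ n, ‖finPoch r n‖ ≤ A := fun n => hA _ ⟨n, rfl⟩
  have hB' : ∀ n, ‖(finPoch r n)⁻¹‖ ≤ B := fun n => hB _ ⟨n, rfl⟩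
  have hA0 : 0 ≤ A := (norm_nonneg _).trans (hA' 0)
  have hB0 : 0 ≤ B := (norm_nonneg _).trans (hB' 0)
  have hbound : ∀ N κ, ‖tripleCoeff r N κ‖ ≤ A * (B * B) := by
    intro N κ
    rw [tripleCoeff]
    split_ifs
    · rw [div_eq_mul_inv, mul_inv, norm_mul, norm_mul]
      gcongr <;> first | exact hA' _ | exact hB' _
    · rw [norm_zero]; positivity
  have hlim : ∀ κ : ℤ, Tendsto (fun N => tripleCoeff r N κ) atTop (𝓝 (qPoch r ω)⁻¹) := by
    intro κ
    have h1 : Tendsto (fun N : ℕ => finPoch r (2 * N)) atTop (𝓝 (qPoch r ω)) :=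
      hf.comp (tendsto_id.const_mul_atTop' (by norm_num))
    have h2 : ∀ κ : ℤ, Tendsto (fun N : ℕ => finPoch r ((N : ℤ) + κ).toNat) atTop
        (𝓝 (qPoch r ω)) := fun κ => by
      refine hf.comp (tendsto_atTop.mpr fun b => ?_)
      filter_upwards [eventually_ge_atTop (b + κ.natAbs)] with N hN
      omega
    have h3 := h1.div ((h2 κ).mul (h2 (-κ))) (mul_ne_zero hL hL)
    rw [show qPoch r ω / (qPoch r ω * qPoch r ω) = (qPoch r ω)⁻¹ by field_simp] at h3
    refine h3.congr' ?_
    filter_upwards [eventually_ge_atTop κ.natAbs] with N hN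
    rw [tripleCoeff, if_pos (by omega)]
    rfl
  have hsum := ((summable_jacobiTheta₂_term_iff (z + 1 / 2 - ω / 2) ω).mpr hω).norm
  have ht := tendsto_tsum_of_dominated_convergence
    (f := fun N κ => tripleCoeff r N κ * jacobiTheta₂_term κ (z + 1 / 2 - ω / 2) ω)
    (hsum.mul_left (A * (B * B))) (fun κ => (hlim κ).mul_const _)
    (Eventually.of_forall fun N κ => by rw [norm_mul]; gcongr; exact hbound N κ)
  have ht2 := (tendsto_prod_qPoch (cexp (2 * π * I * z)) hω).mul
    (tendsto_prod_qPoch (r * (cexp (2 * π * I * z))⁻¹) hω)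
  have := tendsto_nhds_unique (ht2.congr fun N => prod_mul_prod_eq_tsum z hω N) ht
  rw [tsum_mul_left] at this
  rw [thetaM, this, ← mul_assoc, mul_inv_cancel₀ hL, one_mul]
  rfl

theorem thetaR_ne_zero {ω : ℂ} (hω : 0 < ω.im) : thetaR ω ≠ 0 :=
  div_ne_zero (nomePow_ne_zero _ _) (mul_ne_zero I_ne_zero (qPoch_nomePow_one_ne_zero hω))

/-- The product form of `θ₁`. -/
theorem thetaM_exp (z : ℂ) {ω : ℂ} (hω : 0 < ω.im) :
    thetaM (cexp (2 * π * I * z)) ω = thetaR ω * cexp (π * I * z) * theta1 z ω := by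
  have hL := qPoch_nomePow_one_ne_zero hω
  have h := jacobi_triple_product z hω
  have h2 : theta1 z ω = I * nomePow ω (1 / 8) * cexp (-(π * I * z))
      * jacobiTheta₂ (z + 1 / 2 - ω / 2) ω := by
    rw [theta1_eq_jacobiTheta₂, show z + 1 / 2 + ω / 2 = (z + 1 / 2 - ω / 2) + ω by ring,
      jacobiTheta₂_add_left', ← mul_assoc, ← Complex.exp_add, ← neg_mul]
    congr 1
    rw [show I * nomePow ω (1 / 8) = cexp (π / 2 * I) * nomePow ω (1 / 8) by
      rw [Complex.exp_pi_div_two_mul_I]]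
    rw [nomePow, ← Complex.exp_add, ← Complex.exp_add, ← neg_one_mul, ← Complex.exp_pi_mul_I,
      ← Complex.exp_add]
    congr 1
    ring
  rw [h2, ← h, thetaR]
  have h3 : nomePow ω (-1 / 8) * nomePow ω (1 / 8) = 1 := by
    rw [← nomePow_add]; norm_num [nomePow_zero]
  have h4 : cexp (π * I * z) * cexp (-(π * I * z)) = 1 := by
    rw [← Complex.exp_add, add_neg_cancel, Complex.exp_zero]
  have hI := I_ne_zero
  set T := thetaM (cexp (2 * π * I * z)) ω
  have h5 : nomePow ω (-1 / 8) / (I * qPoch (nomePow ω 1) ω) * cexp (π * I * z)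
      * (I * nomePow ω (1 / 8) * cexp (-(π * I * z)) * (qPoch (nomePow ω 1) ω * T))
      = (nomePow ω (-1 / 8) * nomePow ω (1 / 8)) * (cexp (π * I * z) * cexp (-(π * I * z))) * T := by
    generalize cexp (-(π * I * z)) = e
    field_simp
  rw [h5, h3, h4, one_mul, one_mul]


/-! ## Infinite products and the zeros of `θ₁` -/

/-- On a ball about 0 the terms are dominated by a multiple of ‖a i‖, so the product converges
locally uniformly. -/
theorem differentiable_tprod_one_sub_mul {ι : Type*} {a : ι → ℂ} (ha : Summable fun i => ‖a i‖) :
    Differentiable ℂ fun w => ∏' i, (1 - w * a i) := by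
  intro w₀
  have hK : IsOpen (Metric.ball (0 : ℂ) (‖w₀‖ + 1)) := Metric.isOpen_ball
  have h := Summable.hasProdLocallyUniformlyOn_one_add (f := fun i w => -(w * a i)) hK
    (ha.mul_left (‖w₀‖ + 1)) (Eventually.of_forall fun i x hx => by
      rw [norm_neg, norm_mul]
      have : ‖x‖ < ‖w₀‖ + 1 := by simpa using hx
      gcongr) (fun i => by fun_prop)
  rw [hasProdLocallyUniformlyOn_iff_tendstoLocallyUniformlyOn] at h
  have h2 := h.differentiableOn (Eventually.of_forall fun s => by
    have : Differentiable ℂ fun w : ℂ => ∏ i ∈ s, (1 + -(w * a i)) := by fun_prop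
    exact this.differentiableOn) hK
  have h3 := h2.differentiableAt (hK.mem_nhds (by simp : w₀ ∈ Metric.ball (0 : ℂ) (‖w₀‖ + 1)))
  simpa [sub_eq_add_neg] using h3

theorem differentiable_qPoch {ω : ℂ} (hω : 0 < ω.im) : Differentiable ℂ fun t => qPoch t ω := by
  simp only [qPoch_eq]
  refine differentiable_tprod_one_sub_mul ?_
  simp only [norm_pow]
  exact summable_geometric_of_lt_one (norm_nonneg _) (norm_nomePow_one_lt hω)

theorem qPoch_eq_mul (t : ℂ) {ω : ℂ} (hω : 0 < ω.im) :
    qPoch t ω = (1 - t) * qPoch (t * nomePow ω 1) ω := by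
  rw [qPoch_eq, qPoch_eq, tprod_eq_zero_mul']
  · simp [pow_succ', mul_assoc]
  · have := multipliable_one_sub_mul_pow (t * nomePow ω 1) (norm_nomePow_one_lt hω)
    simpa [pow_succ', mul_assoc] using this

/-- In the product form a factor vanishes only if exp(2πiz) is an integral power of the nome. -/
theorem theta1_ne_zero {z ω : ℂ} (hω : 0 < ω.im) (h : ∀ a b : ℤ, z ≠ a + b * ω) :
    theta1 z ω ≠ 0 := by
  have h1 : ∀ b : ℤ, cexp (2 * π * I * z) * nomePow ω b ≠ 1 := by
    intro b hb
    rw [nomePow, ← Complex.exp_add, Complex.exp_eq_one_iff] at hb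
    obtain ⟨a, ha⟩ := hb
    apply h a (-b)
    have h2 : (2 * π * I : ℂ) * (z + ω * b - a) = 0 := by linear_combination ha
    have h3 := (mul_eq_zero.mp h2).resolve_left Complex.two_pi_I_ne_zero
    push_cast
    linear_combination h3
  have h2 : thetaM (cexp (2 * π * I * z)) ω ≠ 0 := by
    refine mul_ne_zero (qPoch_ne_zero hω fun k => ?_) (qPoch_ne_zero hω fun k => ?_)
    · rw [← nomePow_natCast]
      exact_mod_cast h1 k
    · intro hk
      apply h1 (-(k + 1 : ℤ))
      have e : nomePow ω (k + 1) * nomePow ω (-(k + 1)) = 1 := by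
        rw [← nomePow_add, add_neg_cancel, nomePow_zero]
      have hw : cexp (2 * π * I * z) ≠ 0 := Complex.exp_ne_zero _
      rw [mul_right_comm, ← pow_succ', ← nomePow_natCast_add_one] at hk
      push_cast
      field_simp at hk
      rw [← hk, e]
  rw [thetaM_exp z hω] at h2
  exact right_ne_zero_of_mul h2

/-- In the product form the factor 1 - exp(2πiz) has a simple zero at 0, and the remaining factors
take the value (r;r)_∞² ≠ 0 there. -/
theorem deriv_theta1_zero_ne_zero {ω : ℂ} (hω : 0 < ω.im) :
    deriv (fun z => theta1 z ω) 0 ≠ 0 := by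
  have hd := (differentiable_theta1 hω 0).hasDerivAt
  have hP := differentiable_qPoch hω
  have hL := qPoch_nomePow_one_ne_zero hω
  have h1 : ∀ z, thetaR ω * cexp (π * I * z) * theta1 z ω
      = (1 - cexp (2 * π * I * z)) * (qPoch (cexp (2 * π * I * z) * nomePow ω 1) ω
        * qPoch (nomePow ω 1 * cexp (-(2 * π * I * z))) ω) := fun z => by
    rw [← thetaM_exp z hω, thetaM, qPoch_eq_mul _ hω, Complex.exp_neg, mul_assoc]
  have hQ : DifferentiableAt ℂ (fun z => qPoch (cexp (2 * π * I * z) * nomePow ω 1) ω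
        * qPoch (nomePow ω 1 * cexp (-(2 * π * I * z))) ω) 0 := by
    have a1 : Differentiable ℂ fun z => qPoch (cexp (2 * π * I * z) * nomePow ω 1) ω :=
      hP.comp (by fun_prop : Differentiable ℂ fun z => cexp (2 * π * I * z) * nomePow ω 1)
    have a2 : Differentiable ℂ fun z => qPoch (nomePow ω 1 * cexp (-(2 * π * I * z))) ω :=
      hP.comp (by fun_prop : Differentiable ℂ fun z => nomePow ω 1 * cexp (-(2 * π * I * z)))
    exact (a1.mul a2) 0
  have he : HasDerivAt (fun z : ℂ => 1 - cexp (2 * π * I * z)) (-(2 * π * I)) 0 := by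
    have := (((hasDerivAt_id (0 : ℂ)).const_mul (2 * π * I)).cexp).const_sub 1
    simpa using this
  have hf : DifferentiableAt ℂ (fun z : ℂ => thetaR ω * cexp (π * I * z)) 0 := by fun_prop
  have hl := hf.hasDerivAt.mul hd
  have hr := he.mul hQ.hasDerivAt
  have hfun : ((fun z : ℂ => thetaR ω * cexp (π * I * z)) * fun z => theta1 z ω)
    = ((fun z : ℂ => 1 - cexp (2 * π * I * z)) * fun z =>
      qPoch (cexp (2 * π * I * z) * nomePow ω 1) ω
        * qPoch (nomePow ω 1 * cexp (-(2 * π * I * z))) ω) := funext h1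
  rw [hfun] at hl
  have := hl.unique hr
  intro h0
  rw [h0, theta1_zero] at this
  simp only [mul_zero, neg_zero, Complex.exp_zero, mul_one, one_mul, sub_self, zero_mul, add_zero]
    at this
  exact mul_ne_zero (neg_ne_zero.mpr Complex.two_pi_I_ne_zero) (mul_ne_zero hL hL) this.symm

/-- Every zero is a lattice translate of 0, and quasi-periodicity carries the derivative at 0 there
up to a nonvanishing factor. -/
theorem deriv_theta1_ne_zero {z ω : ℂ} (hω : 0 < ω.im) (h : theta1 z ω = 0) :
    deriv (fun z => theta1 z ω) z ≠ 0 := by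
  obtain ⟨a, b, rfl⟩ : ∃ a b : ℤ, z = a + b * ω := by
    by_contra! hc
    exact theta1_ne_zero hω hc h
  have hd := (differentiable_theta1 hω 0).hasDerivAt
  have hg : DifferentiableAt ℂ (fun u : ℂ => (-1 : ℂ) ^ b * cexp (-(π * I * b ^ 2 * ω)
      - 2 * π * I * b * u) * (-1) ^ a) 0 := by fun_prop
  have h1 := hg.hasDerivAt.mul hd
  have h2 : HasDerivAt (fun u => theta1 (u + (a + b * ω)) ω)
      (deriv (fun z => theta1 z ω) (a + b * ω)) 0 := by
    have := (differentiable_theta1 hω (0 + (a + b * ω))).hasDerivAt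
    have := HasDerivAt.comp_add_const (0 : ℂ) (a + b * ω) this
    rwa [zero_add] at this
  have hfun : (fun u => theta1 (u + (a + b * ω)) ω) = (fun u : ℂ => (-1 : ℂ) ^ b
      * cexp (-(π * I * b ^ 2 * ω) - 2 * π * I * b * u) * (-1) ^ a) * fun z => theta1 z ω := by
    ext u
    simp only [Pi.mul_apply]
    have e : cexp (2 * π * I * (b * a)) = 1 := by
      have := exp_two_pi_mul_I_int (b * a)
      push_cast at this
      exact this
    rw [← add_assoc, theta1_add_int_mul, theta1_add_int,
      show -(π * I * b ^ 2 * ω) - 2 * π * I * b * (u + a)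
        = -(π * I * b ^ 2 * ω) - 2 * π * I * b * u - 2 * π * I * (b * a) by ring,
      Complex.exp_sub _ (2 * π * I * (b * a)), e]
    ring
  rw [hfun] at h2
  rw [h2.unique h1, theta1_zero, mul_zero, zero_add]
  refine mul_ne_zero (mul_ne_zero (mul_ne_zero ?_ (Complex.exp_ne_zero _)) ?_)
    (deriv_theta1_zero_ne_zero hω) <;> exact zpow_ne_zero _ (by norm_num)

/-! ## Division by functions with simple zeros -/

/-- The quotient `f/D`, continued to simple zeros of `D` at which `f` vanishes. -/
noncomputable def divExt (f D : ℂ → ℂ) (x : ℂ) : ℂ :=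
  if D x = 0 then deriv f x / deriv D x else f x / D x

theorem mul_divExt {f D : ℂ → ℂ} {x : ℂ} (h : D x = 0 → f x = 0) : D x * divExt f D x = f x := by
  rw [divExt]
  split_ifs with h0
  · rw [h0, h h0, zero_mul]
  · field_simp

/-- Near a zero x of D both functions are y - x times their `dslope`, so the quotient is a quotient
of slopes whose denominator at x is D'(x) ≠ 0. -/
theorem differentiableOn_divExt {f D : ℂ → ℂ} {U : Set ℂ} (hU : IsOpen U)
    (hf : DifferentiableOn ℂ f U) (hD : DifferentiableOn ℂ D U)
    (h0 : ∀ x ∈ U, D x = 0 → f x = 0) (h1 : ∀ x ∈ U, D x = 0 → deriv D x ≠ 0) :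
    DifferentiableOn ℂ (divExt f D) U := by
  intro x hx
  refine DifferentiableAt.differentiableWithinAt ?_
  have hxU := hU.mem_nhds hx
  by_cases hDx : D x = 0
  · have hfs := (Complex.differentiableOn_dslope hxU).mpr hf
    have hDs := (Complex.differentiableOn_dslope hxU).mpr hD
    have hne : dslope D x x ≠ 0 := by rw [dslope_same]; exact h1 x hx hDx
    have hev : ∀ᶠ y in 𝓝 x, dslope D x y ≠ 0 :=
      (hDs.differentiableAt hxU).continuousAt.eventually_ne hne
    refine ((hfs.differentiableAt hxU).div (hDs.differentiableAt hxU) hne).congr_of_eventuallyEq ?_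
    filter_upwards [hev] with y hy
    by_cases hyx : y = x
    · subst hyx
      simp only [Pi.div_apply, dslope_same, divExt, if_pos hDx]
    · have e1 := sub_smul_dslope f x y
      have e2 := sub_smul_dslope D x y
      rw [hDx, sub_zero, smul_eq_mul] at e2
      rw [h0 x hx hDx, sub_zero, smul_eq_mul] at e1
      have hyx' := sub_ne_zero.mpr hyx
      have hDy : D y ≠ 0 := by rw [← e2]; exact mul_ne_zero hyx' hy
      rw [divExt, if_neg hDy, ← e1, ← e2, Pi.div_apply]
      field_simp
  · have hDc := (hD.differentiableAt hxU)
    refine ((hf.differentiableAt hxU).div hDc hDx).congr_of_eventuallyEq ?_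
    filter_upwards [hDc.continuousAt.eventually_ne hDx] with y hy
    rw [divExt, if_neg hy, Pi.div_apply]

/-- Entire functions form an integral domain. This lets functional equations pass from a product to
one of its factors. -/
theorem eq_zero_of_mul_eq_zero {D f : ℂ → ℂ} (hD : Differentiable ℂ D) (hf : Differentiable ℂ f)
    {x₀ : ℂ} (h0 : D x₀ ≠ 0) (h : ∀ x, D x * f x = 0) (x : ℂ) : f x = 0 := by
  have hD' : AnalyticOnNhd ℂ D Set.univ := fun x _ => hD.analyticAt x
  have hf' : AnalyticOnNhd ℂ f Set.univ := fun x _ => hf.analyticAt x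
  rcases AnalyticOnNhd.eq_zero_or_eq_zero_of_mul_eq_zero hD' hf' (fun x _ => h x)
    isPreconnected_univ with h1 | h1
  · exact absurd (h1 x₀ (Set.mem_univ _)) h0
  · exact h1 x (Set.mem_univ _)


/-! ## Spaces of theta functions -/

theorem IsThetaFunction.mul {ω : ℂ} {M N : ℤ} {F G : ℂ → ℂ} (hF : IsThetaFunction ω M F)
    (hG : IsThetaFunction ω N G) : IsThetaFunction ω (M + N) fun x => F x * G x where
  holomorphic := hF.holomorphic.mul hG.holomorphic
  period_one z := by rw [hF.period_one, hG.period_one]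
  quasiPeriod z a := by
    dsimp only
    rw [hF.quasiPeriod, hG.quasiPeriod, mul_mul_mul_comm, ← Complex.exp_add]
    congr 2
    push_cast
    ring

theorem IsThetaFunction.const_mul {ω : ℂ} {N : ℤ} {F : ℂ → ℂ} (hF : IsThetaFunction ω N F)
    (c : ℂ) : IsThetaFunction ω N fun x => c * F x where
  holomorphic := hF.holomorphic.const_mul c
  period_one z := by rw [hF.period_one]
  quasiPeriod z a := by
    dsimp only
    rw [hF.quasiPeriod, mul_left_comm]

theorem IsThetaFunction.add {ω : ℂ} {N : ℤ} {F G : ℂ → ℂ} (hF : IsThetaFunction ω N F)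
    (hG : IsThetaFunction ω N G) : IsThetaFunction ω N fun x => F x + G x where
  holomorphic := hF.holomorphic.add hG.holomorphic
  period_one z := by rw [hF.period_one, hG.period_one]
  quasiPeriod z a := by
    dsimp only
    rw [hF.quasiPeriod, hG.quasiPeriod, ← mul_add]

theorem IsThetaFunction.comp_neg {ω : ℂ} {N : ℤ} {F : ℂ → ℂ} (hF : IsThetaFunction ω N F) :
    IsThetaFunction ω N fun x => F (-x) where
  holomorphic := hF.holomorphic.comp differentiable_neg
  period_one z := by
    have := hF.period_one (-(z + 1))
    rw [← this]; congr 1; ring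
  quasiPeriod z a := by
    dsimp only
    have := hF.quasiPeriod (-z) (-a)
    rw [show -(z + ω * a) = -z + ω * ((-a : ℤ) : ℂ) by push_cast; ring, this]
    congr 2
    push_cast
    ring

theorem isThetaFunction_zero (ω : ℂ) (N : ℤ) : IsThetaFunction ω N fun _ => 0 where
  holomorphic := differentiable_const 0
  period_one _ := rfl
  quasiPeriod z a := by rw [mul_zero]

theorem isThetaFunction_one (ω : ℂ) : IsThetaFunction ω 0 fun _ => 1 where
  holomorphic := differentiable_const 1
  period_one _ := rfl
  quasiPeriod z a := by simp

theorem isThetaFunction_sum {ι : Type*} {ω : ℂ} {N : ℤ} (s : Finset ι) {F : ι → ℂ → ℂ}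
    (h : ∀ i ∈ s, IsThetaFunction ω N (F i)) : IsThetaFunction ω N fun x => ∑ i ∈ s, F i x := by
  classical
  induction s using Finset.induction_on with
  | empty => simpa using isThetaFunction_zero ω N
  | insert i s hi ih =>
    simp only [Finset.sum_insert hi]
    exact (h i (Finset.mem_insert_self i s)).add
      (ih fun j hj => h j (Finset.mem_insert_of_mem hj))

theorem isThetaFunction_prod {ι : Type*} {ω : ℂ} (s : Finset ι) {F : ι → ℂ → ℂ}
    (h : ∀ i ∈ s, IsThetaFunction ω 1 (F i)) :
    IsThetaFunction ω s.card fun x => ∏ i ∈ s, F i x := by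
  classical
  induction s using Finset.induction_on with
  | empty => simpa using isThetaFunction_one ω
  | insert i s hi ih =>
    simp only [Finset.prod_insert hi]
    have := (h i (Finset.mem_insert_self i s)).mul
      (ih fun j hj => h j (Finset.mem_insert_of_mem hj))
    rwa [Finset.card_insert_of_notMem hi, Nat.cast_succ, add_comm]

/-- The even theta function of order two with zeros at `±y`. -/
noncomputable def thetaDiff (ω x y : ℂ) : ℂ := theta1 (x - y) ω * theta1 (x + y) ω

theorem thetaDiff_comm (ω x y : ℂ) : thetaDiff ω x y = -thetaDiff ω y x := by
  rw [thetaDiff, thetaDiff, ← neg_sub y x, theta1_neg, add_comm x y, neg_mul]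

theorem thetaDiff_neg (ω x y : ℂ) : thetaDiff ω (-x) y = thetaDiff ω x y := by
  rw [thetaDiff, thetaDiff, show -x - y = -(x + y) by ring, show -x + y = -(x - y) by ring,
    theta1_neg, theta1_neg, neg_mul_neg, mul_comm]

theorem thetaDiff_self (ω y : ℂ) : thetaDiff ω y y = 0 := by
  rw [thetaDiff, sub_self, theta1_zero, zero_mul]

theorem isThetaFunction_thetaDiff {ω : ℂ} (hω : 0 < ω.im) (y : ℂ) :
    IsThetaFunction ω 1 fun x => thetaDiff ω x y where
  holomorphic := by
    have h := differentiable_theta1 hω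
    have h1 : Differentiable ℂ fun x => theta1 (x - y) ω :=
      h.comp (by fun_prop : Differentiable ℂ fun x : ℂ => x - y)
    have h2 : Differentiable ℂ fun x => theta1 (x + y) ω :=
      h.comp (by fun_prop : Differentiable ℂ fun x : ℂ => x + y)
    exact h1.mul h2
  period_one z := by
    rw [thetaDiff, thetaDiff, show z + 1 - y = z - y + 1 by ring,
      show z + 1 + y = z + y + 1 by ring, theta1_add_one, theta1_add_one, neg_mul_neg]
  quasiPeriod z a := by
    dsimp only
    have e : ((-1 : ℂ) ^ a) * (-1) ^ a = 1 := by rw [← mul_zpow]; simp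
    rw [thetaDiff, thetaDiff, show z + ω * a - y = z - y + a * ω by ring,
      show z + ω * a + y = z + y + a * ω by ring, theta1_add_int_mul, theta1_add_int_mul]
    rw [show ∀ s A B C D : ℂ, s * A * B * (s * C * D) = (s * s) * (A * C) * (B * D) by
      intros; ring, e, one_mul, ← Complex.exp_add]
    congr 2
    push_cast
    ring

/-- Liouville's theorem: at order zero both periods are exact, so all values are attained on a
compact rectangle. A multiple of ω adjusts the imaginary part first, then an integer the real part.
-/
theorem IsThetaFunction.eq_of_order_zero {ω : ℂ} (hω : 0 < ω.im) {F : ℂ → ℂ}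
    (hF : IsThetaFunction ω 0 F) (x y : ℂ) : F x = F y := by
  refine hF.holomorphic.apply_eq_apply_of_bounded ?_ x y
  have hK : IsCompact (Set.Icc (0 : ℝ) 1 ×ℂ Set.Icc (0 : ℝ) ω.im) :=
    isCompact_Icc.reProdIm isCompact_Icc
  refine (hK.image hF.holomorphic.continuous).isBounded.subset ?_
  rintro _ ⟨z, rfl⟩
  have hper : ∀ (z : ℂ) (a : ℤ), F (z + a) = F z := fun z a => by
    have h := Function.Periodic.int_mul (f := F) (c := 1) hF.period_one a z
    rwa [mul_one] at h
  have hq : ∀ (z : ℂ) (a : ℤ), F (z + ω * a) = F z := fun z a => by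
    rw [hF.quasiPeriod]; simp
  set b : ℤ := ⌊z.im / ω.im⌋ with hb
  set u := z + ω * ((-b : ℤ) : ℂ) with hu
  set a : ℤ := ⌊u.re⌋ with ha
  refine ⟨u + ((-a : ℤ) : ℂ), ?_, by rw [hper, hu, hq]⟩
  rw [Complex.mem_reProdIm]
  have him : (u + ((-a : ℤ) : ℂ)).im = z.im - ω.im * b := by
    simp [hu]; ring
  have hre : (u + ((-a : ℤ) : ℂ)).re = u.re - a := by simp; ring
  rw [him, hre]
  have h1 := Int.floor_le (z.im / ω.im)
  have h2 := Int.lt_floor_add_one (z.im / ω.im)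
  rw [← hb] at h1 h2
  rw [le_div_iff₀ hω] at h1
  rw [div_lt_iff₀ hω] at h2
  have h3 := Int.floor_le u.re
  have h4 := Int.lt_floor_add_one u.re
  exact ⟨⟨by linarith, by linarith⟩, ⟨by linarith, by linarith⟩⟩

theorem exists_theta1_ne_zero {ω : ℂ} (hω : 0 < ω.im) : theta1 (1 / 2) ω ≠ 0 := by
  refine theta1_ne_zero hω fun a b h => ?_
  have h1 := congrArg Complex.im h
  have h2 := congrArg Complex.re h
  simp at h1
  rcases h1 with h1 | h1
  · rw [h1] at h2
    simp at h2
    have : (1 : ℝ) = 2 * a := by linarith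
    norm_cast at this
    omega
  · exact hω.ne' h1

/-- Multiplication by θ₁(x)² gives order zero, hence a constant, and this constant vanishes at x =
0. -/
theorem IsThetaFunction.eq_zero_of_order_neg_one {ω : ℂ} (hω : 0 < ω.im) {F : ℂ → ℂ}
    (hF : IsThetaFunction ω (-1) F) (x : ℂ) : F x = 0 := by
  have hD := isThetaFunction_thetaDiff hω 0
  have h := hD.mul hF
  refine eq_zero_of_mul_eq_zero hD.holomorphic hF.holomorphic (x₀ := 1 / 2) ?_ (fun x => ?_) x
  · rw [thetaDiff, sub_zero, add_zero]
    exact mul_ne_zero (exists_theta1_ne_zero hω) (exists_theta1_ne_zero hω)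
  · have := IsThetaFunction.eq_of_order_zero hω h x 0
    rw [this, thetaDiff_self, zero_mul]

theorem thetaDiff_eq_zero {ω x y : ℂ} (hω : 0 < ω.im) (h : thetaDiff ω x y = 0) :
    ∃ a b : ℤ, x = y + (a + b * ω) ∨ x = -y + (a + b * ω) := by
  rcases mul_eq_zero.mp h with h | h
  · by_contra! hc
    exact theta1_ne_zero hω (fun a b e => (hc a b).1 (by linear_combination e)) h
  · by_contra! hc
    exact theta1_ne_zero hω (fun a b e => (hc a b).2 (by linear_combination e)) h

theorem IsThetaFunction.apply_add_lattice {ω : ℂ} {N : ℤ} {F : ℂ → ℂ}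
    (hF : IsThetaFunction ω N F) (x : ℂ) (h : F x = 0) (a b : ℤ) : F (x + (a + b * ω)) = 0 := by
  have h1 := Function.Periodic.int_mul (f := F) (c := 1) hF.period_one a (x + ω * b)
  rw [mul_one] at h1
  rw [show x + (a + b * ω) = x + ω * b + a by ring, h1, hF.quasiPeriod, h, mul_zero]

/-- An even theta function vanishing at a generic point is divisible by `thetaDiff`. -/
theorem IsThetaFunction.exists_eq_thetaDiff_mul {ω : ℂ} (hω : 0 < ω.im) {N : ℤ} {F : ℂ → ℂ}
    (hF : IsThetaFunction ω N F) (heven : ∀ x, F (-x) = F x) {y : ℂ}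
    (hy : theta1 (2 * y) ω ≠ 0) (h0 : F y = 0) :
    ∃ G, IsThetaFunction ω (N - 1) G ∧ (∀ x, G (-x) = G x) ∧ ∀ x, F x = thetaDiff ω x y * G x := by
  set D : ℂ → ℂ := fun x => thetaDiff ω x y with hDdef
  have hDt := isThetaFunction_thetaDiff hω y
  have hDd : Differentiable ℂ D := hDt.holomorphic
  have hvan : ∀ x, D x = 0 → F x = 0 := by
    intro x hx
    obtain ⟨a, b, h | h⟩ := thetaDiff_eq_zero hω hx
    · rw [h]; exact hF.apply_add_lattice y h0 a b
    · rw [h]; exact hF.apply_add_lattice (-y) (by rw [heven, h0]) a b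
  have hθ := differentiable_theta1 hω
  -- Since 2y is not a zero of θ₁, the two factors of D have no common zero, so all zeros of D are
  -- simple.
  have hder : ∀ x, D x = 0 → deriv D x ≠ 0 := by
    intro x hx
    have e1 : HasDerivAt (fun x => theta1 (x - y) ω) (deriv (fun z => theta1 z ω) (x - y)) x := by
      have := (hθ (x - y)).hasDerivAt
      exact HasDerivAt.comp_sub_const x y this
    have e2 : HasDerivAt (fun x => theta1 (x + y) ω) (deriv (fun z => theta1 z ω) (x + y)) x := by
      have := (hθ (x + y)).hasDerivAt
      exact HasDerivAt.comp_add_const x y this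
    have e3 : deriv D x = _ := (e1.mul e2).deriv
    rw [e3]
    have hnot : ∀ u, theta1 u ω = 0 → theta1 (u + 2 * y) ω ≠ 0 := by
      intro u hu h2
      obtain ⟨a, b, hab⟩ : ∃ a b : ℤ, u = a + b * ω := by
        by_contra! hc
        exact theta1_ne_zero hω hc hu
      rw [hab, show (a : ℂ) + b * ω + 2 * y = 2 * y + a + b * ω by ring, theta1_add_int_mul,
        theta1_add_int] at h2
      exact mul_ne_zero (mul_ne_zero (zpow_ne_zero _ (by norm_num)) (Complex.exp_ne_zero _))
        (mul_ne_zero (zpow_ne_zero _ (by norm_num)) hy) h2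
    rcases mul_eq_zero.mp hx with h | h
    · rw [h, zero_mul, add_zero]
      refine mul_ne_zero (deriv_theta1_ne_zero hω h) ?_
      have := hnot _ h
      rwa [show x - y + 2 * y = x + y by ring] at this
    · rw [h, mul_zero, zero_add]
      refine mul_ne_zero (fun h2 => ?_) (deriv_theta1_ne_zero hω h)
      have := hnot _ h2
      rw [show x - y + 2 * y = x + y by ring] at this
      exact this h
  have hGd : Differentiable ℂ (divExt F D) := by
    rw [← differentiableOn_univ]
    exact differentiableOn_divExt isOpen_univ hF.holomorphic.differentiableOn
      hDd.differentiableOn (fun x _ => hvan x) (fun x _ => hder x)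
  have hmul : ∀ x, D x * divExt F D x = F x := fun x => mul_divExt (hvan x)
  obtain ⟨x₀, hx₀⟩ : ∃ x₀, D x₀ ≠ 0 := by
    by_contra! hc
    have : D = fun _ => 0 := funext hc
    exact hder y (hc y) (by rw [this]; simp)
  -- Each law of the quotient is checked after multiplication by D, where it becomes a law of F.
  have hcancel : ∀ f : ℂ → ℂ, Differentiable ℂ f → (∀ x, D x * f x = 0) → ∀ x, f x = 0 :=
    fun f hf h => eq_zero_of_mul_eq_zero hDd hf hx₀ h
  have hDneg : ∀ x, D (-x) = D x := fun x => thetaDiff_neg ω x y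
  refine ⟨divExt F D, ⟨hGd, ?_, ?_⟩, ?_, fun x => (hmul x).symm⟩
  · intro z
    have := hcancel (fun z => divExt F D (z + 1) - divExt F D z) (by fun_prop) (fun x => by
      have e1 := hmul (x + 1)
      have e2 := hmul x
      have e3 : D (x + 1) = D x := hDt.period_one x
      rw [e3, hF.period_one] at e1
      linear_combination e1 - e2) z
    exact sub_eq_zero.mp this
  · intro z a
    have := hcancel (fun z => divExt F D (z + ω * a)
      - cexp (-2 * (N - 1 : ℤ) * a * (π * I * ω * a + 2 * π * I * z)) * divExt F D z)
      (by fun_prop) (fun x => by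
      have e1 := hmul (x + ω * a)
      have e2 := hmul x
      have e3 : D (x + ω * a) = _ * D x := hDt.quasiPeriod x a
      rw [e3, hF.quasiPeriod, ← e2,
        show (-2 * (N : ℂ) * a * (π * I * ω * a + 2 * π * I * x))
          = (-2 * ((1 : ℤ) : ℂ) * a * (π * I * ω * a + 2 * π * I * x))
          + (-2 * ((N - 1 : ℤ) : ℂ) * a * (π * I * ω * a + 2 * π * I * x)) by push_cast; ring,
        Complex.exp_add] at e1
      refine mul_left_cancel₀ (Complex.exp_ne_zero
        (-2 * ((1 : ℤ) : ℂ) * a * (π * I * ω * a + 2 * π * I * x))) ?_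
      linear_combination e1) z
    exact sub_eq_zero.mp this
  · intro z
    have := hcancel (fun z => divExt F D (-z) - divExt F D z) (by fun_prop) (fun x => by
      have e1 := hmul (-x)
      have e2 := hmul x
      rw [hDneg, heven] at e1
      linear_combination e1 - e2) z
    exact sub_eq_zero.mp this

/-- An even theta function of order 2N is determined by N+1 generic values: every zero splits off a
`thetaDiff` and lowers the order by two, until order -2 leaves only the zero function. -/
theorem IsThetaFunction.eq_zero_of_even {ι : Type*} {ω : ℂ} (hω : 0 < ω.im) {x : ι → ℂ}
    (s : Finset ι) {F : ℂ → ℂ} (hF : IsThetaFunction ω (s.card - 1) F)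
    (heven : ∀ u, F (-u) = F u) (hx : ∀ i ∈ s, theta1 (2 * x i) ω ≠ 0)
    (hxx : ∀ i ∈ s, ∀ j ∈ s, i ≠ j → thetaDiff ω (x i) (x j) ≠ 0)
    (h0 : ∀ i ∈ s, F (x i) = 0) (u : ℂ) : F u = 0 := by
  classical
  induction s using Finset.induction_on generalizing F with
  | empty => exact IsThetaFunction.eq_zero_of_order_neg_one hω (by simpa using hF) u
  | insert i s hi ih =>
    obtain ⟨G, hG, hGe, hFG⟩ := hF.exists_eq_thetaDiff_mul hω heven
      (hx i (Finset.mem_insert_self i s)) (h0 i (Finset.mem_insert_self i s))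
    rw [hFG, ih (F := G) ?_ hGe (fun j hj => hx j (Finset.mem_insert_of_mem hj))
      (fun j hj k hk => hxx j (Finset.mem_insert_of_mem hj) k (Finset.mem_insert_of_mem hk)) ?_,
      mul_zero]
    · rw [Finset.card_insert_of_notMem hi] at hG
      push_cast at hG
      rwa [add_sub_cancel_right] at hG
    · intro j hj
      have h1 := h0 j (Finset.mem_insert_of_mem hj)
      rw [hFG] at h1
      exact (mul_eq_zero.mp h1).resolve_left (hxx j (Finset.mem_insert_of_mem hj) i
        (Finset.mem_insert_self i s) (by rintro rfl; exact hi hj))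

/-- The residue theorem for the elliptic function `F(x) θ₁(2x) / ∏ thetaDiff ω x (x i)`. -/
theorem IsThetaFunction.sum_div_prod_eq_zero {ι : Type*} [DecidableEq ι] {ω : ℂ} (hω : 0 < ω.im)
    {x : ι → ℂ} (s : Finset ι) {F : ℂ → ℂ} (hF : IsThetaFunction ω (s.card - 2) F)
    (heven : ∀ u, F (-u) = F u) (hx : ∀ i ∈ s, theta1 (2 * x i) ω ≠ 0)
    (hxx : ∀ i ∈ s, ∀ j ∈ s, i ≠ j → thetaDiff ω (x i) (x j) ≠ 0) :
    ∑ i ∈ s, F (x i) / ∏ j ∈ s.erase i, thetaDiff ω (x i) (x j) = 0 := by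
  rcases s.eq_empty_or_nonempty with rfl | ⟨a, ha⟩
  · simp
  -- Interpolation takes the place of a contour integral. One node a is set aside; F equals the
  -- Lagrange interpolant, built from `thetaDiff`, of its values at the other nodes, and evaluation
  -- at the node a gives the identity.
  obtain ⟨t, hat, rfl⟩ : ∃ t, a ∉ t ∧ s = insert a t :=
    ⟨s.erase a, Finset.notMem_erase a s, (Finset.insert_erase ha).symm⟩
  have hane : ∀ i ∈ t, a ≠ i := by rintro i hi rfl; exact hat hi
  have hne : ∀ i ∈ t, thetaDiff ω (x a) (x i) ≠ 0 := fun i hi =>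
    hxx a (Finset.mem_insert_self a t) i (Finset.mem_insert_of_mem hi) (hane i hi)
  have hP : ∀ i ∈ t, ∏ j ∈ t.erase i, thetaDiff ω (x i) (x j) ≠ 0 := fun i hi =>
    Finset.prod_ne_zero_iff.mpr fun j hj => hxx i (Finset.mem_insert_of_mem hi) j
      (Finset.mem_insert_of_mem (Finset.mem_of_mem_erase hj)) (Finset.ne_of_mem_erase hj).symm
  set c : ι → ℂ := fun i => F (x i) / ∏ j ∈ t.erase i, thetaDiff ω (x i) (x j) with hc
  have hcard : ((insert a t).card : ℤ) - 2 = t.card - 1 := by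
    rw [Finset.card_insert_of_notMem hat]; push_cast; ring
  rw [hcard] at hF
  have hL : IsThetaFunction ω (t.card - 1)
      fun u => ∑ i ∈ t, c i * ∏ j ∈ t.erase i, thetaDiff ω u (x j) := by
    refine isThetaFunction_sum t fun i hi => IsThetaFunction.const_mul ?_ _
    have := isThetaFunction_prod (t.erase i) (F := fun j u => thetaDiff ω u (x j))
      fun j _ => isThetaFunction_thetaDiff hω (x j)
    rwa [Finset.card_erase_of_mem hi, Nat.cast_sub (Finset.card_pos.mpr ⟨i, hi⟩),
      Nat.cast_one] at this
  have hfl := hF.add (hL.const_mul (-1))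
  have hzero := IsThetaFunction.eq_zero_of_even hω (x := x) t hfl (fun u => by
      simp only [heven, thetaDiff_neg]) (fun i hi => hx i (Finset.mem_insert_of_mem hi))
      (fun i hi j hj => hxx i (Finset.mem_insert_of_mem hi) j (Finset.mem_insert_of_mem hj))
      (fun i hi => by
        rw [Finset.sum_eq_single_of_mem i hi fun k hk hki => ?_]
        · simp only [hc]
          have := hP i hi
          field_simp
          ring
        · rw [Finset.prod_eq_zero (Finset.mem_erase.mpr ⟨hki.symm, hi⟩) (thetaDiff_self ω (x i)),
            mul_zero]) (x a)
  rw [Finset.sum_insert hat, Finset.erase_insert hat]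
  have hPa : ∏ j ∈ t, thetaDiff ω (x a) (x j) ≠ 0 := Finset.prod_ne_zero_iff.mpr hne
  have hFa : F (x a) = ∑ i ∈ t, c i * ∏ j ∈ t.erase i, thetaDiff ω (x a) (x j) := by
    linear_combination hzero
  rw [hFa, Finset.sum_div, ← Finset.sum_add_distrib]
  refine Finset.sum_eq_zero fun i hi => ?_
  rw [Finset.erase_insert_of_ne (hane i hi), Finset.prod_insert (fun h =>
    hat (Finset.mem_of_mem_erase h)), ← Finset.mul_prod_erase t _ hi, thetaDiff_comm ω (x i) (x a)]
  have h1 := hP i hi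
  have h2 := hne i hi
  have h3 : ∏ j ∈ t.erase i, thetaDiff ω (x a) (x j) ≠ 0 :=
    Finset.prod_ne_zero_iff.mpr fun j hj => hne j (Finset.mem_of_mem_erase hj)
  simp only [hc]
  field_simp
  ring


/-! ## The sums over shifts -/

/-- The sum `∑_{k=0}^n (-1)^k α_k^{(n)}(z) F(z+(n-2k)s)`. -/
noncomputable def coreSum (s ω : ℂ) (n : ℕ) (F : ℂ → ℂ) (z : ℂ) : ℂ :=
  ∑ k ∈ Finset.range (n + 1), (-1) ^ k * shiftCoeff s ω n k z * F (z + (n - 2 * k) * s)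

/-- The normalized half-period shift of a function with the transformation law of modulus `ω` and
order `2N`; it depends on `β` only through its parity. -/
noncomputable def halfShift (ω : ℂ) (N β : ℤ) (F : ℂ → ℂ) (x : ℂ) : ℂ :=
  cexp (π * I * ω / 2 * β ^ 2 * N) * cexp (2 * π * I * β * N * x) * F (x + β * (ω / 2))

/-- Mω/2 and βω/2 differ by a full period, because M - β is even. -/
theorem HasThetaQuasiPeriod.apply_add_half {ω : ℂ} {N : ℤ} {F : ℂ → ℂ}
    (hF : HasThetaQuasiPeriod ω N F) {M β : ℤ} (h : Even (M - β)) (x : ℂ) :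
    F (x + M * (ω / 2))
      = cexp (-(N * (π * I * ω * M ^ 2 / 2 + 2 * π * I * M * x))) * halfShift ω N β F x := by
  obtain ⟨a, ha⟩ := h
  obtain rfl : M = β + 2 * a := by omega
  rw [show x + ((β + 2 * a : ℤ) : ℂ) * (ω / 2) = (x + β * (ω / 2)) + ω * a by push_cast; ring,
    hF, halfShift, ← mul_assoc, ← Complex.exp_add, ← Complex.exp_add]
  congr 2
  push_cast
  ring

theorem IsThetaFunction.halfShift {ω : ℂ} {N : ℤ} {F : ℂ → ℂ} (hF : IsThetaFunction ω N F)
    (β : ℤ) : IsThetaFunction ω N (halfShift ω N β F) where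
  holomorphic := by
    have h : Differentiable ℂ fun x => F (x + β * (ω / 2)) :=
      hF.holomorphic.comp (by fun_prop : Differentiable ℂ fun x : ℂ => x + β * (ω / 2))
    exact (Differentiable.mul (by fun_prop) (by fun_prop)).mul h
  period_one z := by
    have e : cexp (2 * π * I * β * N) = 1 := by
      have := exp_two_pi_mul_I_int (β * N)
      rw [← this]; congr 1; push_cast; ring
    rw [EllipticDouble.halfShift, EllipticDouble.halfShift, show z + 1 + β * (ω / 2)
      = z + β * (ω / 2) + 1 by ring, hF.period_one, mul_add (2 * π * I * β * N : ℂ), mul_one,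
      Complex.exp_add _ (2 * π * I * β * N : ℂ), e, mul_one]
  quasiPeriod z a := by
    rw [EllipticDouble.halfShift, EllipticDouble.halfShift, show z + ω * a + β * (ω / 2)
      = z + β * (ω / 2) + ω * a by ring, hF.quasiPeriod, ← mul_assoc, ← mul_assoc, ← mul_assoc,
      ← Complex.exp_add, ← Complex.exp_add, ← Complex.exp_add, ← Complex.exp_add]
    congr 2
    ring

/-- The exponentials before and inside the additive sum are together those of `halfShift` at the
points z+(n-2k)s. -/
theorem mul_additiveSum (s ω : ℂ) (n : ℕ) (γ : ℤ) (F : ℂ → ℂ) (z : ℂ) :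
    cexp (π * I * ω / 2 * γ ^ 2 * (n - 1)) * cexp (2 * π * I * s * γ * (n - 1) * n)
      * cexp (2 * π * I * γ * (n - 1) * z) * additiveSum s ω n γ F z
      = coreSum s ω n (halfShift ω (n - 1) γ F) z := by
  rw [additiveSum, coreSum, Finset.mul_sum]
  refine Finset.sum_congr rfl fun k _ => ?_
  rw [halfShift, show ∀ A B C S E G : ℂ, A * B * C * (S * E * G) = S * ((A * B * C * E) * G) by
    intros; ring, ← Complex.exp_add, ← Complex.exp_add, ← Complex.exp_add, ← Complex.exp_add,
    show z + γ * (ω / 2) + (n - 2 * k) * s = z + (n - 2 * k) * s + γ * (ω / 2) by ring]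
  congr 3
  push_cast
  ring

theorem additiveForm_eq (η τ : ℂ) (n m : ℕ) (α β : ℤ) (F G : ℂ → ℂ) (z : ℂ) :
    additiveForm η τ n m α β F G z
      = (-1) ^ (n * m) * cexp (-(π * I * τ / 2) * m ^ 2 * n - π * I * η * n ^ 2 * m)
        * coreSum η τ n (halfShift τ (n - 1) β F) z
        * coreSum (τ / 2) (2 * η) m (halfShift (2 * η) (m - 1) α G) z := by
  rw [additiveForm, mul_additiveSum, ← mul_additiveSum (τ / 2)]
  congr 5
  all_goals ring

theorem prod_theta1_add_half (s ω z l : ℂ) (K : ℤ) (M : ℕ) :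
    ∏ j ∈ Finset.range M, theta1 (2 * (z + K * (ω / 2)) - 2 * s * (l - j)) ω
      = ((-1) ^ K) ^ M * cexp (-(M * (π * I * K ^ 2 * ω))
          - 2 * π * I * K * (M * (2 * z - 2 * s * l) + s * M * (M - 1)))
        * ∏ j ∈ Finset.range M, theta1 (2 * z - 2 * s * (l - j)) ω := by
  induction M with
  | zero => simp
  | succ M ih =>
    rw [Finset.prod_range_succ, ih, Finset.prod_range_succ,
      show 2 * (z + K * (ω / 2)) - 2 * s * (l - M) = 2 * z - 2 * s * (l - M) + K * ω by ring,
      theta1_add_int_mul, show ∀ a A P b B T : ℂ, a * A * P * (b * B * T) = (a * b) * (A * B)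
        * (P * T) by intros; ring, ← pow_succ, ← Complex.exp_add]
    congr 3
    push_cast
    ring

theorem shiftCoeff_add_half (s ω : ℂ) (n k : ℕ) (z : ℂ) (K : ℤ) :
    shiftCoeff s ω n k (z + K * (ω / 2))
      = ((-1) ^ K) ^ n * cexp (n * (π * I * ω * K ^ 2) + 4 * π * I * K * n * z
          + 2 * π * I * K * s * (n - 1) * (n - 2 * k)) * shiftCoeff s ω n k z := by
  have e : ((-1 : ℂ) ^ K) * (-1) ^ K = 1 := by rw [← mul_zpow]; simp
  have e0 : ((-1 : ℂ) ^ K) ≠ 0 := zpow_ne_zero _ (by norm_num)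
  have e2 : ((-1 : ℂ) ^ K) ^ n * ((-1) ^ K) ^ n = 1 := by rw [← mul_pow, e, one_pow]
  rw [shiftCoeff, shiftCoeff, prod_theta1_add_half,
    show 2 * (z + K * (ω / 2)) + 2 * s * (n - 2 * k) = 2 * z + 2 * s * (n - 2 * k) + K * ω by ring,
    theta1_add_int_mul, mul_div_mul_comm, mul_div_mul_comm, ← Complex.exp_sub]
  have e3 : (-1 : ℂ) ^ K / ((-1) ^ K) ^ (n + 1) = ((-1) ^ K) ^ n := by
    rw [pow_succ, div_eq_iff (mul_ne_zero (pow_ne_zero _ e0) e0), ← mul_assoc, e2, one_mul]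
  rw [e3, show ∀ c b E A T : ℂ, c * b * (E * A * T) = E * A * (c * b * T) by intros; ring]
  congr 3
  push_cast
  ring

/-- Shifting the argument of `coreSum` by half-periods. -/
theorem coreSum_add_half {s ω : ℂ} {n : ℕ} {F : ℂ → ℂ} (hF : HasThetaQuasiPeriod ω (n - 1) F)
    {K β : ℤ} (h : Even (K - β)) (z : ℂ) :
    coreSum s ω n F (z + K * (ω / 2))
      = ((-1) ^ K) ^ n * cexp ((n + 1) * (π * I * ω * K ^ 2 / 2 + 2 * π * I * K * z))
        * coreSum s ω n (halfShift ω (n - 1) β F) z := by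
  rw [coreSum, coreSum, Finset.mul_sum]
  refine Finset.sum_congr rfl fun k _ => ?_
  -- The exponential from the coefficient and the one from F have opposite dependence on k; this is
  -- where the order 2n-2 enters.
  rw [show z + K * (ω / 2) + (n - 2 * k) * s = (z + (n - 2 * k) * s) + K * (ω / 2) by ring,
    hF.apply_add_half h, shiftCoeff_add_half,
    show ∀ a b A S B H : ℂ, a * (b * A * S) * (B * H) = b * (A * B) * (a * S * H) by intros; ring,
    ← Complex.exp_add]
  congr 3
  push_cast
  ring

theorem prod_range_succ_erase {M : Type*} [CommMonoid M] (f : ℕ → M) {n k : ℕ} (hk : k ≤ n) :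
    ∏ j ∈ (Finset.range (n + 1)).erase k, f j
      = (∏ j ∈ Finset.range k, f j) * ∏ j ∈ Finset.range (n - k), f (k + 1 + j) := by
  have h1 : ∏ j ∈ (Finset.range (n + 1)).erase k, f j
      = ∏ j ∈ Finset.range (n + 1), if j = k then 1 else f j := by
    rw [← Finset.mul_prod_erase _ (fun j => if j = k then 1 else f j)
      (Finset.mem_range.mpr (Nat.lt_succ_of_le hk)), if_pos rfl, one_mul]
    exact Finset.prod_congr rfl fun j hj => by rw [if_neg (Finset.ne_of_mem_erase hj)]
  rw [h1, show n + 1 = k + 1 + (n - k) by omega, Finset.prod_range_add, Finset.prod_range_succ,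
    if_pos rfl, mul_one]
  congr 1
  · exact Finset.prod_congr rfl fun j hj => by rw [if_neg (Finset.mem_range.mp hj).ne]
  · exact Finset.prod_congr rfl fun j hj => by rw [if_neg (by omega)]

theorem prod_Icc_one_eq_range {M : Type*} [CommMonoid M] (f : ℕ → M) (k : ℕ) :
    ∏ j ∈ Finset.Icc 1 k, f j = ∏ j ∈ Finset.range k, f (j + 1) := by
  induction k with
  | zero => simp
  | succ k ih => rw [Finset.prod_Icc_succ_top (by omega), ih, Finset.prod_range_succ]

/-- For the nodes x_k = z+(n-2k)s one has x_k - x_j = 2s(j-k) and x_k + x_j = 2z+2s(n-k-j), so the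
coefficient is the interpolation weight of x_k. The numerator θ₁(2x_k) cancels the missing factor j
= k, and the differences with j < k supply the sign. -/
theorem neg_one_pow_mul_shiftCoeff {s ω z : ℂ} {n k : ℕ} (hk : k ≤ n)
    (hz : ∀ j : ℤ, theta1 (2 * z + 2 * s * j) ω ≠ 0) :
    (-1) ^ k * shiftCoeff s ω n k z
      = (cexp (π * I * s) / thetaR ω) ^ n * (∏ j ∈ Finset.Icc 1 n, theta1 (2 * s * j) ω)
        / ∏ j ∈ (Finset.range (n + 1)).erase k,
          thetaDiff ω (z + (n - 2 * k) * s) (z + (n - 2 * j) * s) := by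
  simp only [thetaDiff]
  rw [Finset.prod_mul_distrib]
  have h1 : ∏ j ∈ (Finset.range (n + 1)).erase k,
      theta1 (z + (n - 2 * k) * s - (z + (n - 2 * j) * s)) ω
      = (-1) ^ k * ((∏ j ∈ Finset.Icc 1 k, theta1 (2 * s * j) ω)
        * ∏ j ∈ Finset.Icc 1 (n - k), theta1 (2 * s * j) ω) := by
    rw [prod_range_succ_erase _ hk, ← mul_assoc]
    congr 1
    · rw [prod_Icc_one_eq_range, ← Finset.prod_range_reflect, ← Finset.card_range k,
        ← Finset.prod_const, Finset.card_range, ← Finset.prod_mul_distrib]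
      refine Finset.prod_congr rfl fun j hj => ?_
      rw [Finset.mem_range] at hj
      rw [neg_one_mul, ← theta1_neg]
      congr 1
      rw [Nat.cast_sub (by omega), Nat.cast_sub (by omega)]
      push_cast
      ring
    · rw [prod_Icc_one_eq_range]
      refine Finset.prod_congr rfl fun j hj => ?_
      congr 1
      push_cast
      ring
  have h2 : theta1 (2 * z + 2 * s * (n - 2 * k)) ω * ∏ j ∈ (Finset.range (n + 1)).erase k,
      theta1 (z + (n - 2 * k) * s + (z + (n - 2 * j) * s)) ω
      = ∏ j ∈ Finset.range (n + 1), theta1 (2 * z - 2 * s * (k - j)) ω := by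
    rw [← Finset.prod_range_reflect,
      ← Finset.mul_prod_erase _ _ (Finset.mem_range.mpr (Nat.lt_succ_of_le hk))]
    congr 1
    · congr 1
      rw [Nat.cast_sub (by omega), Nat.cast_sub (by omega)]
      push_cast
      ring
    · refine Finset.prod_congr rfl fun j hj => ?_
      have := Finset.mem_range.mp (Finset.mem_of_mem_erase hj)
      congr 1
      rw [Nat.cast_sub (by omega), Nat.cast_sub (by omega)]
      push_cast
      ring
  have h3 : theta1 (2 * z + 2 * s * (n - 2 * k)) ω ≠ 0 := by
    have := hz (n - 2 * k)
    push_cast at this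
    exact this
  rw [h1, shiftCoeff, ellBinom, ← h2, div_mul_cancel_left₀ h3]
  have e : ((-1 : ℂ) ^ k) * (-1) ^ k = 1 := by rw [← mul_pow]; simp
  have e' : ((-1 : ℂ) ^ k)⁻¹ = (-1) ^ k := inv_eq_of_mul_eq_one_left e
  simp only [div_eq_mul_inv, mul_inv, e']
  ring

theorem theta1_two_mul_ne_zero {s ω z : ℂ} (hz : ∀ j : ℤ, theta1 (2 * z + 2 * s * j) ω ≠ 0)
    (n k : ℕ) : theta1 (2 * (z + (n - 2 * k) * s)) ω ≠ 0 := by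
  have := hz (n - 2 * k)
  push_cast at this
  rwa [show 2 * (z + (n - 2 * k) * s) = 2 * z + 2 * s * (n - 2 * k) by ring]

/-- The coefficients are the interpolation weights of n+1 nodes, for which 2(n-1) is the order
required in the residue identity. -/
theorem coreSum_even {s ω z : ℂ} (hω : 0 < ω.im) {n : ℕ} {F : ℂ → ℂ}
    (hF : IsThetaFunction ω (n - 1) F) (heven : ∀ u, F (-u) = F u)
    (hz : ∀ j : ℤ, theta1 (2 * z + 2 * s * j) ω ≠ 0)
    (hs : ∀ j : ℤ, j ≠ 0 → theta1 (2 * s * j) ω ≠ 0) : coreSum s ω n F z = 0 := by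
  have key := IsThetaFunction.sum_div_prod_eq_zero hω (x := fun k : ℕ => z + (n - 2 * k) * s)
    (Finset.range (n + 1)) (F := F) (by
      rw [Finset.card_range]; push_cast; rwa [show (n : ℤ) + 1 - 2 = n - 1 by ring]) heven
    (fun i _ => theta1_two_mul_ne_zero hz n i) (fun i _ j _ hij => by
      refine mul_ne_zero ?_ ?_
      · have := hs (j - i) (by omega)
        push_cast at this
        rwa [show z + (n - 2 * i) * s - (z + (n - 2 * j) * s) = 2 * s * (j - i) by ring]
      · have := hz (n - i - j)
        push_cast at this
        rwa [show z + (n - 2 * i) * s + (z + (n - 2 * j) * s) = 2 * z + 2 * s * (n - i - j) by ring])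
  rw [coreSum]
  have : ∀ k ∈ Finset.range (n + 1), (-1) ^ k * shiftCoeff s ω n k z * F (z + (n - 2 * k) * s)
      = (cexp (π * I * s) / thetaR ω) ^ n * (∏ j ∈ Finset.Icc 1 n, theta1 (2 * s * j) ω)
        * (F (z + (n - 2 * k) * s) / ∏ j ∈ (Finset.range (n + 1)).erase k,
          thetaDiff ω (z + (n - 2 * k) * s) (z + (n - 2 * j) * s)) := by
    intro k hk
    rw [neg_one_pow_mul_shiftCoeff (by rw [Finset.mem_range] at hk; omega) hz]
    ring
  rw [Finset.sum_congr rfl this, ← Finset.mul_sum, key, mul_zero]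

theorem coreSum_neg {s ω z : ℂ} {n : ℕ} {F : ℂ → ℂ} :
    coreSum s ω n F (-z) = coreSum s ω n (fun u => F (-u)) z := by
  rw [coreSum, coreSum, ← Finset.sum_range_reflect]
  refine Finset.sum_congr rfl fun k hk => ?_
  have hkn : k ≤ n := by rw [Finset.mem_range] at hk; omega
  rw [show n + 1 - 1 - k = n - k by omega]
  have h1 : ellBinom s ω n (n - k) = ellBinom s ω n k := by
    rw [ellBinom, ellBinom, show n - (n - k) = k by omega, mul_comm (∏ j ∈ Finset.Icc 1 (n - k), _)]
  have h2 : ∏ j ∈ Finset.range (n + 1), theta1 (2 * (-z) - 2 * s * (((n - k : ℕ) : ℂ) - j)) ω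
      = (-1) ^ (n + 1) * ∏ j ∈ Finset.range (n + 1), theta1 (2 * z - 2 * s * (k - j)) ω := by
    rw [← Finset.prod_range_reflect, ← Finset.card_range (n + 1), ← Finset.prod_const,
      Finset.card_range, ← Finset.prod_mul_distrib]
    refine Finset.prod_congr rfl fun j hj => ?_
    rw [Finset.mem_range] at hj
    rw [neg_one_mul, ← theta1_neg]
    congr 1
    rw [Nat.cast_sub (by omega), Nat.cast_sub (by omega), Nat.cast_sub (by omega)]
    push_cast
    ring
  have h3 : theta1 (2 * (-z) + 2 * s * (n - 2 * ((n - k : ℕ) : ℂ))) ω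
      = -theta1 (2 * z + 2 * s * (n - 2 * k)) ω := by
    rw [← theta1_neg, Nat.cast_sub hkn]
    congr 1
    ring
  have e : ((-1 : ℂ) ^ k) * (-1) ^ k = 1 := by rw [← mul_pow]; simp
  have e' : ((-1 : ℂ) ^ n)⁻¹ = (-1) ^ n :=
    inv_eq_of_mul_eq_one_left (by rw [← mul_pow]; simp)
  have e3 : ((-1 : ℂ) ^ (n - k)) * (-1) ^ n = (-1) ^ k := by
    rw [← pow_add, show n - k + n = 2 * (n - k) + k by omega, pow_add, pow_mul]; simp
  rw [shiftCoeff, shiftCoeff, h1, h2, h3, Nat.cast_sub hkn,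
    show -z + (n - 2 * ((n : ℂ) - k)) * s = -(z + (n - 2 * k) * s) by ring, pow_succ, ← e3]
  simp only [div_eq_mul_inv, mul_inv, e']
  ring

theorem coreSum_add {s ω z : ℂ} {n : ℕ} {F G : ℂ → ℂ} :
    coreSum s ω n F z + coreSum s ω n G z = coreSum s ω n (fun u => F u + G u) z := by
  rw [coreSum, coreSum, coreSum, ← Finset.sum_add_distrib]
  exact Finset.sum_congr rfl fun k _ => by ring

/-- Reversing z amounts to reflecting F, and the sum vanishes on the even function F(-u)+F(u). It is
needed because the integral operator produces the average over z and -z. -/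
theorem coreSum_neg_of_isThetaFunction {s ω z : ℂ} (hω : 0 < ω.im) {n : ℕ} {F : ℂ → ℂ}
    (hF : IsThetaFunction ω (n - 1) F) (hz : ∀ j : ℤ, theta1 (2 * z + 2 * s * j) ω ≠ 0)
    (hs : ∀ j : ℤ, j ≠ 0 → theta1 (2 * s * j) ω ≠ 0) :
    coreSum s ω n F (-z) = -coreSum s ω n F z := by
  rw [eq_neg_iff_add_eq_zero, coreSum_neg, coreSum_add]
  exact coreSum_even hω (hF.comp_neg.add hF) (fun u => by rw [neg_neg, add_comm]) hz hs


/-! ## The finite-difference operator -/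

theorem ellBinom_succ {s ω : ℂ} (hs : ∀ j : ℤ, j ≠ 0 → theta1 (2 * s * j) ω ≠ 0) {n k : ℕ}
    (hk : k ≤ n) : ellBinom s ω n k
      = ellBinom s ω (n + 1) k * (theta1 (2 * s * (n + 1 - k)) ω / theta1 (2 * s * (n + 1)) ω) := by
  have h1 : theta1 (2 * s * (n + 1 - k)) ω ≠ 0 := by
    have := hs (n + 1 - k) (by omega)
    push_cast at this
    exact this
  have h2 : theta1 (2 * s * (n + 1)) ω ≠ 0 := by
    have := hs (n + 1) (by omega)
    push_cast at this
    exact this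
  rw [ellBinom, ellBinom, show n + 1 - k = (n - k) + 1 by omega,
    Finset.prod_Icc_succ_top (by omega), Finset.prod_Icc_succ_top (by omega)]
  rw [Nat.cast_add (n - k) 1, Nat.cast_sub hk, Nat.cast_add n 1, Nat.cast_one,
    show (n : ℂ) - k + 1 = n + 1 - k by ring]
  field_simp

theorem ellBinom_succ_succ {s ω : ℂ} (hs : ∀ j : ℤ, j ≠ 0 → theta1 (2 * s * j) ω ≠ 0) (n k : ℕ) :
    ellBinom s ω n k = ellBinom s ω (n + 1) (k + 1)
      * (theta1 (2 * s * (k + 1)) ω / theta1 (2 * s * (n + 1)) ω) := by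
  have h1 : theta1 (2 * s * (k + 1)) ω ≠ 0 := by
    have := hs (k + 1) (by omega)
    push_cast at this
    exact this
  have h2 : theta1 (2 * s * (n + 1)) ω ≠ 0 := by
    have := hs (n + 1) (by omega)
    push_cast at this
    exact this
  rw [ellBinom, ellBinom, show n + 1 - (k + 1) = n - k by omega,
    Finset.prod_Icc_succ_top (by omega), Finset.prod_Icc_succ_top (by omega)]
  push_cast
  field_simp

/-- The denominators at z+s are those of the coefficient with index n+1 at z, except for j = 0. The
missing factor reappears as a numerator. -/
theorem shiftCoeff_add_self {s ω : ℂ} (hω : 0 < ω.im)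
    (hs : ∀ j : ℤ, j ≠ 0 → theta1 (2 * s * j) ω ≠ 0) {z : ℂ}
    (hz : ∀ j : ℤ, theta1 (2 * z + 2 * s * j) ω ≠ 0) {n k : ℕ} (hk : k ≤ n) :
    cexp (π * I * s) / thetaR ω * shiftCoeff s ω n k (z + s)
      = shiftCoeff s ω (n + 1) k z * (theta1 (2 * s * (n + 1 - k)) ω / theta1 (2 * s * (n + 1)) ω
        * theta1 (2 * z - 2 * s * k) ω) := by
  have h0 : theta1 (2 * z - 2 * s * k) ω ≠ 0 := by
    have := hz (-k)
    push_cast at this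
    rwa [show 2 * z - 2 * s * k = 2 * z + 2 * s * -k by ring]
  have hc : cexp (π * I * s) / thetaR ω ≠ 0 := div_ne_zero (Complex.exp_ne_zero _) (thetaR_ne_zero hω)
  rw [shiftCoeff, shiftCoeff, Finset.prod_range_succ' _ (n + 1), ellBinom_succ hs hk]
  have e1 : ∀ j : ℕ, 2 * z - 2 * s * (k - ((j + 1 : ℕ) : ℂ)) = 2 * (z + s) - 2 * s * (k - j) :=
    fun j => by push_cast; ring
  simp only [e1]
  rw [show 2 * z - 2 * s * (k - ((0 : ℕ) : ℂ)) = 2 * z - 2 * s * k by push_cast; ring,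
    show 2 * z + 2 * s * (((n + 1 : ℕ) : ℂ) - 2 * k) = 2 * (z + s) + 2 * s * (n - 2 * k) by
      push_cast; ring]
  generalize cexp (π * I * s) / thetaR ω = c at *
  generalize theta1 (2 * z - 2 * s * k) ω = t at *
  simp only [div_eq_mul_inv, mul_inv]
  rw [pow_succ]
  field_simp

/-- Here the missing denominator is the one with j = n+1. -/
theorem shiftCoeff_sub_self {s ω : ℂ} (hω : 0 < ω.im)
    (hs : ∀ j : ℤ, j ≠ 0 → theta1 (2 * s * j) ω ≠ 0) {z : ℂ}
    (hz : ∀ j : ℤ, theta1 (2 * z + 2 * s * j) ω ≠ 0) (n k : ℕ) :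
    cexp (π * I * s) / thetaR ω * shiftCoeff s ω n k (z - s)
      = shiftCoeff s ω (n + 1) (k + 1) z * (theta1 (2 * s * (k + 1)) ω
        / theta1 (2 * s * (n + 1)) ω * theta1 (2 * z + 2 * s * (n - k)) ω) := by
  have h0 : theta1 (2 * z + 2 * s * (n - k)) ω ≠ 0 := by
    have := hz (n - k)
    push_cast at this
    exact this
  have hc : cexp (π * I * s) / thetaR ω ≠ 0 := div_ne_zero (Complex.exp_ne_zero _) (thetaR_ne_zero hω)
  rw [shiftCoeff, shiftCoeff, Finset.prod_range_succ _ (n + 1), ellBinom_succ_succ hs]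
  have e1 : ∀ j : ℕ, 2 * z - 2 * s * (((k + 1 : ℕ) : ℂ) - j) = 2 * (z - s) - 2 * s * (k - j) :=
    fun j => by push_cast; ring
  rw [show theta1 (2 * z - 2 * s * (((k + 1 : ℕ) : ℂ) - ((n + 1 : ℕ) : ℂ))) ω
      = theta1 (2 * z + 2 * s * (n - k)) ω by congr 1; push_cast; ring]
  simp only [e1]
  rw [show 2 * z + 2 * s * (((n + 1 : ℕ) : ℂ) - 2 * ((k + 1 : ℕ) : ℂ))
      = 2 * (z - s) + 2 * s * (n - 2 * k) by push_cast; ring]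
  generalize cexp (π * I * s) / thetaR ω = c at *
  generalize theta1 (2 * z + 2 * s * (n - k)) ω = t at *
  simp only [div_eq_mul_inv, mul_inv]
  rw [pow_succ]
  field_simp

/-- The recurrence of `coreSum` in `n`. -/
theorem coreSum_succ {ϑ : ℂ → ℂ → ℂ} {ε : ℂ} (hϑ : IsEvenTheta ϑ ε) {s ω : ℂ} (hω : 0 < ω.im)
    (hs : ∀ j : ℤ, j ≠ 0 → theta1 (2 * s * j) ω ≠ 0) {z : ℂ}
    (hz : ∀ j : ℤ, theta1 (2 * z + 2 * s * j) ω ≠ 0) (n : ℕ) (F : ℂ → ℂ) :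
    (cexp (π * I * s) / thetaR ω) / theta1 (2 * z) ω
        * (ϑ (z + n * s + s) (ω / 2) * coreSum s ω n F (z + s)
          - ϑ (z - n * s - s) (ω / 2) * coreSum s ω n F (z - s))
      = coreSum s ω (n + 1) (fun x => ϑ x (ω / 2) * F x) z := by
  set c := cexp (π * I * s) / thetaR ω with hc
  set N := theta1 (2 * s * (n + 1)) ω with hN
  have hN0 : N ≠ 0 := by
    have := hs (n + 1) (by omega)
    push_cast at this
    exact this
  have hz0 : theta1 (2 * z) ω ≠ 0 := by simpa using hz 0
  -- The added term k = n+1 carries θ₁(0) = 0, so the sum may be taken over the same n+2 points as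
  -- the next one.
  have h1 : c * coreSum s ω n F (z + s) = ∑ k ∈ Finset.range (n + 2), (-1) ^ k
      * shiftCoeff s ω (n + 1) k z * (theta1 (2 * s * (n + 1 - k)) ω / N
        * theta1 (2 * z - 2 * s * k) ω) * F (z + (((n + 1 : ℕ) : ℂ) - 2 * k) * s) := by
    rw [Finset.sum_range_succ _ (n + 1), show 2 * s * ((n : ℂ) + 1 - ((n + 1 : ℕ) : ℂ)) = 0 by
      push_cast; ring, theta1_zero, zero_div, zero_mul, mul_zero, zero_mul, add_zero, coreSum,
      Finset.mul_sum]
    refine Finset.sum_congr rfl fun k hk => ?_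
    have := shiftCoeff_add_self hω hs hz (n := n) (k := k) (by rw [Finset.mem_range] at hk; omega)
    rw [mul_assoc _ (shiftCoeff s ω (n + 1) k z), ← this,
      show z + s + (n - 2 * k) * s = z + (((n + 1 : ℕ) : ℂ) - 2 * k) * s by push_cast; ring]
    ring
  -- After raising the index by one, which changes the sign, the added term k = 0 vanishes.
  have h2 : c * coreSum s ω n F (z - s) = -∑ k ∈ Finset.range (n + 2), (-1) ^ k
      * shiftCoeff s ω (n + 1) k z * (theta1 (2 * s * k) ω / N
        * theta1 (2 * z + 2 * s * (n + 1 - k)) ω) * F (z + (((n + 1 : ℕ) : ℂ) - 2 * k) * s) := by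
    rw [Finset.sum_range_succ' _ (n + 1), show 2 * s * ((0 : ℕ) : ℂ) = 0 by
      push_cast; ring, theta1_zero, zero_div, zero_mul, mul_zero, zero_mul, add_zero, coreSum,
      Finset.mul_sum, ← Finset.sum_neg_distrib]
    refine Finset.sum_congr rfl fun k hk => ?_
    have := shiftCoeff_sub_self hω hs hz n k
    rw [show theta1 (2 * s * ((k + 1 : ℕ) : ℂ)) ω / N
        * theta1 (2 * z + 2 * s * (n + 1 - ((k + 1 : ℕ) : ℂ))) ω
        = theta1 (2 * s * (k + 1)) ω / N * theta1 (2 * z + 2 * s * (n - k)) ω by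
          push_cast; congr 3; ring,
      mul_assoc _ (shiftCoeff s ω (n + 1) (k + 1) z), ← this,
      show z - s + (n - 2 * k) * s
        = z + (((n + 1 : ℕ) : ℂ) - 2 * ((k + 1 : ℕ) : ℂ)) * s by push_cast; ring, pow_succ]
    ring
  rw [show c / theta1 (2 * z) ω * (ϑ (z + n * s + s) (ω / 2) * coreSum s ω n F (z + s)
      - ϑ (z - n * s - s) (ω / 2) * coreSum s ω n F (z - s))
      = (ϑ (z + n * s + s) (ω / 2) * (c * coreSum s ω n F (z + s))
      - ϑ (z - n * s - s) (ω / 2) * (c * coreSum s ω n F (z - s))) / theta1 (2 * z) ω by ring,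
    h1, h2, mul_neg, sub_neg_eq_add, Finset.mul_sum, Finset.mul_sum, ← Finset.sum_add_distrib,
    Finset.sum_div, coreSum]
  refine Finset.sum_congr rfl fun k _ => ?_
  -- At each point the two contributions combine by the three-term relation for z+(n+1)s, z-(n+1)s
  -- and the point itself.
  have key := hϑ.three_term (z + n * s + s) (z - n * s - s)
    (z + (((n + 1 : ℕ) : ℂ) - 2 * k) * s) hω
  rw [show z + (((n + 1 : ℕ) : ℂ) - 2 * k) * s - (z - n * s - s) = 2 * s * (n + 1 - k) by
      push_cast; ring,
    show z - n * s - s + (z + (((n + 1 : ℕ) : ℂ) - 2 * k) * s) = 2 * z - 2 * s * k by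
      push_cast; ring,
    show z + n * s + s - (z + (((n + 1 : ℕ) : ℂ) - 2 * k) * s) = 2 * s * k by push_cast; ring,
    show z + n * s + s + (z + (((n + 1 : ℕ) : ℂ) - 2 * k) * s) = 2 * z + 2 * s * (n + 1 - k) by
      push_cast; ring,
    show z + n * s + s - (z - n * s - s) = 2 * s * (n + 1) by ring,
    show z + n * s + s + (z - n * s - s) = 2 * z by ring, ← hN] at key
  rw [div_eq_iff hz0]
  have key2 : ϑ (z + n * s + s) (ω / 2) * (theta1 (2 * s * (n + 1 - k)) ω / N
      * theta1 (2 * z - 2 * s * k) ω) + ϑ (z - n * s - s) (ω / 2) * (theta1 (2 * s * k) ω / N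
      * theta1 (2 * z + 2 * s * (n + 1 - k)) ω)
      = ϑ (z + (((n + 1 : ℕ) : ℂ) - 2 * k) * s) (ω / 2) * theta1 (2 * z) ω := by
    linear_combination N⁻¹ * key + ϑ (z + (((n + 1 : ℕ) : ℂ) - 2 * k) * s) (ω / 2)
      * theta1 (2 * z) ω * mul_inv_cancel₀ hN0
  linear_combination (-1) ^ k * shiftCoeff s ω (n + 1) k z
    * F (z + (((n + 1 : ℕ) : ℂ) - 2 * k) * s) * key2

/-- The Gaussians of consecutive operators cancel, and by `coreSum_succ` each operator raises n by
one and puts one more factor ϑ(x|ω/2) under the sum. -/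
theorem contigProd_zero_eq {ϑ : ℂ → ℂ → ℂ} {ε : ℂ} (hϑ : IsEvenTheta ϑ ε) {s ω : ℂ} (hω : 0 < ω.im)
    (hs : ∀ j : ℤ, j ≠ 0 → theta1 (2 * s * j) ω ≠ 0) (n : ℕ) (Φ : ℂ → ℂ) {z : ℂ}
    (hz : ∀ j : ℤ, theta1 (2 * z + 2 * s * j) ω ≠ 0) :
    contigProd ϑ s ω 0 n Φ z = cexp (π * I * z ^ 2 / s)
      * coreSum s ω n (fun x => ϑ x (ω / 2) ^ n * (cexp (-(π * I * x ^ 2 / s)) * Φ x)) z := by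
  induction n generalizing z with
  | zero =>
    have hz0 : theta1 (2 * z) ω ≠ 0 := by simpa using hz 0
    have he : cexp (π * I * z ^ 2 / s) * cexp (-(π * I * z ^ 2 / s)) = 1 := by
      rw [← Complex.exp_add, add_neg_cancel, Complex.exp_zero]
    simp [contigProd, coreSum, shiftCoeff, ellBinom, hz0, ← mul_assoc, he]
  | succ n ih =>
    have hp : ∀ j : ℤ, theta1 (2 * (z + s) + 2 * s * j) ω ≠ 0 := fun j => by
      have := hz (j + 1)
      push_cast at this
      rwa [show 2 * (z + s) + 2 * s * j = 2 * z + 2 * s * (j + 1) by ring]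
    have hm : ∀ j : ℤ, theta1 (2 * (z - s) + 2 * s * j) ω ≠ 0 := fun j => by
      have := hz (j - 1)
      push_cast at this
      rwa [show 2 * (z - s) + 2 * s * j = 2 * z + 2 * s * (j - 1) by ring]
    have he : ∀ u x : ℂ, cexp (-(π * I * u ^ 2 / s)) * (cexp (π * I * u ^ 2 / s) * x) = x :=
      fun u x => by rw [← mul_assoc, ← Complex.exp_add, neg_add_cancel, Complex.exp_zero, one_mul]
    have key := coreSum_succ hϑ hω hs hz n
      (fun x => ϑ x (ω / 2) ^ n * (cexp (-(π * I * x ^ 2 / s)) * Φ x))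
    rw [contigProd, contigOp, ih hp, ih hm, he, he, zero_add, mul_assoc, key]
    simp only [pow_succ', mul_assoc]

/-- By quasi-periodicity of ϑ the two terms acquire exp(∓2πimz) and a common constant. These are the
quotients, up to a constant, of a Gaussian at z and at z ± s, so the change of spin is a
conjugation. -/
theorem contigOp_add_half {ϑ : ℂ → ℂ → ℂ} {ε : ℂ} (hϑ : IsEvenTheta ϑ ε) {s ω : ℂ} (hs : s ≠ 0)
    (g : ℂ) (m : ℕ) (Φ : ℂ → ℂ) (z : ℂ) :
    contigOp ϑ s ω (m * (ω / 2) + g) Φ z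
      = ε ^ m * cexp (-(π * I * m ^ 2 * ω / 2) - 2 * π * I * m * g - π * I * m * s)
        * (cexp (π * I * m * z ^ 2 / s)
          * contigOp ϑ s ω g (fun x => cexp (-(π * I * m * x ^ 2 / s)) * Φ x) z) := by
  have h1 : ϑ (z + (m * (ω / 2) + g) + s) (ω / 2) = ε ^ m
      * cexp (-(π * I * m ^ 2 * ω / 2) - 2 * π * I * m * (z + g + s)) * ϑ (z + g + s) (ω / 2) := by
    have := hϑ.add_int_mul (z + g + s) (ω / 2) m
    rw [zpow_natCast] at this
    rw [show z + (m * (ω / 2) + g) + s = z + g + s + ((m : ℤ) : ℂ) * (ω / 2) by push_cast; ring,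
      this]
    congr 3
    push_cast
    ring
  have h2 : ϑ (z - (m * (ω / 2) + g) - s) (ω / 2) = ε ^ m
      * cexp (-(π * I * m ^ 2 * ω / 2) + 2 * π * I * m * (z - g - s)) * ϑ (z - g - s) (ω / 2) := by
    have := hϑ.add_int_mul (z - g - s) (ω / 2) (-m)
    have e : ε ^ (-(m : ℤ)) = ε ^ m := by
      rw [zpow_neg, zpow_natCast]
      refine inv_eq_of_mul_eq_one_left ?_
      rw [← mul_pow, ← pow_two, hϑ.sq_eq_one, one_pow]
    rw [e] at this
    rw [show z - (m * (ω / 2) + g) - s = z - g - s + ((-m : ℤ) : ℂ) * (ω / 2) by push_cast; ring,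
      this]
    congr 3
    push_cast
    ring
  rw [contigOp, contigOp, h1, h2]
  have e1 : cexp (-(π * I * m ^ 2 * ω / 2) - 2 * π * I * m * (z + g + s))
      = cexp (-(π * I * m ^ 2 * ω / 2) - 2 * π * I * m * g - π * I * m * s)
        * cexp (π * I * m * z ^ 2 / s) * cexp (-(π * I * m * (z + s) ^ 2 / s)) := by
    rw [← Complex.exp_add, ← Complex.exp_add]
    congr 1
    field_simp
    ring
  have e2 : cexp (-(π * I * m ^ 2 * ω / 2) + 2 * π * I * m * (z - g - s))
      = cexp (-(π * I * m ^ 2 * ω / 2) - 2 * π * I * m * g - π * I * m * s)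
        * cexp (π * I * m * z ^ 2 / s) * cexp (-(π * I * m * (z - s) ^ 2 / s)) := by
    rw [← Complex.exp_add, ← Complex.exp_add]
    congr 1
    field_simp
    ring
  rw [e1, e2]
  ring

theorem contigProd_add_half {ϑ : ℂ → ℂ → ℂ} {ε : ℂ} (hϑ : IsEvenTheta ϑ ε) {s ω : ℂ} (hs : s ≠ 0)
    (n m : ℕ) (Φ : ℂ → ℂ) (z : ℂ) :
    contigProd ϑ s ω (m * (ω / 2)) n Φ z
      = ε ^ (m * n) * cexp (-(π * I * m ^ 2 * n * ω / 2) - π * I * m * s * n ^ 2)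
        * (cexp (π * I * m * z ^ 2 / s)
          * contigProd ϑ s ω 0 n (fun x => cexp (-(π * I * m * x ^ 2 / s)) * Φ x) z) := by
  have he : ∀ (u : ℂ) x, cexp (-(π * I * m * u ^ 2 / s)) * (cexp (π * I * m * u ^ 2 / s) * x) = x :=
    fun u x => by rw [← mul_assoc, ← Complex.exp_add, neg_add_cancel, Complex.exp_zero, one_mul]
  induction n generalizing z with
  | zero =>
    simp only [contigProd]
    rw [mul_comm (cexp (π * I * m * z ^ 2 / s)), mul_comm (cexp (-(π * I * m * z ^ 2 / s))),
      mul_assoc (Φ z), ← Complex.exp_add, neg_add_cancel]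
    simp
  | succ n ih =>
    have hlin : ∀ (g c : ℂ) (Ψ : ℂ → ℂ), contigOp ϑ s ω g (fun x => c * Ψ x) z
        = c * contigOp ϑ s ω g Ψ z := fun g c Ψ => by
      simp only [contigOp]
      ring
    rw [contigProd, contigProd, contigOp_add_half hϑ hs]
    have : (fun x => cexp (-(π * I * m * x ^ 2 / s)) * contigProd ϑ s ω (m * (ω / 2)) n Φ x)
        = fun x => ε ^ (m * n) * cexp (-(π * I * m ^ 2 * n * ω / 2) - π * I * m * s * n ^ 2)
          * contigProd ϑ s ω 0 n (fun x => cexp (-(π * I * m * x ^ 2 / s)) * Φ x) x := by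
      ext x
      rw [ih, mul_left_comm, he]
    rw [this, hlin, zero_add, show ∀ a b A B P Q : ℂ, a * A * (P * (b * B * Q))
      = (b * a) * (A * B) * (P * Q) by intros; ring, ← pow_add, ← Complex.exp_add]
    congr 3
    push_cast
    ring


/-! ## Multiplicative notation -/

theorem thetaM_exp_mul_nomePow (u s t : ℂ) {ω : ℂ} (hω : 0 < ω.im) :
    thetaM (cexp (4 * π * I * u) * nomePow (2 * s) t) ω
      = thetaR ω * cexp (π * I * (2 * u + 2 * s * t)) * theta1 (2 * u + 2 * s * t) ω := by
  rw [← thetaM_exp _ hω, nomePow, ← Complex.exp_add]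
  congr 2
  ring

theorem thetaM_nomePow (s t : ℂ) {ω : ℂ} (hω : 0 < ω.im) :
    thetaM (nomePow (2 * s) t) ω
      = thetaR ω * cexp (π * I * (2 * s * t)) * theta1 (2 * s * t) ω := by
  have := thetaM_exp_mul_nomePow 0 s t hω
  simpa using this

theorem prod_div_eq_ellBinom {s ω : ℂ} (hs : ∀ j : ℤ, j ≠ 0 → theta1 (2 * s * j) ω ≠ 0) {n k : ℕ}
    (hk : k ≤ n) :
    ∏ b ∈ Finset.Icc 1 k, theta1 (2 * s * (n + 1 - b)) ω / theta1 (2 * s * b) ω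
      = ellBinom s ω n k := by
  have hP : ∀ k : ℕ, ∏ j ∈ Finset.Icc 1 k, theta1 (2 * s * j) ω ≠ 0 := fun k =>
    Finset.prod_ne_zero_iff.mpr fun j hj => by
      have := hs j (by rw [Finset.mem_Icc] at hj; omega)
      exact_mod_cast this
  induction k with
  | zero =>
    simp only [ellBinom, Finset.Icc_eq_empty (by omega : ¬(1 ≤ 0)), Finset.prod_empty, Nat.sub_zero]
    rw [one_mul, div_self (hP n)]
  | succ k ih =>
    rw [Finset.prod_Icc_succ_top (by omega), ih (by omega), ellBinom, ellBinom,
      Finset.prod_Icc_succ_top (by omega), show n - k = n - (k + 1) + 1 by omega,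
      Finset.prod_Icc_succ_top (by omega), show ((n - (k + 1) + 1 : ℕ) : ℂ) = n - k by
        rw [show n - (k + 1) + 1 = n - k by omega, Nat.cast_sub (by omega)]]
    have h1 := hP k
    have h2 := hP (n - (k + 1))
    have h3 : theta1 (2 * s * ((k + 1 : ℕ) : ℂ)) ω ≠ 0 := by
      have := hs (k + 1) (by omega); exact_mod_cast this
    have h4 : theta1 (2 * s * (n - k)) ω ≠ 0 := by
      have := hs (n - k) (by omega); exact_mod_cast this
    rw [show (n : ℂ) + 1 - ((k + 1 : ℕ) : ℂ) = n - k by push_cast; ring]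
    field_simp

/-- Raising k by one slides the window of n+1 arguments by -2s: one factor enters, one leaves, and
their quotient is the new factor of the first product. -/
theorem prod_div_mul_prod {s ω z : ℂ} (hz : ∀ j : ℤ, theta1 (2 * z + 2 * s * j) ω ≠ 0) (n k : ℕ) :
    (∏ b ∈ Finset.Icc 1 k, theta1 (2 * z + 2 * s * (n + 1 - b)) ω / theta1 (2 * z - 2 * s * b) ω)
        * ∏ j ∈ Finset.range (n + 1), theta1 (2 * z - 2 * s * (k - j)) ω
      = ∏ j ∈ Finset.range (n + 1), theta1 (2 * z + 2 * s * j) ω := by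
  induction k with
  | zero =>
    simp only [Finset.Icc_eq_empty (by omega : ¬(1 ≤ 0)), Finset.prod_empty, one_mul]
    refine Finset.prod_congr rfl fun j _ => ?_
    congr 1
    push_cast
    ring
  | succ k ih =>
    have h1 : theta1 (2 * z - 2 * s * ((k + 1 : ℕ) : ℂ)) ω ≠ 0 := by
      have := hz (-(k + 1 : ℕ))
      push_cast at this ⊢
      rwa [show 2 * z - 2 * s * ((k : ℂ) + 1) = 2 * z + 2 * s * -((k : ℂ) + 1) by ring]
    rw [← ih, Finset.prod_Icc_succ_top (by omega), Finset.prod_range_succ',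
      Finset.prod_range_succ]
    have e1 : ∀ j : ℕ, 2 * z - 2 * s * (((k + 1 : ℕ) : ℂ) - ((j + 1 : ℕ) : ℂ))
        = 2 * z - 2 * s * (k - j) := fun j => by push_cast; ring
    simp only [e1]
    rw [show 2 * z + 2 * s * ((n : ℂ) + 1 - ((k + 1 : ℕ) : ℂ)) = 2 * z - 2 * s * (k - n) by
      push_cast; ring, Nat.cast_zero, sub_zero]
    generalize theta1 (2 * z - 2 * s * ((k + 1 : ℕ) : ℂ)) ω = t at *
    rw [mul_assoc]
    congr 1
    rw [mul_comm _ t, ← mul_assoc, div_mul_cancel₀ _ h1, mul_comm]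

theorem thetaDenom_eq {s ω : ℂ} (hω : 0 < ω.im) (n : ℕ) (z : ℂ) :
    thetaDenom s ω n z = thetaR ω ^ (n + 1) * cexp (2 * π * I * (n + 1) * z + π * I * s * n * (n + 1))
      * ∏ j ∈ Finset.range (n + 1), theta1 (2 * z + 2 * s * j) ω := by
  rw [thetaDenom]
  induction n with
  | zero =>
    rw [zero_add, Finset.prod_range_one, Finset.prod_range_one, thetaM_exp_mul_nomePow _ _ _ hω,
      pow_one]
    congr 3
    push_cast
    ring
  | succ n ih =>
    rw [Finset.prod_range_succ, ih, Finset.prod_range_succ _ (n + 1),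
      thetaM_exp_mul_nomePow _ _ _ hω, show ∀ a b A B P Q : ℂ, a * A * P * (b * B * Q)
        = a * b * (A * B) * (P * Q) by intros; ring, ← pow_succ, ← Complex.exp_add]
    congr 3
    push_cast
    ring

/-- Each multiplicative theta function is a constant times an exponential times θ₁. The θ₁ reproduce
the shift coefficient, and the exponentials reproduce the one in the additive sum up to a factor
independent of k. -/
theorem multiplicativeSum_eq {s ω z : ℂ} (hω : 0 < ω.im)
    (hz : ∀ j : ℤ, theta1 (2 * z + 2 * s * j) ω ≠ 0)
    (hs : ∀ j : ℤ, j ≠ 0 → theta1 (2 * s * j) ω ≠ 0) (n : ℕ) (γ : ℤ) (F : ℂ → ℂ) :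
    multiplicativeSum s ω n γ (fun k => k * n * (1 - γ) + γ * k) F z
      = -cexp (-(π * I * s * (n ^ 2 + 4 * n)) - 2 * π * I * (n + 2) * z)
        * thetaDenom s ω n z * additiveSum s ω n γ F z := by
  have hR := thetaR_ne_zero hω
  rw [multiplicativeSum, additiveSum, Finset.mul_sum]
  refine Finset.sum_congr rfl fun k hk => ?_
  have hkn : k ≤ n := by rw [Finset.mem_range] at hk; omega
  rw [← mul_assoc]
  congr 1
  rw [show (-4 * π * I * z : ℂ) = 4 * π * I * (-z) by ring, thetaM_exp_mul_nomePow _ _ _ hω]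
  have hprod : ∏ b ∈ Finset.Icc 1 k,
      thetaM (cexp (4 * π * I * (-z)) * nomePow (2 * s) (b - n - 1)) ω
          * thetaM (nomePow (2 * s) (b - n - 1)) ω
        / (thetaM (cexp (4 * π * I * (-z)) * nomePow (2 * s) b) ω * thetaM (nomePow (2 * s) b) ω)
      = (-1) ^ k * cexp (-(4 * π * I * s * (n + 1) * k)) * (ellBinom s ω n k
        * ∏ b ∈ Finset.Icc 1 k,
          theta1 (2 * z + 2 * s * (n + 1 - b)) ω / theta1 (2 * z - 2 * s * b) ω) := by
    have hc : ((-1) ^ k * cexp (-(4 * π * I * s * (n + 1) * k)) : ℂ)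
        = ∏ _b ∈ Finset.Icc 1 k, (-cexp (-(4 * π * I * s * (n + 1)))) := by
      rw [Finset.prod_const, Nat.card_Icc, Nat.add_sub_cancel, neg_pow (cexp _), ← Complex.exp_nat_mul]
      congr 2
      ring
    rw [hc, ← prod_div_eq_ellBinom hs hkn, ← Finset.prod_mul_distrib, ← Finset.prod_mul_distrib]
    refine Finset.prod_congr rfl fun b hb => ?_
    rw [Finset.mem_Icc] at hb
    rw [thetaM_exp_mul_nomePow _ _ _ hω, thetaM_exp_mul_nomePow _ _ _ hω, thetaM_nomePow _ _ hω,
      thetaM_nomePow _ _ hω,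
      show 2 * s * ((b : ℂ) - n - 1) = -(2 * s * (n + 1 - b)) by ring,
      show 2 * (-z) + -(2 * s * (n + 1 - b)) = -(2 * z + 2 * s * (n + 1 - b)) by ring,
      show 2 * (-z) + 2 * s * b = -(2 * z - 2 * s * b) by ring, theta1_neg, theta1_neg, theta1_neg]
    have h1 : theta1 (2 * s * b) ω ≠ 0 := by
      have := hs b (by omega); exact_mod_cast this
    have h2 : theta1 (2 * z - 2 * s * b) ω ≠ 0 := by
      have := hz (-b)
      push_cast at this
      rwa [show 2 * z - 2 * s * b = 2 * z + 2 * s * -b by ring]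
    have he : cexp (π * I * -(2 * z + 2 * s * (n + 1 - b))) * cexp (π * I * -(2 * s * (n + 1 - b)))
        = cexp (π * I * -(2 * z - 2 * s * b)) * cexp (π * I * (2 * s * b))
          * cexp (-(4 * π * I * s * (n + 1))) := by
      rw [← Complex.exp_add, ← Complex.exp_add, ← Complex.exp_add]
      congr 1
      ring
    have h3 := Complex.exp_ne_zero (π * I * -(2 * z - 2 * s * b))
    have h4 := Complex.exp_ne_zero (π * I * (2 * s * b))
    rw [div_eq_iff (mul_ne_zero (mul_ne_zero (mul_ne_zero hR h3) (neg_ne_zero.mpr h2))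
      (mul_ne_zero (mul_ne_zero hR h4) h1))]
    generalize cexp (π * I * -(2 * z + 2 * s * (n + 1 - b))) = E1 at *
    generalize cexp (π * I * -(2 * s * (n + 1 - b))) = E2 at *
    generalize cexp (π * I * -(2 * z - 2 * s * b)) = E3 at *
    generalize cexp (π * I * (2 * s * b)) = E4 at *
    generalize cexp (-(4 * π * I * s * (n + 1))) = E5 at *
    generalize theta1 (2 * z - 2 * s * b) ω = t2 at *
    generalize theta1 (2 * s * b) ω = t1 at *
    generalize theta1 (2 * z + 2 * s * (n + 1 - b)) ω = t3
    generalize theta1 (2 * s * (n + 1 - b)) ω = t4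
    field_simp
    linear_combination t3 * t4 * he
  rw [hprod, thetaDenom_eq hω, ← prod_div_mul_prod hz n k, shiftCoeff, div_pow,
    show 2 * (-z) + 2 * s * (2 * k - n) = -(2 * z + 2 * s * (n - 2 * k)) by ring, theta1_neg,
    nomePow, ← Complex.exp_nat_mul]
  have hd : ∏ j ∈ Finset.range (n + 1), theta1 (2 * z - 2 * s * (k - j)) ω ≠ 0 := by
    refine Finset.prod_ne_zero_iff.mpr fun j _ => ?_
    have := hz (j - k)
    push_cast at this
    rwa [show 2 * z - 2 * s * (k - j) = 2 * z + 2 * s * (j - k) by ring]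
  have hx : cexp (2 * π * I * (2 * s) * (k * n * (1 - γ) + γ * k))
      * cexp (π * I * -(2 * z + 2 * s * (n - 2 * k))) * cexp (-(4 * π * I * s * (n + 1) * k))
      = cexp (-(π * I * s * (n ^ 2 + 4 * n)) - 2 * π * I * (n + 2) * z)
        * cexp (2 * π * I * (n + 1) * z + π * I * s * n * (n + 1)) * cexp (n * (π * I * s))
        * cexp (-4 * π * I * s * γ * (n - 1) * k) := by
    rw [← Complex.exp_add, ← Complex.exp_add, ← Complex.exp_add, ← Complex.exp_add,
      ← Complex.exp_add]
    congr 1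
    ring
  have hRn : thetaR ω ^ (n + 1) / thetaR ω ^ n = thetaR ω := by
    rw [pow_succ, mul_div_cancel_left₀ _ (pow_ne_zero _ hR)]
  generalize ∏ b ∈ Finset.Icc 1 k, theta1 (2 * z + 2 * s * (n + 1 - b)) ω
    / theta1 (2 * z - 2 * s * b) ω = Q
  generalize ∏ j ∈ Finset.range (n + 1), theta1 (2 * z - 2 * s * (k - j)) ω = P at *
  generalize theta1 (2 * z + 2 * s * (n - 2 * k)) ω = t
  generalize ellBinom s ω n k = b
  generalize cexp (2 * π * I * (2 * s) * (k * n * (1 - γ) + γ * k)) = E1 at *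
  generalize cexp (π * I * -(2 * z + 2 * s * (n - 2 * k))) = E2 at *
  generalize cexp (-(4 * π * I * s * (n + 1) * k)) = E3 at *
  generalize cexp (-(π * I * s * (n ^ 2 + 4 * n)) - 2 * π * I * (n + 2) * z) = E4 at *
  generalize cexp (2 * π * I * (n + 1) * z + π * I * s * n * (n + 1)) = E5 at *
  generalize cexp (n * (π * I * s)) = E6 at *
  generalize cexp (-4 * π * I * s * γ * (n - 1) * k) = E7 at *
  have hr : -E4 * (thetaR ω ^ (n + 1) * E5 * (Q * P))
      * ((-1) ^ k * (E6 / thetaR ω ^ n * b * (t / P)) * E7)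
      = -(thetaR ω ^ (n + 1) / thetaR ω ^ n) * (P / P) * (E4 * E5 * E6 * E7)
        * ((-1) ^ k * Q * b * t) := by ring
  rw [hr, hRn, div_self hd, ← hx]
  ring

theorem thetaDenom_ne_zero {s ω z : ℂ} (hω : 0 < ω.im)
    (hz : ∀ j : ℤ, theta1 (2 * z + 2 * s * j) ω ≠ 0) (n : ℕ) : thetaDenom s ω n z ≠ 0 := by
  rw [thetaDenom_eq hω]
  exact mul_ne_zero (mul_ne_zero (pow_ne_zero _ (thetaR_ne_zero hω)) (Complex.exp_ne_zero _))
    (Finset.prod_ne_zero_iff.mpr fun j _ => by exact_mod_cast hz j)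

theorem multiplicativeForm_eq_additiveForm {η τ z : ℂ} (hη : 0 < (2 * η).im) (hτ : 0 < τ.im)
    (hz1 : ∀ j : ℤ, theta1 (2 * z + 2 * η * j) τ ≠ 0)
    (hz2 : ∀ j : ℤ, theta1 (2 * z + 2 * (τ / 2) * j) (2 * η) ≠ 0)
    (hs1 : ∀ j : ℤ, j ≠ 0 → theta1 (2 * η * j) τ ≠ 0)
    (hs2 : ∀ j : ℤ, j ≠ 0 → theta1 (2 * (τ / 2) * j) (2 * η) ≠ 0)
    (n m : ℕ) (α β : ℤ) (F G : ℂ → ℂ) :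
    multiplicativeForm η τ n m α β F G z = additiveForm η τ n m α β F G z := by
  have hd1 := thetaDenom_ne_zero hτ hz1 n
  have hd2 := thetaDenom_ne_zero hη hz2 m
  rw [multiplicativeForm, multiplicativeSum_eq hτ hz1 hs1, multiplicativeSum_eq hη hz2 hs2,
    additiveForm, nomePow, nomePow]
  generalize thetaDenom η τ n z = d1 at *
  generalize thetaDenom (τ / 2) (2 * η) m z = d2 at *
  generalize additiveSum η τ n β F z = S1
  generalize additiveSum (τ / 2) (2 * η) m α G z = S2
  rw [show ∀ e A B C D E : ℂ, e * A * (B / d1) * (C / d2) * (-D * d1 * S1) * (-E * d2 * S2)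
      = (d1 / d1) * (d2 / d2) * e * (A * B * C * D * E) * (S1 * S2) by intros; ring,
    div_self hd1, div_self hd2, one_mul, one_mul,
    show ∀ e A B C D E H J : ℂ, e * A * (B * C * D * S1) * (E * H * J * S2)
      = e * (A * B * C * D * E * H * J) * (S1 * S2) by intros; ring]
  simp only [← Complex.exp_add]
  congr 3
  ring

theorem residueForm_eq_multiplicativeForm (η τ : ℂ) (n m : ℕ) (F G : ℂ → ℂ) (z : ℂ) :
    residueForm η τ n m F G z = multiplicativeForm η τ n m 1 1 F G z := by
  rw [residueForm, multiplicativeForm]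
  have e1 : (fun k : ℕ => (k : ℂ) * n * (1 - ((1 : ℤ) : ℂ)) + ((1 : ℤ) : ℂ) * k) = fun k : ℕ => (k : ℂ) := by
    ext k; push_cast; ring
  have e2 : (fun k : ℕ => (k : ℂ) * m * (1 - ((1 : ℤ) : ℂ)) + ((1 : ℤ) : ℂ) * k) = fun k : ℕ => (k : ℂ) := by
    ext k; push_cast; ring
  rw [e1, e2]
  rw [show 4 * π * I * z * ((n : ℂ) + m + 1) = 2 * π * I * z
      * (n + m + 4 + ((1 : ℤ) : ℂ) * (m - 1) + ((1 : ℤ) : ℂ) * (n - 1)) by push_cast; ring,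
    show ((n : ℂ) ^ 2 - 1) * (1 - m) / 4 + (n + 1) * n / 2 = ((n : ℂ) ^ 2 - ((1 : ℤ) : ℂ) ^ 2)
      * (1 - m) / 4 + ((1 : ℤ) : ℂ) * (n * (n - 1) / 2) + n by push_cast; ring,
    show ((m : ℂ) ^ 2 - 1) * (1 - n) / 4 + m * (m + 1) / 2 = ((m : ℂ) ^ 2 - ((1 : ℤ) : ℂ) ^ 2)
      * (1 - n) / 4 + ((1 : ℤ) : ℂ) * (m * (m - 1) / 2) + m by push_cast; ring]
  ring


/-! ## Factorization of the finite-difference operator -/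

theorem IsEvenTheta.apply_ne_zero {ϑ : ℂ → ℂ → ℂ} {ε : ℂ} (h : IsEvenTheta ϑ ε) {ω x : ℂ}
    (hω : 0 < ω.im) (hx : ∀ a b : ℤ, 2 * x ≠ a + b * ω) : ϑ x ω ≠ 0 := by
  rcases h with ⟨rfl, -⟩ | ⟨rfl, -⟩
  · rw [theta3, theta2]
    refine mul_ne_zero (Complex.exp_ne_zero _) (theta1_ne_zero hω fun a b hab => ?_)
    refine hx (2 * a - 1) (2 * b - 1) ?_
    push_cast
    linear_combination 2 * hab
  · rw [theta4, theta3, theta2]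
    refine mul_ne_zero (Complex.exp_ne_zero _) (theta1_ne_zero hω fun a b hab => ?_)
    refine hx (2 * a - 2) (2 * b - 1) ?_
    push_cast
    linear_combination 2 * hab

theorem coreSum_congr {s ω z : ℂ} {n : ℕ} {F G : ℂ → ℂ}
    (h : ∀ k ≤ n, F (z + (n - 2 * k) * s) = G (z + (n - 2 * k) * s)) :
    coreSum s ω n F z = coreSum s ω n G z :=
  Finset.sum_congr rfl fun k hk => by rw [h k (by rw [Finset.mem_range] at hk; omega)]

theorem coreSum_const_mul {s ω z c : ℂ} {n : ℕ} {F : ℂ → ℂ} :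
    coreSum s ω n (fun x => c * F x) z = c * coreSum s ω n F z := by
  rw [coreSum, coreSum, Finset.mul_sum]
  exact Finset.sum_congr rfl fun k _ => by ring

theorem IsEvenTheta.pow_eq_of_even {ϑ : ℂ → ℂ → ℂ} {ε : ℂ} (h : IsEvenTheta ϑ ε) (m l : ℕ) :
    ε ^ ((m : ℤ) - 2 * l) = ε ^ m := by
  rw [zpow_sub₀ h.ne_zero, zpow_mul, zpow_natCast, show ε ^ (2 : ℤ) = 1 from by
    exact_mod_cast h.sq_eq_one, one_zpow, div_one]

/-- The B-product shifts by multiples of τ/2, under which F, ϑ(·|τ/2) and the Gaussian change by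
exponentials only, so they leave the sum. The powers of ϑ(·|η) created by the operators cancel those
in the initial condition. -/
theorem contigProd_mul_eq {ϑ : ℂ → ℂ → ℂ} {ε : ℂ} (hϑ : IsEvenTheta ϑ ε) {η τ : ℂ}
    (hη : 0 < η.im) (hτ : 0 < τ.im) {n m : ℕ} {β : ℤ} (hmβ : Even ((m : ℤ) - β)) {F G : ℂ → ℂ}
    (hF : HasThetaQuasiPeriod τ (n - 1) F)
    (hs2 : ∀ j : ℤ, j ≠ 0 → theta1 (2 * (τ / 2) * j) (2 * η) ≠ 0) {x : ℂ}
    (hx2 : ∀ j : ℤ, theta1 (2 * x + 2 * (τ / 2) * j) (2 * η) ≠ 0)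
    (hϑη : ∀ l : ℕ, ϑ (x + (m - 2 * l) * (τ / 2)) η ≠ 0) :
    contigProd ϑ (τ / 2) (2 * η) 0 m
        (fun z => (ϑ z η ^ m)⁻¹ * (ϑ z (τ / 2) ^ n)⁻¹ * (F z * G z)) x
      = ε ^ (m * n) * (ϑ x (τ / 2) ^ n)⁻¹ * halfShift τ (n - 1) β F x
        * coreSum (τ / 2) (2 * η) m G x := by
  have hη2 : 0 < (2 * η).im := by simpa using hη
  have hτ0 : τ ≠ 0 := by rintro rfl; simp at hτ
  rw [contigProd_zero_eq hϑ hη2 hs2 m _ hx2, ← coreSum_const_mul, ← coreSum_const_mul]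
  refine coreSum_congr fun l _ => ?_
  set y := x + (m - 2 * l) * (τ / 2) with hy
  have hyM : y = x + (((m : ℤ) - 2 * l : ℤ) : ℂ) * (τ / 2) := by rw [hy]; push_cast; ring
  have h1 := hF.apply_add_half (M := (m : ℤ) - 2 * l) (β := β) (by
    obtain ⟨c, hc⟩ := hmβ
    exact ⟨c - l, by omega⟩) x
  have h2 := hϑ.add_int_mul x (τ / 2) ((m : ℤ) - 2 * l)
  rw [hϑ.pow_eq_of_even] at h2
  rw [← hyM] at h1 h2
  have hne : ϑ y η ≠ 0 := hϑη l
  rw [mul_div_cancel_left₀ η (two_ne_zero), h1, h2]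
  generalize halfShift τ (n - 1) β F x = H
  have hpow : (ϑ y η) ^ m * ((ϑ y η) ^ m)⁻¹ = 1 := mul_inv_cancel₀ (pow_ne_zero _ hne)
  have hε : (ε ^ m)⁻¹ = ε ^ m := inv_eq_of_mul_eq_one_left (by
    rw [← mul_pow, ← pow_two, hϑ.sq_eq_one, one_pow])
  rw [mul_pow, mul_pow, mul_inv, mul_inv, ← inv_pow (ε ^ m), hε, ← pow_mul, ← Complex.exp_nat_mul,
    ← Complex.exp_neg]
  rw [show ∀ A T B T' e C D P H : ℂ, A * (T * (B * (T' * (e * C * P) * (D * H * G y))))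
    = (T * T') * (A * B * C * D) * (e * P * H * G y) by intros; ring, hpow, one_mul,
    ← Complex.exp_add, ← Complex.exp_add, ← Complex.exp_add]
  -- With M = m-2l and A = πiτM²/2 + 2πiMx, the Gaussians contribute -A, the power ϑ^{-n}
  -- contributes nA and F contributes -(n-1)A.
  have : cexp (π * I * x ^ 2 / (τ / 2) + -(π * I * y ^ 2 / (τ / 2))
      + -(n * (-(π * I * (((m : ℤ) - 2 * l : ℤ) : ℂ) ^ 2 * (τ / 2))
        - 2 * π * I * (((m : ℤ) - 2 * l : ℤ) : ℂ) * x))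
      + -((((n : ℤ) - 1 : ℤ) : ℂ) * (π * I * τ * (((m : ℤ) - 2 * l : ℤ) : ℂ) ^ 2 / 2
        + 2 * π * I * (((m : ℤ) - 2 * l : ℤ) : ℂ) * x))) = 1 := by
    rw [← Complex.exp_zero, hy]
    congr 1
    push_cast
    field_simp
    ring
  rw [this, one_mul]

theorem intertwinerDiff_eq_additiveForm {ϑ : ℂ → ℂ → ℂ} {ε : ℂ} (hϑ : IsEvenTheta ϑ ε) {η τ : ℂ}
    (hη : 0 < η.im) (hτ : 0 < τ.im) {n m : ℕ} {α β : ℤ}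
    (hnα : Even ((n : ℤ) - α)) (hmβ : Even ((m : ℤ) - β)) {F G : ℂ → ℂ}
    (hF : HasThetaQuasiPeriod τ (n - 1) F) (hG : HasThetaQuasiPeriod (2 * η) (m - 1) G)
    (hs1 : ∀ j : ℤ, j ≠ 0 → theta1 (2 * η * j) τ ≠ 0)
    (hs2 : ∀ j : ℤ, j ≠ 0 → theta1 (2 * (τ / 2) * j) (2 * η) ≠ 0) {z : ℂ}
    (hz : 4 * z ∉ periodGroup η τ) :
    intertwinerDiff ϑ η τ n m (fun x => F x * G x) z = additiveForm η τ n m α β F G z := by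
  have hη2 : 0 < (2 * η).im := by simpa using hη
  have hτ2 : 0 < (τ / 2).im := by rw [Complex.div_ofNat_im]; positivity
  have hη0 : η ≠ 0 := by rintro rfl; simp at hη
  have hz1 : ∀ j : ℤ, theta1 (2 * z + 2 * η * j) τ ≠ 0 := fun j =>
    theta1_ne_zero hτ fun a b hab => hz ⟨2 * a, 2 * b, -2 * j, by
      push_cast; linear_combination 2 * hab⟩
  rw [intertwinerDiff, contigProd_add_half hϑ hη0, contigProd_zero_eq hϑ hτ hs1 n _ hz1,
    additiveForm_eq]
  have hcore : coreSum η τ n (fun x => ϑ x (τ / 2) ^ n * (cexp (-(π * I * x ^ 2 / η))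
      * (cexp (-(π * I * m * x ^ 2 / η)) * contigProd ϑ (τ / 2) (2 * η) 0 m
        (fun z => (ϑ z η ^ m)⁻¹ * (ϑ z (τ / 2) ^ n)⁻¹ * (F z * G z)) x))) z
      = coreSum η τ n (fun x => (ε ^ (m * n) * (-1) ^ (n * m)
        * cexp (-((m + 1) * (π * I * z ^ 2 / η)))
        * coreSum (τ / 2) (2 * η) m (halfShift (2 * η) (m - 1) α G) z)
        * halfShift τ (n - 1) β F x) z := by
    refine coreSum_congr fun k _ => ?_
    set x := z + (n - 2 * k) * η with hx
    have hxK : x = z + (((n : ℤ) - 2 * k : ℤ) : ℂ) * (2 * η / 2) := by rw [hx]; push_cast; ring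
    have hx2 : ∀ j : ℤ, theta1 (2 * x + 2 * (τ / 2) * j) (2 * η) ≠ 0 := fun j =>
      theta1_ne_zero hη2 fun a b hab => hz ⟨2 * a, -2 * j, 2 * b - 2 * n + 4 * k, by
        rw [hx] at hab; push_cast; linear_combination 2 * hab⟩
    -- The doubles of the zeros of θ₃(·|η) and θ₄(·|η) lie in ℤ + ℤη, which contains half of the
    -- generator 2η; excluding them uses 4z rather than 2z.
    have hϑη : ∀ l : ℕ, ϑ (x + (m - 2 * l) * (τ / 2)) η ≠ 0 := fun l =>
      hϑ.apply_ne_zero hη fun a b hab => hz ⟨2 * a, 4 * l - 2 * m, b - 2 * n + 4 * k, by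
        rw [hx] at hab; push_cast; linear_combination 2 * hab⟩
    have hϑτ : ϑ x (τ / 2) ≠ 0 :=
      hϑ.apply_ne_zero hτ2 fun a b hab => hz ⟨2 * a, b, 4 * k - 2 * n, by
        rw [hx] at hab; push_cast; linear_combination 2 * hab⟩
    -- A shift by Kη multiplies the G-sum by a sign and exp((m+1)πi(ηK²+2Kz)). As x²/η =
    -- z²/η+2Kz+ηK², this replaces the Gaussian at x by the one at z, and the G-sum can leave the
    -- sum over k.
    have h1 := coreSum_add_half (s := τ / 2) hG (K := (n : ℤ) - 2 * k) (β := α) (by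
      obtain ⟨c, hc⟩ := hnα
      exact ⟨c - k, by omega⟩) z
    rw [← hxK] at h1
    have hsgn : (((-1 : ℂ) ^ ((n : ℤ) - 2 * k)) ^ m) = (-1) ^ (n * m) := by
      rw [zpow_sub₀ (by norm_num), zpow_mul, zpow_natCast, pow_mul]
      norm_num
    rw [contigProd_mul_eq hϑ hη hτ hmβ hF hs2 hx2 hϑη, h1, hsgn]
    have hpow : ϑ x (τ / 2) ^ n * (ϑ x (τ / 2) ^ n)⁻¹ = 1 := mul_inv_cancel₀ (pow_ne_zero _ hϑτ)
    rw [show ∀ T A B e T' H s C S : ℂ, T * (A * (B * (e * T' * H * (s * C * S))))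
      = (T * T') * (e * s * (A * B * C) * S * H) by intros; ring, hpow, one_mul,
      ← Complex.exp_add, ← Complex.exp_add]
    congr 4
    rw [hx]
    push_cast
    field_simp
    ring
  rw [hcore, coreSum_const_mul, show ∀ e C A B e' s D S T : ℂ,
    e * C * (A * (B * (e' * s * D * S * T))) = (e * e') * (s * (A * B * D * C) * T * S) by
    intros; ring, ← Complex.exp_add, ← Complex.exp_add, ← Complex.exp_add, ← mul_pow, ← pow_two,
    hϑ.sq_eq_one, one_pow, one_mul]
  congr 4
  field_simp
  ring


/-! ## The double infinite product -/

/-- `exp(2πiu)`. -/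
noncomputable def expTwoPi (u : ℂ) : ℂ := cexp (2 * π * I * u)

theorem expTwoPi_add (u v : ℂ) : expTwoPi (u + v) = expTwoPi u * expTwoPi v := by
  rw [expTwoPi, expTwoPi, expTwoPi, ← Complex.exp_add, mul_add]

theorem expTwoPi_zero : expTwoPi 0 = 1 := by rw [expTwoPi, mul_zero, Complex.exp_zero]

theorem expTwoPi_ne_zero (u : ℂ) : expTwoPi u ≠ 0 := Complex.exp_ne_zero _

theorem expTwoPi_neg (u : ℂ) : expTwoPi (-u) = (expTwoPi u)⁻¹ := by
  rw [expTwoPi, expTwoPi, ← Complex.exp_neg, mul_neg]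

theorem expTwoPi_int (a : ℤ) : expTwoPi a = 1 := exp_two_pi_mul_I_int a

theorem expTwoPi_add_int (u : ℂ) (a : ℤ) : expTwoPi (u + a) = expTwoPi u := by
  rw [expTwoPi_add, expTwoPi_int, mul_one]

theorem expTwoPi_add_one (u : ℂ) : expTwoPi (u + 1) = expTwoPi u := by
  exact_mod_cast expTwoPi_add_int u 1

theorem expTwoPi_eq_one_iff {u : ℂ} : expTwoPi u = 1 ↔ ∃ a : ℤ, u = a := by
  rw [expTwoPi, Complex.exp_eq_one_iff]
  refine exists_congr fun a => ?_
  rw [mul_comm, mul_left_inj' Complex.two_pi_I_ne_zero]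

theorem norm_expTwoPi (u : ℂ) : ‖expTwoPi u‖ = Real.exp (-(2 * π * u.im)) := by
  rw [expTwoPi, Complex.norm_exp]
  congr 1
  simp

theorem norm_expTwoPi_lt_one {u : ℂ} : ‖expTwoPi u‖ < 1 ↔ 0 < u.im := by
  rw [norm_expTwoPi, Real.exp_lt_one_iff, neg_lt_zero]
  exact mul_pos_iff_of_pos_left (by positivity)

theorem expTwoPi_ne_one {u : ℂ} (hu : 0 < u.im) : expTwoPi u ≠ 1 := by
  intro h
  have := norm_expTwoPi_lt_one.mpr hu
  rw [h, norm_one] at this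
  exact lt_irrefl _ this

theorem differentiable_expTwoPi : Differentiable ℂ expTwoPi := by
  unfold expTwoPi; fun_prop

theorem hasDerivAt_expTwoPi (u : ℂ) : HasDerivAt expTwoPi (2 * π * I * expTwoPi u) u := by
  have := ((hasDerivAt_id u).const_mul (2 * π * I : ℂ)).cexp
  simp only [id, mul_one] at this
  rw [mul_comm]
  exact this

theorem nomePow_eq_expTwoPi (ω s : ℂ) : nomePow ω s = expTwoPi (ω * s) := by
  rw [nomePow, expTwoPi, mul_assoc]

theorem expTwoPi_nat_mul (ω : ℂ) (k : ℕ) : expTwoPi (k * ω) = expTwoPi ω ^ k := by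
  rw [expTwoPi, expTwoPi, ← Complex.exp_nat_mul]
  congr 1
  ring

/-- The weights of the double product without the pairs in `S`. -/
noncomputable def dWeight (ω₁ ω₂ : ℂ) (S : Finset (ℕ × ℕ)) (x : ℕ × ℕ) : ℂ :=
  if x ∈ S then 0 else expTwoPi (x.1 * ω₁ + x.2 * ω₂)

/-- The product `∏_{(i,j) ∉ S} (1 - exp(2πi(u + iω₁ + jω₂)))`. -/
noncomputable def dPoch (ω₁ ω₂ : ℂ) (S : Finset (ℕ × ℕ)) (u : ℂ) : ℂ :=
  ∏' x : ℕ × ℕ, (1 - expTwoPi u * dWeight ω₁ ω₂ S x)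

section DoubleProduct

variable {ω₁ ω₂ : ℂ}

theorem summable_dWeight (h₁ : 0 < ω₁.im) (h₂ : 0 < ω₂.im) (S : Finset (ℕ × ℕ)) :
    Summable fun x => ‖dWeight ω₁ ω₂ S x‖ := by
  have := Summable.mul_of_nonneg
    (summable_geometric_of_lt_one (norm_nonneg _) (norm_expTwoPi_lt_one.mpr h₁))
    (summable_geometric_of_lt_one (norm_nonneg _) (norm_expTwoPi_lt_one.mpr h₂))
    (fun _ => by positivity) (fun _ => by positivity)
  refine this.of_nonneg_of_le (fun _ => norm_nonneg _) fun x => ?_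
  rw [dWeight]
  split_ifs
  · rw [norm_zero]; positivity
  · rw [expTwoPi_add, expTwoPi_nat_mul, expTwoPi_nat_mul, norm_mul, norm_pow, norm_pow]

theorem multipliable_dPoch (h₁ : 0 < ω₁.im) (h₂ : 0 < ω₂.im) (S : Finset (ℕ × ℕ)) (w : ℂ) :
    Multipliable fun x => 1 - w * dWeight ω₁ ω₂ S x := by
  have := multipliable_one_add_of_summable (f := fun x => -(w * dWeight ω₁ ω₂ S x)) (by
    simp only [norm_neg, norm_mul]
    exact (summable_dWeight h₁ h₂ S).mul_left _)
  simpa [sub_eq_add_neg] using this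

theorem differentiable_dPoch (h₁ : 0 < ω₁.im) (h₂ : 0 < ω₂.im) (S : Finset (ℕ × ℕ)) :
    Differentiable ℂ (dPoch ω₁ ω₂ S) :=
  (differentiable_tprod_one_sub_mul (summable_dWeight h₁ h₂ S)).comp differentiable_expTwoPi

theorem dPoch_add_one (S : Finset (ℕ × ℕ)) (u : ℂ) :
    dPoch ω₁ ω₂ S (u + 1) = dPoch ω₁ ω₂ S u := by
  rw [dPoch, dPoch, expTwoPi_add_one]

theorem dPoch_ne_zero (h₁ : 0 < ω₁.im) (h₂ : 0 < ω₂.im) {S : Finset (ℕ × ℕ)} {u : ℂ}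
    (h : ∀ i j : ℕ, (i, j) ∉ S → expTwoPi (u + (i * ω₁ + j * ω₂)) ≠ 1) :
    dPoch ω₁ ω₂ S u ≠ 0 := by
  have := tprod_one_add_ne_zero_of_summable (f := fun x => -(expTwoPi u * dWeight ω₁ ω₂ S x))
    (fun x => by
      rw [← sub_eq_add_neg, sub_ne_zero, dWeight]
      split_ifs with hx
      · rw [mul_zero]; exact one_ne_zero
      · rw [← expTwoPi_add]
        exact (h x.1 x.2 hx).symm) (by
    simp only [norm_neg, norm_mul]
    exact (summable_dWeight h₁ h₂ S).mul_left _)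
  simpa [sub_eq_add_neg, dPoch] using this

theorem dPoch_ne_zero_of_im_pos (h₁ : 0 < ω₁.im) (h₂ : 0 < ω₂.im) (S : Finset (ℕ × ℕ)) {u : ℂ}
    (hu : 0 < u.im) : dPoch ω₁ ω₂ S u ≠ 0 :=
  dPoch_ne_zero h₁ h₂ fun i j _ => expTwoPi_ne_one (by simp; positivity)

theorem dPoch_eq_zero {S : Finset (ℕ × ℕ)} {i j : ℕ} (hij : (i, j) ∉ S) {u : ℂ}
    (h : expTwoPi (u + (i * ω₁ + j * ω₂)) = 1) : dPoch ω₁ ω₂ S u = 0 := by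
  refine tprod_of_exists_eq_zero ⟨(i, j), ?_⟩
  rw [dWeight, if_neg hij, ← expTwoPi_add, h, sub_self]

theorem dPoch_eq_prod_sdiff_mul (h₁ : 0 < ω₁.im) (h₂ : 0 < ω₂.im) {T S : Finset (ℕ × ℕ)}
    (hTS : T ⊆ S) (u : ℂ) : dPoch ω₁ ω₂ T u
      = (∏ x ∈ S \ T, (1 - expTwoPi (u + (x.1 * ω₁ + x.2 * ω₂)))) * dPoch ω₁ ω₂ S u := by
  have h3 : HasProd (fun x : ℕ × ℕ =>
      if x ∈ S \ T then 1 - expTwoPi (u + (x.1 * ω₁ + x.2 * ω₂)) else 1)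
      (∏ x ∈ S \ T, (1 - expTwoPi (u + (x.1 * ω₁ + x.2 * ω₂)))) := by
    have h : HasProd _ (∏ x ∈ S \ T, if x ∈ S \ T then
        1 - expTwoPi (u + (x.1 * ω₁ + x.2 * ω₂)) else 1) (.unconditional _) :=
      hasProd_prod_of_ne_finset_one (f := fun x : ℕ × ℕ =>
        if x ∈ S \ T then 1 - expTwoPi (u + (x.1 * ω₁ + x.2 * ω₂)) else 1) fun x hx => if_neg hx
    rwa [Finset.prod_congr rfl fun x hx => if_pos hx] at h
  have h4 := h3.mul (multipliable_dPoch h₁ h₂ S (expTwoPi u)).hasProd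
  refine Eq.trans (tprod_congr fun x => ?_) h4.tprod_eq
  rw [dWeight, dWeight]
  by_cases hT : x ∈ T
  · simp [hT, hTS hT]
  · by_cases hS : x ∈ S
    · simp [hT, hS, expTwoPi_add]
    · simp [hT, hS]

theorem dPoch_eq_prod_mul (h₁ : 0 < ω₁.im) (h₂ : 0 < ω₂.im) (S : Finset (ℕ × ℕ)) (u : ℂ) :
    dPoch ω₁ ω₂ ∅ u
      = (∏ x ∈ S, (1 - expTwoPi (u + (x.1 * ω₁ + x.2 * ω₂)))) * dPoch ω₁ ω₂ S u := by
  rw [dPoch_eq_prod_sdiff_mul h₁ h₂ (Finset.empty_subset S), Finset.sdiff_empty]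

theorem dPoch_swap (u : ℂ) : dPoch ω₂ ω₁ ∅ u = dPoch ω₁ ω₂ ∅ u := by
  rw [dPoch, dPoch, ← (Equiv.prodComm ℕ ℕ).tprod_eq]
  refine tprod_congr fun x => ?_
  simp [dWeight, add_comm]

/-- The factors with second index 0 are split off and the others are reindexed. -/
theorem dPoch_add_snd (h₁ : 0 < ω₁.im) (h₂ : 0 < ω₂.im) (u : ℂ) :
    dPoch ω₁ ω₂ ∅ u = qPoch (expTwoPi u) ω₁ * dPoch ω₁ ω₂ ∅ (u + ω₂) := by
  have hfib : ∀ (v : ℂ) (i : ℕ),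
      Multipliable fun j : ℕ => 1 - expTwoPi v * dWeight ω₁ ω₂ ∅ (i, j) := fun v i => by
    have := multipliable_one_sub_mul_pow (expTwoPi v * expTwoPi (i * ω₁))
      (norm_expTwoPi_lt_one.mpr h₂)
    refine this.congr fun j => ?_
    rw [dWeight, if_neg (Finset.notMem_empty _), expTwoPi_add, expTwoPi_nat_mul ω₂, mul_assoc]
  have hM : ∀ v : ℂ, Multipliable fun i : ℕ =>
      ∏' j : ℕ, (1 - expTwoPi v * dWeight ω₁ ω₂ ∅ (i, j)) := fun v =>
    ((multipliable_dPoch h₁ h₂ ∅ (expTwoPi v)).hasProd.prod_fiberwise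
      fun i => (hfib v i).hasProd).multipliable
  rw [dPoch, dPoch, (multipliable_dPoch h₁ h₂ ∅ _).tprod_prod' (hfib u),
    (multipliable_dPoch h₁ h₂ ∅ _).tprod_prod' (hfib (u + ω₂)), qPoch_eq]
  have hstep : ∀ i : ℕ, ∏' j : ℕ, (1 - expTwoPi u * dWeight ω₁ ω₂ ∅ (i, j))
      = (1 - expTwoPi u * nomePow ω₁ 1 ^ i)
        * ∏' j : ℕ, (1 - expTwoPi (u + ω₂) * dWeight ω₁ ω₂ ∅ (i, j)) := by
    intro i
    have e : ∀ j : ℕ, 1 - expTwoPi u * dWeight ω₁ ω₂ ∅ (i, j + 1)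
        = 1 - expTwoPi (u + ω₂) * dWeight ω₁ ω₂ ∅ (i, j) := fun j => by
      simp only [dWeight, Finset.notMem_empty, if_false]
      rw [← expTwoPi_add, ← expTwoPi_add]
      congr 2
      push_cast
      ring
    rw [tprod_eq_zero_mul' ((hfib (u + ω₂) i).congr fun j => (e j).symm), tprod_congr e]
    congr 1
    simp only [dWeight, Finset.notMem_empty, if_false]
    rw [← nomePow_natCast, nomePow_eq_expTwoPi]
    congr 3
    push_cast
    ring
  rw [tprod_congr hstep]
  exact (multipliable_one_sub_mul_pow _ (norm_nomePow_one_lt h₁)).tprod_mul (hM (u + ω₂))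

theorem dPoch_add_fst (h₁ : 0 < ω₁.im) (h₂ : 0 < ω₂.im) (u : ℂ) :
    dPoch ω₁ ω₂ ∅ u = qPoch (expTwoPi u) ω₂ * dPoch ω₁ ω₂ ∅ (u + ω₁) := by
  rw [← dPoch_swap, dPoch_add_snd h₂ h₁, dPoch_swap]

theorem ellGamma_eq {η τ : ℂ} (hη : 0 < (2 * η).im) (hτ : 0 < τ.im) (u : ℂ) :
    ellGamma η τ u = dPoch τ (2 * η) ∅ (τ + 2 * η - u) / dPoch τ (2 * η) ∅ u := by
  have hterm : ∀ x : ℕ × ℕ, (1 - cexp (-2 * π * I * u)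
        * nomePow τ (x.1 + 1) * nomePow (2 * η) (x.2 + 1))
      / (1 - cexp (2 * π * I * u) * nomePow τ x.1 * nomePow (2 * η) x.2)
      = (1 - expTwoPi (τ + 2 * η - u) * dWeight τ (2 * η) ∅ x)
        * (1 - expTwoPi u * dWeight τ (2 * η) ∅ x)⁻¹ := by
    intro x
    rw [div_eq_mul_inv, dWeight, if_neg (Finset.notMem_empty x), ← expTwoPi_add, ← expTwoPi_add]
    simp only [nomePow, expTwoPi]
    rw [← Complex.exp_add, ← Complex.exp_add, ← Complex.exp_add, ← Complex.exp_add]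
    congr 4 <;> ring
  rw [ellGamma, tprod_congr hterm]
  -- At a zero of the denominator both sides are 0 by the convention for division by zero, since the
  -- infinite product then has a factor 0.
  by_cases h0 : dPoch τ (2 * η) ∅ u = 0
  · rw [h0, div_zero]
    by_contra hne
    have hx : ∃ i j : ℕ, expTwoPi (u + (i * τ + j * (2 * η))) = 1 := by
      by_contra! hc
      exact dPoch_ne_zero hτ hη (fun i j _ => hc i j) h0
    obtain ⟨i, j, hij⟩ := hx
    refine hne (tprod_of_exists_eq_zero ⟨(i, j), ?_⟩)
    simp only [dWeight, Finset.notMem_empty, if_false]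
    rw [← expTwoPi_add u, hij, sub_self, inv_zero, mul_zero]
  · have h1 := (multipliable_dPoch hτ hη ∅ (expTwoPi u)).hasProd
    have h2 := (multipliable_dPoch hτ hη ∅ (expTwoPi (τ + 2 * η - u))).hasProd
    have h3 : HasProd (fun x => (1 - expTwoPi u * dWeight τ (2 * η) ∅ x)⁻¹)
        (dPoch τ (2 * η) ∅ u)⁻¹ := by
      have := Filter.Tendsto.inv₀ h1 h0
      rw [HasProd]
      refine this.congr fun s => ?_
      rw [Finset.prod_inv_distrib]
    rw [(h2.mul h3).tprod_eq, div_eq_mul_inv]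
    rfl

/-- The double product at its zero `-(lω₁ + kω₂)`, without the vanishing factor. -/
noncomputable def dPochHat (ω₁ ω₂ : ℂ) (l k : ℕ) : ℂ :=
  dPoch ω₁ ω₂ {(l, k)} (-(l * ω₁ + k * ω₂))

/-- The factor (l,k) vanishes here with derivative -2πi. The recursions of `dPochHat` follow by
differentiating those of the double product. -/
theorem hasDerivAt_dPoch (h₁ : 0 < ω₁.im) (h₂ : 0 < ω₂.im) (l k : ℕ) :
    HasDerivAt (dPoch ω₁ ω₂ ∅) (-(2 * π * I) * dPochHat ω₁ ω₂ l k) (-(l * ω₁ + k * ω₂)) := by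
  have h3 : HasDerivAt (fun u => 1 - expTwoPi (u + (l * ω₁ + k * ω₂))) (-(2 * π * I))
      (-(l * ω₁ + k * ω₂)) := by
    have := (HasDerivAt.comp_add_const (-(l * ω₁ + k * ω₂)) (l * ω₁ + k * ω₂)
      (hasDerivAt_expTwoPi (-(l * ω₁ + k * ω₂) + (l * ω₁ + k * ω₂)))).const_sub 1
    rwa [neg_add_cancel, expTwoPi_zero, mul_one] at this
  have h4 := h3.mul (differentiable_dPoch h₁ h₂ {(l, k)} (-(l * ω₁ + k * ω₂))).hasDerivAt
  rw [neg_add_cancel, expTwoPi_zero, sub_self, zero_mul, add_zero] at h4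
  refine h4.congr_of_eventuallyEq (Eventually.of_forall fun u => ?_)
  rw [dPoch_eq_prod_mul h₁ h₂ {(l, k)} u, Finset.prod_singleton]
  rfl

theorem hasDerivAt_qPoch_expTwoPi {ω : ℂ} (hω : 0 < ω.im) (u : ℂ) :
    ∃ d, HasDerivAt (fun u => qPoch (expTwoPi u) ω) d u :=
  ⟨_, ((differentiable_qPoch hω).comp differentiable_expTwoPi u).hasDerivAt⟩

/-- The functional equation is differentiated at a zero; the term with the derivative of `qPoch`
drops out because its cofactor vanishes. -/
theorem dPochHat_succ_snd (h₁ : 0 < ω₁.im) (h₂ : 0 < ω₂.im) (l k : ℕ) :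
    dPochHat ω₁ ω₂ l (k + 1)
      = qPoch (expTwoPi (-(l * ω₁ + (k + 1) * ω₂))) ω₁ * dPochHat ω₁ ω₂ l k := by
  have h3 := hasDerivAt_dPoch h₁ h₂ l (k + 1)
  have h4 := hasDerivAt_dPoch h₁ h₂ l k
  obtain ⟨d, hd⟩ := hasDerivAt_qPoch_expTwoPi h₁ (-(l * ω₁ + (k + 1) * ω₂))
  rw [show -((l : ℂ) * ω₁ + ((k + 1 : ℕ) : ℂ) * ω₂) = -(l * ω₁ + (k + 1) * ω₂) by
    push_cast; ring] at h3
  have e : -((l : ℂ) * ω₁ + k * ω₂) = -(l * ω₁ + (k + 1) * ω₂) + ω₂ := by ring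
  rw [e] at h4
  have h5 := hd.mul (HasDerivAt.comp_add_const (-(l * ω₁ + (k + 1) * ω₂)) ω₂ h4)
  have h0 : dPoch ω₁ ω₂ ∅ (-(l * ω₁ + (k + 1) * ω₂) + ω₂) = 0 :=
    dPoch_eq_zero (i := l) (j := k) (Finset.notMem_empty _) (by
      rw [← e, neg_add_cancel, expTwoPi_zero])
  have hfun : dPoch ω₁ ω₂ ∅
      = (fun u => qPoch (expTwoPi u) ω₁) * fun u => dPoch ω₁ ω₂ ∅ (u + ω₂) :=
    funext fun u => dPoch_add_snd h₁ h₂ u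
  rw [← hfun, h0, mul_zero, zero_add] at h5
  have := h3.unique h5
  refine mul_left_cancel₀ (neg_ne_zero.mpr Complex.two_pi_I_ne_zero) ?_
  linear_combination this

theorem dPochHat_swap (h₁ : 0 < ω₁.im) (h₂ : 0 < ω₂.im) (l k : ℕ) :
    dPochHat ω₂ ω₁ k l = dPochHat ω₁ ω₂ l k := by
  have h3 := hasDerivAt_dPoch h₁ h₂ l k
  have h4 := hasDerivAt_dPoch h₂ h₁ k l
  rw [show dPoch ω₂ ω₁ ∅ = dPoch ω₁ ω₂ ∅ from funext fun u => dPoch_swap u,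
    add_comm ((k : ℂ) * ω₂)] at h4
  exact mul_left_cancel₀ (neg_ne_zero.mpr Complex.two_pi_I_ne_zero) (h4.unique h3)

theorem dPochHat_zero_zero (h₁ : 0 < ω₁.im) (h₂ : 0 < ω₂.im) :
    dPochHat ω₁ ω₂ 0 0
      = qPoch (nomePow ω₁ 1) ω₁ * qPoch (nomePow ω₂ 1) ω₂ * dPoch ω₁ ω₂ ∅ (ω₁ + ω₂) := by
  have h3 := hasDerivAt_dPoch h₁ h₂ 0 0
  simp only [Nat.cast_zero, zero_mul, add_zero, neg_zero] at h3
  have hq : DifferentiableAt ℂ (fun u => qPoch (expTwoPi u * nomePow ω₁ 1) ω₁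
      * dPoch ω₁ ω₂ ∅ (u + ω₂)) 0 := by
    have a1 : Differentiable ℂ fun u => qPoch (expTwoPi u * nomePow ω₁ 1) ω₁ :=
      (differentiable_qPoch h₁).comp (differentiable_expTwoPi.mul_const _)
    have a2 : Differentiable ℂ fun u => dPoch ω₁ ω₂ ∅ (u + ω₂) :=
      (differentiable_dPoch h₁ h₂ ∅).comp (differentiable_id.add_const ω₂)
    exact (a1.mul a2) 0
  have h4 := ((hasDerivAt_expTwoPi 0).const_sub 1).mul hq.hasDerivAt
  have hfun : dPoch ω₁ ω₂ ∅ = (fun u => 1 - expTwoPi u) * fun u =>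
      qPoch (expTwoPi u * nomePow ω₁ 1) ω₁ * dPoch ω₁ ω₂ ∅ (u + ω₂) :=
    funext fun u => by
      rw [dPoch_add_snd h₁ h₂ u, qPoch_eq_mul _ h₁, mul_assoc]; rfl
  rw [← hfun, expTwoPi_zero, sub_self, zero_mul, add_zero, one_mul, zero_add, mul_one] at h4
  have h5 := h3.unique h4
  have h6 := dPoch_add_fst h₁ h₂ ω₂
  rw [h6] at h5
  rw [nomePow_eq_expTwoPi ω₂, mul_one, add_comm ω₁ ω₂]
  refine mul_left_cancel₀ (neg_ne_zero.mpr Complex.two_pi_I_ne_zero) ?_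
  linear_combination h5

/-- Incommensurability of the periods excludes a second vanishing factor. -/
theorem dPochHat_ne_zero (h₁ : 0 < ω₁.im) (h₂ : 0 < ω₂.im)
    (hinc : ∀ a b c : ℤ, (a : ℂ) + b * ω₁ + c * ω₂ = 0 → a = 0 ∧ b = 0 ∧ c = 0) (l k : ℕ) :
    dPochHat ω₁ ω₂ l k ≠ 0 := by
  refine dPoch_ne_zero h₁ h₂ fun i j hij h => hij ?_
  obtain ⟨a, ha⟩ := expTwoPi_eq_one_iff.mp h
  obtain ⟨-, h3, h4⟩ := hinc (-a) (i - l) (j - k) (by push_cast; linear_combination ha)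
  rw [Finset.mem_singleton, Prod.mk.injEq]
  omega

end DoubleProduct


/-! ## Contour integrals of periodic functions -/

/-- Cauchy's theorem on a rectangle of width 1, whose vertical sides cancel by periodicity. -/
theorem integral_add_mul_I_eq {f : ℂ → ℂ} (hper : ∀ x, f (x + 1) = f x) {y₁ y₂ : ℝ}
    (hf : ∀ x : ℂ, x.im ∈ Set.uIcc y₁ y₂ → DifferentiableAt ℂ f x) :
    ∫ t in (0 : ℝ)..1, f (t + y₁ * I) = ∫ t in (0 : ℝ)..1, f (t + y₂ * I) := by
  have h := integral_boundary_rect_eq_zero_of_differentiableOn f (y₁ * I) (1 + y₂ * I)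
    (fun x hx => (hf x (by simpa using hx.2)).differentiableWithinAt)
  simp only [mul_re, ofReal_re, I_re, mul_zero, ofReal_im, I_im, mul_one, sub_self, add_re, one_re,
    add_zero, mul_im, zero_add, add_im, one_im, ofReal_zero, ofReal_one] at h
  have e : ∀ y : ℝ, f (1 + y * I) = f (0 + y * I) := fun y => by
    rw [zero_add, add_comm, hper]
  simp only [e, zero_add, add_sub_cancel_right] at h
  exact sub_eq_zero.mp h

/-- A periodic primitive is -log(1-e(c+t))/(2πi), with the principal branch because 1 - e(c+t) has
positive real part. -/
theorem integral_expTwoPi_div_one_sub {c : ℂ} (hc : 0 < c.im) :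
    ∫ t in (0 : ℝ)..1, expTwoPi (c + t) / (1 - expTwoPi (c + t)) = 0 := by
  have hs : ∀ t : ℝ, 0 < (1 - expTwoPi (c + t)).re := fun t => by
    have h1 : ‖expTwoPi (c + t)‖ < 1 := norm_expTwoPi_lt_one.mpr (by simpa using hc)
    have h2 := Complex.re_le_norm (expTwoPi (c + t))
    simp only [sub_re, one_re]
    linarith
  have hne : ∀ t : ℝ, 1 - expTwoPi (c + t) ≠ 0 := fun t h => by
    have := hs t
    rw [h] at this
    exact lt_irrefl _ this
  have hd : ∀ t : ℝ, HasDerivAt (fun t : ℝ => -(2 * π * I)⁻¹ * Complex.log (1 - expTwoPi (c + t)))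
      (expTwoPi (c + t) / (1 - expTwoPi (c + t))) t := fun t => by
    have h1 : HasDerivAt (fun u : ℂ => 1 - expTwoPi (c + u)) (-(2 * π * I * expTwoPi (c + t))) t :=
      (HasDerivAt.comp_const_add c (t : ℂ) (hasDerivAt_expTwoPi (c + t))).const_sub 1
    have h2 := (h1.clog (Or.inl (hs t))).const_mul (-(2 * π * I)⁻¹)
    convert h2.comp_ofReal using 1
    have := Complex.two_pi_I_ne_zero
    field_simp
  have hcont : Continuous fun t : ℝ => expTwoPi (c + t) / (1 - expTwoPi (c + t)) := by
    have : Continuous fun t : ℝ => expTwoPi (c + t) :=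
      differentiable_expTwoPi.continuous.comp (by fun_prop)
    exact this.div (continuous_const.sub this) hne
  rw [intervalIntegral.integral_eq_sub_of_hasDerivAt (fun t _ => hd t)
    (hcont.intervalIntegrable _ _)]
  simp [expTwoPi_add_one]

theorem integral_expTwoPi_sub_div_one_sub {c : ℂ} (hc : 0 < c.im) :
    ∫ t in (0 : ℝ)..1, expTwoPi (c - t) / (1 - expTwoPi (c - t)) = 0 := by
  have h := intervalIntegral.integral_comp_sub_left
    (fun t : ℝ => expTwoPi (c + t) / (1 - expTwoPi (c + t))) (a := 0) (b := 1) 1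
  rw [sub_self, sub_zero, integral_expTwoPi_div_one_sub hc] at h
  rw [← h]
  refine intervalIntegral.integral_congr fun t _ => ?_
  have e : expTwoPi (c + ((1 - t : ℝ) : ℂ)) = expTwoPi (c - t) := by
    rw [← expTwoPi_add_one (c - t)]
    congr 1
    push_cast
    ring
  simp only [e]

theorem one_sub_expTwoPi_ne_zero {u : ℂ} (hu : 0 < u.im) : 1 - expTwoPi u ≠ 0 :=
  sub_ne_zero.mpr (expTwoPi_ne_one hu).symm

theorem isOpen_strip (Y : ℝ) : IsOpen {x : ℂ | |x.im| < Y} :=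
  isOpen_lt (continuous_abs.comp Complex.continuous_im) continuous_const

theorem continuous_comp_line {f : ℂ → ℂ} {Y : ℝ} (hf : DifferentiableOn ℂ f {x | |x.im| < Y})
    {y : ℝ} (hy : |y| < Y) : Continuous fun t : ℝ => f (t + y * I) := by
  refine hf.continuousOn.comp_continuous (by fun_prop) fun t => ?_
  simpa using hy

/-- The residue theorem for a strip: the difference of the integrals of `f(x)/(1 - e(x - x₀))`
over `Im x = y` and `Im x = -y`, in the form in which both integrands are expanded in powers of
an exponential of modulus less than one. -/
theorem integral_add_integral_eq {f : ℂ → ℂ} {Y y : ℝ} (hper : ∀ x, f (x + 1) = f x)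
    (hf : DifferentiableOn ℂ f {x | |x.im| < Y}) (hy : y < Y) {x₀ : ℂ} (hx : |x₀.im| < y) :
    (∫ t in (0 : ℝ)..1, f (t + y * I) / (1 - expTwoPi (t + y * I - x₀)))
      + ∫ t in (0 : ℝ)..1, f (t - y * I) *
        (expTwoPi (-(t - y * I) + x₀) / (1 - expTwoPi (-(t - y * I) + x₀))) = f x₀ := by
  have hy0 : 0 < y := (abs_nonneg _).trans_lt hx
  obtain ⟨hx1, hx2⟩ := abs_lt.mp hx
  set D : ℂ → ℂ := fun x => 1 - expTwoPi (x - x₀) with hD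
  have hDd : Differentiable ℂ D :=
    (differentiable_expTwoPi.comp (differentiable_id.sub_const x₀)).const_sub 1
  have hD0 : ∀ x, D x = 0 → ∃ a : ℤ, x = x₀ + a := fun x h => by
    obtain ⟨a, ha⟩ := expTwoPi_eq_one_iff.mp (sub_eq_zero.mp h).symm
    exact ⟨a, by rw [← ha]; ring⟩
  have hperZ : ∀ (a : ℤ) x, f (x + a) = f x := fun a x => by
    have := Function.Periodic.int_mul (f := f) (c := 1) hper a x
    rwa [mul_one] at this
  -- Subtraction of the constant f(x₀) removes the poles, so the quotient has equal integrals over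
  -- both lines. The constant itself contributes f(x₀) on the upper line and 0 on the lower one.
  set k : ℂ → ℂ := fun x => f x - f x₀ with hk
  set φ := divExt k D with hφ
  have hkD : ∀ x, D x = 0 → k x = 0 := fun x h => by
    obtain ⟨a, rfl⟩ := hD0 x h
    rw [hk]
    simp only [hperZ, sub_self]
  have hφd : DifferentiableOn ℂ φ {x | |x.im| < Y} :=
    differentiableOn_divExt (isOpen_strip Y) (hf.sub_const _) hDd.differentiableOn (fun x _ h => hkD x h)
      fun x _ h => by
        obtain ⟨a, rfl⟩ := hD0 x h
        have := (HasDerivAt.comp_sub_const (x₀ + a) x₀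
          (hasDerivAt_expTwoPi (x₀ + a - x₀))).const_sub 1
        have e : expTwoPi (x₀ + a - x₀) = 1 := by rw [add_sub_cancel_left, expTwoPi_int]
        rw [e, mul_one] at this
        rw [this.deriv]
        exact neg_ne_zero.mpr Complex.two_pi_I_ne_zero
  have hDper : ∀ x, D (x + 1) = D x := fun x => by
    simp only [hD]
    rw [add_sub_right_comm, expTwoPi_add_one]
  have hφper : ∀ x, φ (x + 1) = φ x := fun x => by
    have h1 : deriv k (x + 1) = deriv k x := by
      rw [← deriv_comp_add_const]
      congr 1
      ext u
      simp only [hk, hper]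
    have h2 : deriv D (x + 1) = deriv D x := by
      rw [← deriv_comp_add_const]
      congr 1
      ext u
      exact hDper u
    rw [hφ, divExt, divExt, h1, h2, hDper]
    simp only [hk, hper]
  have hshift := integral_add_mul_I_eq hφper (y₁ := y) (y₂ := -y) fun x hx =>
    (hφd x (by
      rw [Set.uIcc_of_ge (by linarith)] at hx
      exact (abs_le.mpr hx).trans_lt hy)).differentiableAt
      ((isOpen_strip Y).mem_nhds ((abs_le.mpr (by
        rwa [Set.uIcc_of_ge (by linarith)] at hx)).trans_lt hy))
  have i1 : ∀ t : ℝ, f (t + y * I) / (1 - expTwoPi (t + y * I - x₀))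
      = φ (t + y * I) + f x₀ * (1 + expTwoPi ((y * I - x₀) + t) /
        (1 - expTwoPi ((y * I - x₀) + t))) := fun t => by
    have hne : 1 - expTwoPi (t + y * I - x₀) ≠ 0 := one_sub_expTwoPi_ne_zero (by simp; linarith)
    have h1 : φ (t + y * I) = (f (t + y * I) - f x₀) / (1 - expTwoPi (t + y * I - x₀)) := by
      rw [hφ, divExt, if_neg hne]
    rw [h1, show (y * I - x₀) + t = t + y * I - x₀ by ring]
    field_simp
    ring
  have i2 : ∀ t : ℝ, f (t - y * I) *
        (expTwoPi (-(t - y * I) + x₀) / (1 - expTwoPi (-(t - y * I) + x₀)))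
      = -φ (t + (-y : ℝ) * I) + f x₀ * (expTwoPi ((y * I + x₀) - t) /
        (1 - expTwoPi ((y * I + x₀) - t))) := fun t => by
    have hne : 1 - expTwoPi (-(t - y * I) + x₀) ≠ 0 :=
      one_sub_expTwoPi_ne_zero (by simp; linarith)
    have e1 : (t : ℂ) + (-y : ℝ) * I = t - y * I := by push_cast; ring
    have e2 : expTwoPi (t - y * I - x₀) = (expTwoPi (-(t - y * I) + x₀))⁻¹ := by
      rw [← expTwoPi_neg]
      congr 1
      ring
    have e0 := expTwoPi_ne_zero (-(t - y * I) + x₀)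
    have hne' : D (t - y * I) ≠ 0 := by
      simp only [hD]
      rw [e2]
      intro h
      apply hne
      field_simp at h
      linear_combination -h
    have h1 : φ (t - y * I) = (f (t - y * I) - f x₀) / D (t - y * I) := by
      rw [hφ, divExt, if_neg hne']
    have h2 : D (t - y * I) = -(1 - expTwoPi (-(t - y * I) + x₀))
        / expTwoPi (-(t - y * I) + x₀) := by
      simp only [hD]
      rw [e2]
      field_simp
      ring
    rw [e1, h1, h2, show (y * I + x₀) - t = -(t - y * I) + x₀ by ring]
    field_simp
    ring
  have c1 : IntervalIntegrable (fun t : ℝ => φ (t + y * I)) MeasureTheory.volume 0 1 :=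
    (continuous_comp_line hφd (by rwa [abs_of_pos hy0])).intervalIntegrable _ _
  have c2 : IntervalIntegrable (fun t : ℝ => φ (t + (-y : ℝ) * I)) MeasureTheory.volume 0 1 :=
    (continuous_comp_line hφd (by rwa [abs_neg, abs_of_pos hy0])).intervalIntegrable _ _
  have c3 : IntervalIntegrable (fun t : ℝ => expTwoPi ((y * I - x₀) + t) /
        (1 - expTwoPi ((y * I - x₀) + t))) MeasureTheory.volume 0 1 := by
    have : Continuous fun t : ℝ => expTwoPi ((y * I - x₀) + t) :=
      differentiable_expTwoPi.continuous.comp (by fun_prop)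
    exact (this.div (continuous_const.sub this) fun t =>
      one_sub_expTwoPi_ne_zero (by simp; linarith)).intervalIntegrable _ _
  have c4 : IntervalIntegrable (fun t : ℝ => expTwoPi ((y * I + x₀) - t) /
        (1 - expTwoPi ((y * I + x₀) - t))) MeasureTheory.volume 0 1 := by
    have : Continuous fun t : ℝ => expTwoPi ((y * I + x₀) - t) :=
      differentiable_expTwoPi.continuous.comp (by fun_prop)
    exact (this.div (continuous_const.sub this) fun t =>
      one_sub_expTwoPi_ne_zero (by simp; linarith)).intervalIntegrable _ _
  have c2' : IntervalIntegrable (fun t : ℝ => -φ (t + (-y : ℝ) * I)) MeasureTheory.volume 0 1 :=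
    c2.neg
  simp only [i1, i2]
  rw [intervalIntegral.integral_add c1
      ((intervalIntegrable_const.add c3).const_mul _),
    intervalIntegral.integral_add c2' (c4.const_mul _),
    intervalIntegral.integral_neg, intervalIntegral.integral_const_mul,
    intervalIntegral.integral_const_mul, intervalIntegral.integral_add
      intervalIntegrable_const c3,
    integral_expTwoPi_div_one_sub (by simp; linarith),
    integral_expTwoPi_sub_div_one_sub (by simp; linarith), hshift]
  simp

/-- Integrals over `[0, 1]` that depend holomorphically on a parameter. -/
theorem differentiableOn_intervalIntegral {U : Set ℂ} (hU : IsOpen U) {H : ℝ → ℂ → ℂ}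
    (hc : ContinuousOn (Function.uncurry H) (Set.Icc 0 1 ×ˢ U))
    (hd : ∀ t ∈ Set.Icc (0 : ℝ) 1, DifferentiableOn ℂ (H t) U) :
    DifferentiableOn ℂ (fun g => ∫ t in (0 : ℝ)..1, H t g) U := by
  intro g₀ hg₀
  obtain ⟨r, hr, hrU⟩ : ∃ r > 0, Metric.closedBall g₀ (2 * r) ⊆ U := by
    obtain ⟨ε, hε, h⟩ := Metric.nhds_basis_closedBall.mem_iff.mp (hU.mem_nhds hg₀)
    exact ⟨ε / 2, by positivity, by rwa [mul_div_cancel₀ _ (two_ne_zero)]⟩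
  have hsub : Metric.ball g₀ r ⊆ U :=
    (Metric.ball_subset_closedBall.trans (Metric.closedBall_subset_closedBall (by linarith))).trans
      hrU
  obtain ⟨M, hM⟩ := (isCompact_Icc.prod (isCompact_closedBall g₀ (2 * r))).exists_bound_of_continuousOn
    (hc.mono (Set.prod_mono le_rfl hrU))
  have hline : ∀ g ∈ U, ContinuousOn (fun t => H t g) (Set.Icc 0 1) := fun g hg =>
    hc.comp (f := fun t : ℝ => (t, g)) (by fun_prop) fun t ht => ⟨ht, hg⟩
  have hae : ∀ g ∈ U, MeasureTheory.AEStronglyMeasurable (fun t => H t g)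
      (MeasureTheory.volume.restrict (Set.uIoc (0 : ℝ) 1)) := fun g hg => by
    rw [Set.uIoc_of_le zero_le_one]
    exact ((hline g hg).mono Set.Ioc_subset_Icc_self).aestronglyMeasurable measurableSet_Ioc
  have hIcc : ∀ {t : ℝ}, t ∈ Set.uIoc (0 : ℝ) 1 → t ∈ Set.Icc (0 : ℝ) 1 := fun ht => by
    rw [Set.uIoc_of_le zero_le_one] at ht
    exact Set.Ioc_subset_Icc_self ht
  have hder : ∀ t ∈ Set.Icc (0 : ℝ) 1, ∀ g ∈ U, HasDerivAt (H t) (deriv (H t) g) g :=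
    fun t ht g hg => ((hd t ht).differentiableAt (hU.mem_nhds hg)).hasDerivAt
  refine (intervalIntegral.hasDerivAt_integral_of_dominated_loc_of_deriv_le
    (F := fun g t => H t g) (F' := fun g t => deriv (H t) g) (bound := fun _ => M / r)
    (Metric.ball_mem_nhds g₀ hr) ?_ ?_ ?_ ?_ intervalIntegrable_const ?_).2.differentiableAt
    |>.differentiableWithinAt
  · filter_upwards [hU.mem_nhds hg₀] with g hg using hae g hg
  · refine ContinuousOn.intervalIntegrable ?_
    rw [Set.uIcc_of_le zero_le_one]
    exact hline g₀ hg₀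
  -- The derivative is measurable in t as the limit of difference quotients along this sequence.
  · have hseq : Tendsto (fun k : ℕ => g₀ + ((r / 2 / (k + 1) : ℝ) : ℂ)) atTop (𝓝[≠] g₀) := by
      refine tendsto_nhdsWithin_iff.mpr ⟨?_, Eventually.of_forall fun k => ?_⟩
      · have h1 : Tendsto (fun k : ℕ => r / 2 / ((k : ℝ) + 1)) atTop (𝓝 0) :=
          tendsto_const_div_atTop_nhds_zero_nat (r / 2) |>.comp (tendsto_add_atTop_nat 1) |>.congr
            fun k => by simp
        have h2 := ((Complex.continuous_ofReal.tendsto 0).comp h1).const_add g₀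
        simpa using h2
      · rw [Set.mem_compl_iff, Set.mem_singleton_iff, add_eq_left, Complex.ofReal_eq_zero]
        positivity
    refine aestronglyMeasurable_of_tendsto_ae atTop
      (f := fun (k : ℕ) t => slope (H t) g₀ (g₀ + ((r / 2 / (k + 1) : ℝ) : ℂ))) (fun k => ?_) ?_
    · simp only [slope, vsub_eq_sub]
      refine ((hae _ (hrU ?_)).sub (hae _ hg₀)).const_smul
        (g₀ + ((r / 2 / (k + 1) : ℝ) : ℂ) - g₀)⁻¹
      rw [Metric.mem_closedBall, dist_self_add_left, Complex.norm_real, Real.norm_of_nonneg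
        (by positivity)]
      have : r / 2 / ((k : ℝ) + 1) ≤ r / 2 := div_le_self (by positivity) (by simp)
      linarith
    · refine (MeasureTheory.ae_restrict_iff' measurableSet_uIoc).mpr
        (Eventually.of_forall fun t ht => ?_)
      exact (hasDerivAt_iff_tendsto_slope.mp (hder t (hIcc ht) g₀ hg₀)).comp hseq
  -- Cauchy's estimate on a circle of radius r about g, which stays in the ball of radius 2r where H
  -- is bounded by M.
  · refine Eventually.of_forall fun t ht g hg => ?_
    have hsub' : Metric.closedBall g r ⊆ Metric.closedBall g₀ (2 * r) :=
      Metric.closedBall_subset_closedBall' (by rw [Metric.mem_ball] at hg; linarith)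
    refine Complex.norm_deriv_le_of_forall_mem_sphere_norm_le hr
      (((hd t (hIcc ht)).mono (hsub'.trans hrU)).diffContOnCl_ball Set.Subset.rfl) fun w hw => ?_
    exact hM (t, w) ⟨hIcc ht, hsub' (Metric.sphere_subset_closedBall hw)⟩
  · exact Eventually.of_forall fun t ht g hg => hder t (hIcc ht) g (hsub hg)

/-! ## Partial fractions -/

/-- The Lagrange basis polynomials at the nodes 1/a_i add up to 1; this identity is divided by the
product. -/
theorem prod_one_sub_inv_eq_sum {ι : Type*} [DecidableEq ι] {s : Finset ι} (hs : s.Nonempty)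
    {a : ι → ℂ} {Y : ℂ} (ha : ∀ i ∈ s, a i ≠ 0) (hinj : Set.InjOn a s)
    (hY : ∀ i ∈ s, 1 - a i * Y ≠ 0) :
    (∏ i ∈ s, (1 - a i * Y))⁻¹
      = ∑ i ∈ s, (∏ j ∈ s.erase i, (1 - a j / a i))⁻¹ * (1 - a i * Y)⁻¹ := by
  have h := congrArg (Polynomial.eval Y) (Lagrange.sum_basis (v := fun i => (a i)⁻¹)
    (fun i hi j hj hij => hinj hi hj (inv_injective hij)) hs)
  rw [Polynomial.eval_finsetSum, Polynomial.eval_one] at h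
  have hP : ∏ i ∈ s, (1 - a i * Y) ≠ 0 := Finset.prod_ne_zero_iff.mpr hY
  refine Eq.trans (b := (∑ i ∈ s, Polynomial.eval Y (Lagrange.basis s (fun i => (a i)⁻¹) i))
    * (∏ i ∈ s, (1 - a i * Y))⁻¹) (by rw [h, one_mul]) ?_
  rw [Finset.sum_mul]
  refine Finset.sum_congr rfl fun i hi => ?_
  have hQ : ∏ j ∈ s.erase i, (1 - a j * Y) ≠ 0 :=
    Finset.prod_ne_zero_iff.mpr fun j hj => hY j (Finset.mem_of_mem_erase hj)
  have hb : Polynomial.eval Y (Lagrange.basis s (fun i => (a i)⁻¹) i)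
      = (∏ j ∈ s.erase i, (1 - a j * Y)) * (∏ j ∈ s.erase i, (1 - a j / a i))⁻¹ := by
    rw [Lagrange.basis, Polynomial.eval_prod, ← Finset.prod_inv_distrib, ← Finset.prod_mul_distrib]
    refine Finset.prod_congr rfl fun j hj => ?_
    have hi0 := ha i hi
    have hj0 := ha j (Finset.mem_of_mem_erase hj)
    simp only [Lagrange.basisDivisor, Polynomial.eval_mul, Polynomial.eval_C, Polynomial.eval_sub,
      Polynomial.eval_X]
    have e1 : (a i)⁻¹ - (a j)⁻¹ = -(a j)⁻¹ * (1 - a j / a i) := by field_simp; ring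
    have e2 : Y - (a j)⁻¹ = -(a j)⁻¹ * (1 - a j * Y) := by field_simp; ring
    rw [e1, e2, mul_inv]
    have : -(a j)⁻¹ ≠ 0 := neg_ne_zero.mpr (inv_ne_zero hj0)
    field_simp
  rw [hb, ← Finset.mul_prod_erase s _ hi, mul_inv]
  linear_combination ((1 - a i * Y)⁻¹ * (∏ j ∈ s.erase i, (1 - a j / a i))⁻¹)
    * mul_inv_cancel₀ hQ

/-- It separates the poles below the contour (in A) from those above it (in B): in the application
AB does not depend on the variable of integration. -/
theorem inv_mul_inv_eq {A B : ℂ} (hA : 1 - A ≠ 0) (hB : 1 - B ≠ 0) (hAB : 1 - A * B ≠ 0) :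
    (1 - A)⁻¹ * (1 - B)⁻¹ = (1 - A * B)⁻¹ * ((1 - A)⁻¹ + B / (1 - B)) := by
  field_simp
  ring


/-! ## Continuation of contour integrals -/

theorem expTwoPi_sub (u v : ℂ) : expTwoPi (u - v) = expTwoPi u / expTwoPi v := by
  rw [sub_eq_add_neg, expTwoPi_add, expTwoPi_neg, div_eq_mul_inv]

/-- `∫ R(x,g)/(1 - e(x - g + b)) dx` over the unit segment of `Im x = y`. -/
noncomputable def contourUp (R : ℂ → ℂ → ℂ) (y : ℝ) (b g : ℂ) : ℂ :=
  ∫ t in (0 : ℝ)..1, R (t + y * I) g / (1 - expTwoPi (t + y * I - g + b))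

/-- `∫ R(x,g) e(-x - g + b)/(1 - e(-x - g + b)) dx` over the unit segment of `Im x = -y`. -/
noncomputable def contourDown (R : ℂ → ℂ → ℂ) (y : ℝ) (b g : ℂ) : ℂ :=
  ∫ t in (0 : ℝ)..1, R (t - y * I) g *
    (expTwoPi (-(t - y * I) - g + b) / (1 - expTwoPi (-(t - y * I) - g + b)))

section Contour

variable {R : ℂ → ℂ → ℂ} {Y y c : ℝ} {b g : ℂ}

theorem isOpen_im_lt (c : ℝ) : IsOpen {g : ℂ | g.im < c} :=
  isOpen_lt Complex.continuous_im continuous_const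

theorem differentiableOn_line
    (hR : DifferentiableOn ℂ (Function.uncurry R) ({x | |x.im| < Y} ×ˢ {g | g.im < c}))
    {x : ℂ} (hx : |x.im| < Y) : DifferentiableOn ℂ (R x) {g | g.im < c} :=
  hR.comp (f := fun g => (x, g)) (by fun_prop) fun _ hg => ⟨hx, hg⟩

theorem differentiableOn_strip
    (hR : DifferentiableOn ℂ (Function.uncurry R) ({x | |x.im| < Y} ×ˢ {g | g.im < c}))
    (hg : g.im < c) : DifferentiableOn ℂ (fun x => R x g) {x | |x.im| < Y} :=
  hR.comp (f := fun x => (x, g)) (by fun_prop) fun _ hx => ⟨hx, hg⟩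

/-- For Im g < c the poles g - b stay below the line Im x = y, so none crosses it. -/
theorem differentiableOn_contourUp
    (hR : DifferentiableOn ℂ (Function.uncurry R) ({x | |x.im| < Y} ×ˢ {g | g.im < c}))
    (hy0 : 0 < y) (hy : y < Y) (hb : c - b.im < y) :
    DifferentiableOn ℂ (contourUp R y b) {g | g.im < c} := by
  have him : ∀ (t : ℝ) (g : ℂ), g.im < c → 1 - expTwoPi (t + y * I - g + b) ≠ 0 := fun t g hg =>
    one_sub_expTwoPi_ne_zero (by simp; linarith)
  have hYt : ∀ t : ℝ, |((t : ℂ) + y * I).im| < Y := fun t => by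
    simpa [abs_of_pos hy0] using hy
  refine differentiableOn_intervalIntegral (isOpen_im_lt c) ?_ fun t _ => ?_
  · refine ContinuousOn.div ?_ ?_ fun p hp => him p.1 p.2 hp.2
    · exact hR.continuousOn.comp (f := fun p : ℝ × ℂ => ((p.1 : ℂ) + y * I, p.2)) (by fun_prop)
        fun p hp => ⟨hYt p.1, hp.2⟩
    · exact (continuous_const.sub (differentiable_expTwoPi.continuous.comp
        (g := expTwoPi) (f := fun p : ℝ × ℂ => (p.1 : ℂ) + y * I - p.2 + b)
        (by fun_prop))).continuousOn
  · refine (differentiableOn_line hR (hYt t)).div ?_ fun g hg => him t g hg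
    exact ((differentiable_expTwoPi.comp
      (by fun_prop : Differentiable ℂ fun g => (t : ℂ) + y * I - g + b)).const_sub 1).differentiableOn

theorem differentiableOn_contourDown
    (hR : DifferentiableOn ℂ (Function.uncurry R) ({x | |x.im| < Y} ×ˢ {g | g.im < c}))
    (hy0 : 0 < y) (hy : y < Y) (hb : c - b.im < y) :
    DifferentiableOn ℂ (contourDown R y b) {g | g.im < c} := by
  have him : ∀ (t : ℝ) (g : ℂ), g.im < c → 1 - expTwoPi (-(t - y * I) - g + b) ≠ 0 :=
    fun t g hg => one_sub_expTwoPi_ne_zero (by simp; linarith)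
  have hYt : ∀ t : ℝ, |((t : ℂ) - y * I).im| < Y := fun t => by
    simpa [abs_of_pos hy0] using hy
  have hc : Continuous fun p : ℝ × ℂ => expTwoPi (-((p.1 : ℂ) - y * I) - p.2 + b) :=
    differentiable_expTwoPi.continuous.comp (by fun_prop)
  have hd : ∀ t : ℝ, Differentiable ℂ fun g => expTwoPi (-((t : ℂ) - y * I) - g + b) := fun t =>
    differentiable_expTwoPi.comp (by fun_prop)
  refine differentiableOn_intervalIntegral (isOpen_im_lt c) ?_ fun t _ => ?_
  · refine ContinuousOn.mul ?_ (hc.continuousOn.div (continuous_const.sub hc).continuousOn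
      fun p hp => him p.1 p.2 hp.2)
    exact hR.continuousOn.comp (f := fun p : ℝ × ℂ => ((p.1 : ℂ) - y * I, p.2)) (by fun_prop)
        fun p hp => ⟨hYt p.1, hp.2⟩
  · exact (differentiableOn_line hR (hYt t)).mul ((hd t).differentiableOn.div
      ((hd t).const_sub 1).differentiableOn fun g hg => him t g hg)

/-- While Im g < Im b the pole x = g - b is below the real axis, and the contour can be moved up
freely. -/
theorem integral_div_eq_contourUp
    (hR : DifferentiableOn ℂ (Function.uncurry R) ({x | |x.im| < Y} ×ˢ {g | g.im < c}))
    (hper : ∀ x g, R (x + 1) g = R x g) (hy0 : 0 < y) (hy : y < Y) (hg : g.im < c)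
    (hb : 0 < (b - g).im) :
    ∫ t in (0 : ℝ)..1, R t g / (1 - expTwoPi (t - g + b)) = contourUp R y b g := by
  rw [sub_im] at hb
  have h := integral_add_mul_I_eq (f := fun x => R x g / (1 - expTwoPi (x - g + b)))
    (fun x => by
      rw [hper, show x + 1 - g + b = x - g + b + 1 by ring, expTwoPi_add_one])
    (y₁ := 0) (y₂ := y) fun x hx => by
      rw [Set.uIcc_of_le hy0.le] at hx
      have hx' : x ∈ {x : ℂ | |x.im| < Y} := by
        rw [Set.mem_ofPred_eq, abs_of_nonneg hx.1]
        exact hx.2.trans_lt hy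
      refine DifferentiableAt.div ((differentiableOn_strip hR hg).differentiableAt
        ((isOpen_strip Y).mem_nhds hx')) ?_ (one_sub_expTwoPi_ne_zero ?_)
      · exact ((differentiable_expTwoPi.comp
          (by fun_prop : Differentiable ℂ fun x => x - g + b)).const_sub 1) x
      · rw [add_im, sub_im]
        linarith [hx.1]
  simp only [ofReal_zero, zero_mul, add_zero] at h
  exact h

theorem integral_mul_eq_contourDown
    (hR : DifferentiableOn ℂ (Function.uncurry R) ({x | |x.im| < Y} ×ˢ {g | g.im < c}))
    (hper : ∀ x g, R (x + 1) g = R x g) (hy0 : 0 < y) (hy : y < Y) (hg : g.im < c)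
    (hb : 0 < (b - g).im) :
    ∫ t in (0 : ℝ)..1, R t g * (expTwoPi (-t - g + b) / (1 - expTwoPi (-t - g + b)))
      = contourDown R y b g := by
  rw [sub_im] at hb
  have hd : Differentiable ℂ fun x => expTwoPi (-x - g + b) :=
    differentiable_expTwoPi.comp (by fun_prop)
  have h := integral_add_mul_I_eq
    (f := fun x => R x g * (expTwoPi (-x - g + b) / (1 - expTwoPi (-x - g + b))))
    (fun x => by
      rw [hper, ← expTwoPi_add_one (-(x + 1) - g + b),
        show -(x + 1) - g + b + 1 = -x - g + b by ring])
    (y₁ := 0) (y₂ := -y) fun x hx => by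
      rw [Set.uIcc_of_ge (by linarith)] at hx
      have hx' : x ∈ {x : ℂ | |x.im| < Y} := by
        rw [Set.mem_ofPred_eq, abs_of_nonpos hx.2]
        linarith [hx.1]
      refine DifferentiableAt.mul ((differentiableOn_strip hR hg).differentiableAt
        ((isOpen_strip Y).mem_nhds hx')) ((hd x).div ((hd.const_sub 1) x)
          (one_sub_expTwoPi_ne_zero ?_))
      rw [add_im, sub_im, neg_im]
      linarith [hx.2]
  simp only [ofReal_zero, zero_mul, add_zero, ofReal_neg, neg_mul, ← sub_eq_add_neg] at h
  exact h

/-- When b + b' = 2g the poles g - b and b' - g coincide, and the two integrals form the boundary of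
a strip around them. -/
theorem contourUp_add_contourDown
    (hR : DifferentiableOn ℂ (Function.uncurry R) ({x | |x.im| < Y} ×ˢ {g | g.im < c}))
    (hper : ∀ x g, R (x + 1) g = R x g) (hy : y < Y) (hg : g.im < c) {b' : ℂ}
    (hb : c - b.im < y) (hb' : c - b'.im < y) (hbb : b + b' = 2 * g) :
    contourUp R y b g + contourDown R y b' g = R (g - b) g := by
  have him := congrArg Complex.im hbb
  simp only [add_im, mul_im, re_ofNat, im_ofNat, zero_mul, add_zero] at him
  rw [← integral_add_integral_eq (x₀ := g - b) (fun x => hper x g) (differentiableOn_strip hR hg)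
    hy (by rw [sub_im, abs_lt]; constructor <;> linarith)]
  rw [contourUp, contourDown]
  have e1 : ∀ t : ℝ, (t : ℂ) + y * I - g + b = t + y * I - (g - b) := fun t => by ring
  have e2 : ∀ t : ℝ, -((t : ℂ) - y * I) - g + b' = -(t - y * I) + (g - b) := fun t => by
    linear_combination hbb
  simp only [e1, e2]

/-- The coefficients of the partial fraction decomposition of `∏_i 1/(1 - e(u + b_i))`. -/
noncomputable def residueCoeff {ι : Type*} [DecidableEq ι] (s : Finset ι) (b : ι → ℂ) (i : ι) : ℂ :=
  (∏ j ∈ s.erase i, (1 - expTwoPi (b j - b i)))⁻¹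

/-- Partial fractions are taken separately in e(x-g) and e(-x-g); `inv_mul_inv_eq` then splits each
product into two terms whose contours are moved in opposite directions. On the right only the
explicit fractions can have poles for Im g < c. -/
theorem integral_mul_prod_inv_eq {ι : Type*} [DecidableEq ι] {s : Finset ι} (hs : s.Nonempty)
    {b : ι → ℂ} (hinj : Set.InjOn (fun i => expTwoPi (b i)) s)
    (hR : DifferentiableOn ℂ (Function.uncurry R) ({x | |x.im| < Y} ×ˢ {g | g.im < c}))
    (hper : ∀ x g, R (x + 1) g = R x g) (hy0 : 0 < y) (hy : y < Y) (hg : g.im < c)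
    (hb : ∀ i ∈ s, 0 < (b i - g).im) :
    ∫ t in (0 : ℝ)..1, R t g * ((∏ i ∈ s, (1 - expTwoPi (t - g + b i)))⁻¹
        * (∏ i ∈ s, (1 - expTwoPi (-t - g + b i)))⁻¹)
      = ∑ i ∈ s, ∑ j ∈ s, residueCoeff s b i * residueCoeff s b j *
        ((1 - expTwoPi (b i + b j - 2 * g))⁻¹ * (contourUp R y (b i) g + contourDown R y (b j) g)) := by
  have him : ∀ i ∈ s, 0 < (b i).im - g.im := fun i hi => by
    have := hb i hi
    rwa [sub_im] at this
  have hA : ∀ i ∈ s, ∀ t : ℝ, 1 - expTwoPi (t - g + b i) ≠ 0 := fun i hi t =>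
    one_sub_expTwoPi_ne_zero (by simp; linarith [him i hi])
  have hB : ∀ i ∈ s, ∀ t : ℝ, 1 - expTwoPi (-t - g + b i) ≠ 0 := fun i hi t =>
    one_sub_expTwoPi_ne_zero (by simp; linarith [him i hi])
  have hpf : ∀ u : ℂ, (∀ i ∈ s, 1 - expTwoPi (u + b i) ≠ 0) →
      (∏ i ∈ s, (1 - expTwoPi (u + b i)))⁻¹
        = ∑ i ∈ s, residueCoeff s b i * (1 - expTwoPi (u + b i))⁻¹ := fun u hu => by
    have e : ∀ i, expTwoPi (u + b i) = expTwoPi (b i) * expTwoPi u := fun i => by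
      rw [add_comm, expTwoPi_add]
    simp only [e] at hu ⊢
    rw [prod_one_sub_inv_eq_sum hs (fun i _ => expTwoPi_ne_zero (b i)) hinj hu]
    simp only [residueCoeff, expTwoPi_sub]
  have hterm : ∀ t : ℝ, R t g * ((∏ i ∈ s, (1 - expTwoPi (t - g + b i)))⁻¹
        * (∏ i ∈ s, (1 - expTwoPi (-t - g + b i)))⁻¹)
      = ∑ i ∈ s, ∑ j ∈ s, residueCoeff s b i * residueCoeff s b j *
        ((1 - expTwoPi (b i + b j - 2 * g))⁻¹ * (R t g / (1 - expTwoPi (t - g + b i))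
          + R t g * (expTwoPi (-t - g + b j) / (1 - expTwoPi (-t - g + b j))))) := fun t => by
    rw [hpf _ fun i hi => hA i hi t, hpf _ fun i hi => hB i hi t, Finset.sum_mul_sum,
      Finset.mul_sum]
    refine Finset.sum_congr rfl fun i hi => ?_
    rw [Finset.mul_sum]
    refine Finset.sum_congr rfl fun j hj => ?_
    have e : expTwoPi (t - g + b i) * expTwoPi (-t - g + b j) = expTwoPi (b i + b j - 2 * g) := by
      rw [← expTwoPi_add]
      congr 1
      ring
    have h := inv_mul_inv_eq (hA i hi t) (hB j hj t) (by
      rw [e]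
      refine one_sub_expTwoPi_ne_zero ?_
      simp only [sub_im, add_im, mul_im, re_ofNat, im_ofNat, zero_mul, add_zero]
      linarith [him i hi, him j hj])
    rw [e] at h
    rw [mul_mul_mul_comm, h]
    ring
  have hRc : Continuous fun t : ℝ => R t g :=
    (differentiableOn_strip hR hg).continuousOn.comp_continuous (by fun_prop) fun t => by
      simpa using hy0.trans hy
  have hAc : ∀ i ∈ s, IntervalIntegrable (fun t : ℝ => R t g / (1 - expTwoPi (t - g + b i)))
      MeasureTheory.volume 0 1 := fun i hi => by
    have : Continuous fun t : ℝ => expTwoPi (t - g + b i) :=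
      differentiable_expTwoPi.continuous.comp (by fun_prop)
    exact (hRc.div (continuous_const.sub this) (hA i hi)).intervalIntegrable _ _
  have hBc : ∀ i ∈ s, IntervalIntegrable (fun t : ℝ => R t g *
      (expTwoPi (-t - g + b i) / (1 - expTwoPi (-t - g + b i)))) MeasureTheory.volume 0 1 :=
    fun i hi => by
      have : Continuous fun t : ℝ => expTwoPi (-t - g + b i) :=
        differentiable_expTwoPi.continuous.comp (by fun_prop)
      exact (hRc.mul (this.div (continuous_const.sub this) (hB i hi))).intervalIntegrable _ _
  simp only [hterm, ← Finset.sum_product']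
  rw [intervalIntegral.integral_finsetSum fun p hp => (((hAc p.1 (Finset.mem_product.mp hp).1).add
    (hBc p.2 (Finset.mem_product.mp hp).2)).const_mul _).const_mul _]
  refine Finset.sum_congr rfl fun p hp => ?_
  obtain ⟨i, j⟩ := p
  obtain ⟨hi, hj⟩ := Finset.mem_product.mp hp
  rw [intervalIntegral.integral_const_mul, intervalIntegral.integral_const_mul,
    intervalIntegral.integral_add (hAc i hi) (hBc j hj),
    integral_div_eq_contourUp hR hper hy0 hy hg (hb i hi),
    integral_mul_eq_contourDown hR hper hy0 hy hg (hb j hj)]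

end Contour


/-! ## Continuation of the integral operator -/

/-- One functional equation in each period turns the denominator of one gamma function into the
numerator of the other. The single products left over form one theta function of each modulus. -/
theorem inv_ellGamma_mul_ellGamma_neg {η τ : ℂ} (hη : 0 < (2 * η).im) (hτ : 0 < τ.im) {u : ℂ}
    (h1 : dPoch τ (2 * η) ∅ (τ + 2 * η + u) ≠ 0) (h2 : dPoch τ (2 * η) ∅ (τ + 2 * η - u) ≠ 0) :
    (ellGamma η τ u * ellGamma η τ (-u))⁻¹
      = -(thetaR τ * thetaR (2 * η) * theta1 u τ * theta1 u (2 * η)) := by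
  have e1 : dPoch τ (2 * η) ∅ u = qPoch (expTwoPi u) (2 * η) * qPoch (expTwoPi (u + τ)) τ
      * dPoch τ (2 * η) ∅ (τ + 2 * η + u) := by
    rw [dPoch_add_fst hτ hη, dPoch_add_snd hτ hη, mul_assoc,
      show u + τ + 2 * η = τ + 2 * η + u by ring]
  have e2 : dPoch τ (2 * η) ∅ (-u) = qPoch (expTwoPi (-u)) τ * qPoch (expTwoPi (-u + 2 * η)) (2 * η)
      * dPoch τ (2 * η) ∅ (τ + 2 * η - u) := by
    rw [dPoch_add_snd hτ hη, dPoch_add_fst hτ hη, mul_assoc,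
      show -u + 2 * η + τ = τ + 2 * η - u by ring]
  have e3 : qPoch (expTwoPi u) (2 * η) * qPoch (expTwoPi (-u + 2 * η)) (2 * η)
      = thetaR (2 * η) * cexp (π * I * u) * theta1 u (2 * η) := by
    rw [← thetaM_exp u hη, thetaM, nomePow_eq_expTwoPi, mul_one, ← expTwoPi, ← expTwoPi_neg,
      ← expTwoPi_add, add_comm (2 * η)]
  have e4 : qPoch (expTwoPi (-u)) τ * qPoch (expTwoPi (u + τ)) τ
      = -(thetaR τ * (cexp (π * I * u))⁻¹ * theta1 u τ) := by
    have := thetaM_exp (-u) hτ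
    rw [thetaM, nomePow_eq_expTwoPi, mul_one, ← expTwoPi, ← expTwoPi_neg, neg_neg,
      ← expTwoPi_add, add_comm τ, theta1_neg, mul_neg, mul_neg,
      Complex.exp_neg] at this
    rw [this]
  have hE := Complex.exp_ne_zero (π * I * u)
  rw [ellGamma_eq hη hτ, ellGamma_eq hη hτ, sub_neg_eq_add, mul_inv, inv_div, inv_div, e1, e2,
    mul_div_assoc, mul_div_assoc]
  have : thetaR τ * thetaR (2 * η) * theta1 u τ * theta1 u (2 * η)
      = -((qPoch (expTwoPi u) (2 * η) * qPoch (expTwoPi (-u + 2 * η)) (2 * η))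
        * (qPoch (expTwoPi (-u)) τ * qPoch (expTwoPi (u + τ)) τ)) := by
    rw [e3, e4]
    field_simp
  rw [this]
  field_simp

/-- The location, relative to `g`, of the poles in `-x` of the product of gamma functions. -/
noncomputable def poleShift (η τ z : ℂ) (i : Bool × ℕ × ℕ) : ℂ :=
  cond i.1 z (-z) + (i.2.1 * τ + i.2.2 * (2 * η))

/-- The integrand of the integral operator without the factors `1/(1 - e(±x - g + b))` that belong
to the poles `b = ±z + lτ + 2kη` with `(l, k) ∈ S`. -/
noncomputable def regularKernel (η τ : ℂ) (S : Finset (ℕ × ℕ)) (z : ℂ) (Φ : ℂ → ℂ) (x g : ℂ) : ℂ :=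
  (dPoch τ (2 * η) ∅ (τ + 2 * η - (z + x - g)) * dPoch τ (2 * η) ∅ (τ + 2 * η - (z - x - g))
      * dPoch τ (2 * η) ∅ (τ + 2 * η - (-z + x - g))
      * dPoch τ (2 * η) ∅ (τ + 2 * η - (-z - x - g)))
    / (dPoch τ (2 * η) S (z + x - g) * dPoch τ (2 * η) S (z - x - g)
      * dPoch τ (2 * η) S (-z + x - g) * dPoch τ (2 * η) S (-z - x - g))
    * (-(thetaR τ * thetaR (2 * η) * theta1 (2 * x) τ * theta1 (2 * x) (2 * η)) * Φ x)

/-- The coefficient `D(-2g)/(1 - e(b_i + b_j - 2g))`, where `D(u) = ∏(1 - e(u + lτ + 2kη))`. -/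
noncomputable def pairCoeff (η τ z : ℂ) (i j : Bool × ℕ × ℕ) (g : ℂ) : ℂ :=
  if i.1 = j.1 then
    dPoch τ (2 * η) ∅ (-2 * g) / (1 - expTwoPi (poleShift η τ z i + poleShift η τ z j - 2 * g))
  else dPoch τ (2 * η) {(i.2.1 + j.2.1, i.2.2 + j.2.2)} (-2 * g)

section Continuation

variable {η τ : ℂ}

theorem poleShift_add_of_ne (z : ℂ) {i j : Bool × ℕ × ℕ} (h : i.1 ≠ j.1) :
    poleShift η τ z i + poleShift η τ z j
      = (i.2.1 + j.2.1 : ℕ) * τ + (i.2.2 + j.2.2 : ℕ) * (2 * η) := by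
  obtain ⟨a, x⟩ := i
  obtain ⟨b, y⟩ := j
  cases a <;> cases b <;> simp_all [poleShift] <;> ring

/-- For opposite signs z drops out of b_i+b_j, so the denominator is itself a factor of the double
product D(-2g) and cancels identically. -/
theorem pairCoeff_eq (hη : 0 < (2 * η).im) (hτ : 0 < τ.im) (z : ℂ) (i j : Bool × ℕ × ℕ) {g : ℂ}
    (h : 1 - expTwoPi (poleShift η τ z i + poleShift η τ z j - 2 * g) ≠ 0) :
    pairCoeff η τ z i j g = dPoch τ (2 * η) ∅ (-2 * g)
      * (1 - expTwoPi (poleShift η τ z i + poleShift η τ z j - 2 * g))⁻¹ := by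
  rw [pairCoeff]
  split_ifs with hij
  · rw [div_eq_mul_inv]
  · rw [dPoch_eq_prod_mul hτ hη {(i.2.1 + j.2.1, i.2.2 + j.2.2)} (-2 * g), Finset.prod_singleton]
    have e : -2 * g + (((i.2.1 + j.2.1, i.2.2 + j.2.2) : ℕ × ℕ).1 * τ
        + ((i.2.1 + j.2.1, i.2.2 + j.2.2) : ℕ × ℕ).2 * (2 * η))
        = poleShift η τ z i + poleShift η τ z j - 2 * g := by
      rw [poleShift_add_of_ne z hij]
      ring
    rw [e, mul_right_comm, mul_inv_cancel₀ h, one_mul]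

theorem prod_poleShift (S : Finset (ℕ × ℕ)) (z u : ℂ) :
    ∏ i ∈ Finset.univ ×ˢ S, (1 - expTwoPi (u + poleShift η τ z i))
      = (∏ x ∈ S, (1 - expTwoPi (z + u + (x.1 * τ + x.2 * (2 * η)))))
        * ∏ x ∈ S, (1 - expTwoPi (-z + u + (x.1 * τ + x.2 * (2 * η)))) := by
  rw [Finset.prod_product, Fintype.prod_bool]
  simp only [poleShift, cond_true, cond_false]
  congr 1 <;> refine Finset.prod_congr rfl fun x _ => ?_ <;> congr 2 <;> ring

theorem intertwinerIntegrand_eq (hη : 0 < (2 * η).im) (hτ : 0 < τ.im) (S : Finset (ℕ × ℕ))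
    (z : ℂ) (Φ : ℂ → ℂ) (t : ℝ) (g : ℂ) :
    ellGamma η τ (z + t - g) * ellGamma η τ (z - t - g) * ellGamma η τ (-z + t - g)
        * ellGamma η τ (-z - t - g)
      / (ellGamma η τ (-2 * g) * ellGamma η τ (2 * t) * ellGamma η τ (-2 * t)) * Φ t
    = dPoch τ (2 * η) ∅ (-2 * g) * (dPoch τ (2 * η) ∅ (τ + 2 * η + 2 * g))⁻¹
      * (regularKernel η τ S z Φ t g
        * ((∏ i ∈ Finset.univ ×ˢ S, (1 - expTwoPi (t - g + poleShift η τ z i)))⁻¹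
          * (∏ i ∈ Finset.univ ×ˢ S, (1 - expTwoPi (-t - g + poleShift η τ z i)))⁻¹)) := by
  have hσ : 0 < τ.im + (2 * η).im := add_pos hτ hη
  have hw := inv_ellGamma_mul_ellGamma_neg (u := 2 * t) hη hτ
    (dPoch_ne_zero_of_im_pos hτ hη ∅ (by simpa using hσ))
    (dPoch_ne_zero_of_im_pos hτ hη ∅ (by simpa using hσ))
  have e1 := fun a => dPoch_eq_prod_mul hτ hη S (z + a)
  have e2 := fun a => dPoch_eq_prod_mul hτ hη S (-z + a)
  rw [prod_poleShift, prod_poleShift, regularKernel, ← hw, ellGamma_eq hη hτ (z + t - g),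
    ellGamma_eq hη hτ (z - t - g), ellGamma_eq hη hτ (-z + t - g), ellGamma_eq hη hτ (-z - t - g),
    ellGamma_eq hη hτ (-2 * g), show τ + 2 * η - -2 * g = τ + 2 * η + 2 * g by ring,
    show dPoch τ (2 * η) ∅ (z + t - g) = _ by rw [add_sub_assoc, e1],
    show dPoch τ (2 * η) ∅ (z - t - g) = _ by
      rw [show z - t - g = z + (-t - g) by ring, e1],
    show dPoch τ (2 * η) ∅ (-z + t - g) = _ by rw [add_sub_assoc, e2],
    show dPoch τ (2 * η) ∅ (-z - t - g) = _ by
      rw [show -z - t - g = -z + (-t - g) by ring, e2]]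
  rw [show z + t - g = z + (t - g) by ring, show z - t - g = z + (-t - g) by ring,
    show -z + t - g = -z + (t - g) by ring, show -z - t - g = -z + (-t - g) by ring,
    show -2 * (t : ℂ) = -(2 * t) by ring]
  simp only [div_eq_mul_inv, mul_inv, inv_inv]
  ring

/-- Outside the square one of the indices is at least N, which moves the argument into the upper
half-plane. -/
theorem dPoch_ne_zero_of_compl (hη : 0 < (2 * η).im) (hτ : 0 < τ.im) {N : ℕ} {u : ℂ}
    (h1 : 0 < u.im + N * τ.im) (h2 : 0 < u.im + N * (2 * η).im) :
    dPoch τ (2 * η) (Finset.range N ×ˢ Finset.range N) u ≠ 0 := by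
  refine dPoch_ne_zero hτ hη fun i j hij => expTwoPi_ne_one ?_
  have e : (u + (i * τ + j * (2 * η))).im = u.im + (i * τ.im + j * (2 * η).im) := by
    rw [add_im, add_im, ← Complex.ofReal_natCast, ← Complex.ofReal_natCast, Complex.im_ofReal_mul,
      Complex.im_ofReal_mul]
  rw [e]
  rw [Finset.mem_product, Finset.mem_range, Finset.mem_range, not_and_or, not_lt, not_lt] at hij
  have p1 : 0 ≤ (i : ℝ) * τ.im := by positivity
  have p2 : 0 ≤ (j : ℝ) * (2 * η).im := by positivity
  rcases hij with h | h
  · have : (N : ℝ) * τ.im ≤ i * τ.im := by gcongr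
    linarith
  · have : (N : ℝ) * (2 * η).im ≤ j * (2 * η).im := by gcongr
    linarith

theorem differentiableOn_regularKernel (hη : 0 < (2 * η).im) (hτ : 0 < τ.im) {N : ℕ} {z : ℂ}
    {Φ : ℂ → ℂ} (hΦ : Differentiable ℂ Φ) {Y c : ℝ} (h1 : |z.im| + Y + c < N * τ.im)
    (h2 : |z.im| + Y + c < N * (2 * η).im) :
    DifferentiableOn ℂ
      (Function.uncurry (regularKernel η τ (Finset.range N ×ˢ Finset.range N) z Φ))
      ({x | |x.im| < Y} ×ˢ {g | g.im < c}) := by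
  have hD := fun S => differentiable_dPoch hτ hη S
  have hz1 := neg_abs_le z.im
  have hz2 := le_abs_self z.im
  have hθ1 := differentiable_theta1 hτ
  have hθ2 := differentiable_theta1 hη
  have hne : ∀ u : ℂ, -(|z.im| + Y + c) < u.im →
      dPoch τ (2 * η) (Finset.range N ×ˢ Finset.range N) u ≠ 0 := fun u hu =>
    dPoch_ne_zero_of_compl hη hτ (by linarith) (by linarith)
  unfold regularKernel
  simp only [div_eq_mul_inv]
  refine DifferentiableOn.mul (DifferentiableOn.mul ?_ (DifferentiableOn.inv ?_ ?_)) ?_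
  · refine Differentiable.differentiableOn ?_
    exact (((hD ∅).comp (f := fun p : ℂ × ℂ => τ + 2 * η - (z + p.1 - p.2)) (by fun_prop)).mul
      ((hD ∅).comp (f := fun p : ℂ × ℂ => τ + 2 * η - (z - p.1 - p.2)) (by fun_prop))).mul
      ((hD ∅).comp (f := fun p : ℂ × ℂ => τ + 2 * η - (-z + p.1 - p.2)) (by fun_prop)) |>.mul
      ((hD ∅).comp (f := fun p : ℂ × ℂ => τ + 2 * η - (-z - p.1 - p.2)) (by fun_prop))
  · refine Differentiable.differentiableOn ?_
    exact (((hD _).comp (f := fun p : ℂ × ℂ => z + p.1 - p.2) (by fun_prop)).mul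
      ((hD _).comp (f := fun p : ℂ × ℂ => z - p.1 - p.2) (by fun_prop))).mul
      ((hD _).comp (f := fun p : ℂ × ℂ => -z + p.1 - p.2) (by fun_prop)) |>.mul
      ((hD _).comp (f := fun p : ℂ × ℂ => -z - p.1 - p.2) (by fun_prop))
  · rintro ⟨x, g⟩ ⟨hx, hg⟩
    obtain ⟨hx1, hx2⟩ := abs_lt.mp (show |x.im| < Y from hx)
    have hg' : g.im < c := hg
    refine mul_ne_zero (mul_ne_zero (mul_ne_zero ?_ ?_) ?_) ?_ <;> refine hne _ ?_ <;>
      simp only [add_im, sub_im, neg_im] <;> linarith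
  · refine Differentiable.differentiableOn ?_
    exact ((((hθ1.comp (f := fun p : ℂ × ℂ => 2 * p.1) (by fun_prop)).const_mul _).mul
      (hθ2.comp (f := fun p : ℂ × ℂ => 2 * p.1) (by fun_prop))).neg).mul
      (hΦ.comp (f := fun p : ℂ × ℂ => p.1) (by fun_prop))

theorem dPoch_sub_one (S : Finset (ℕ × ℕ)) (u : ℂ) {ω₁ ω₂ : ℂ} :
    dPoch ω₁ ω₂ S (u - 1) = dPoch ω₁ ω₂ S u := by
  rw [← dPoch_add_one S (u - 1), sub_add_cancel]

theorem regularKernel_add_one (S : Finset (ℕ × ℕ)) (z : ℂ) {Φ : ℂ → ℂ}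
    (hΦ : ∀ x, Φ (x + 1) = Φ x) (x g : ℂ) :
    regularKernel η τ S z Φ (x + 1) g = regularKernel η τ S z Φ x g := by
  have hθ : ∀ ω, theta1 (2 * (x + 1)) ω = theta1 (2 * x) ω := fun ω => by
    rw [mul_add, mul_one, show 2 * x + 2 = 2 * x + 1 + 1 by ring, theta1_add_one, theta1_add_one,
      neg_neg]
  simp only [regularKernel, hΦ, hθ]
  rw [show τ + 2 * η - (z + (x + 1) - g) = τ + 2 * η - (z + x - g) - 1 by ring,
    show τ + 2 * η - (z - (x + 1) - g) = τ + 2 * η - (z - x - g) + 1 by ring,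
    show τ + 2 * η - (-z + (x + 1) - g) = τ + 2 * η - (-z + x - g) - 1 by ring,
    show τ + 2 * η - (-z - (x + 1) - g) = τ + 2 * η - (-z - x - g) + 1 by ring,
    show z + (x + 1) - g = z + x - g + 1 by ring, show z - (x + 1) - g = z - x - g - 1 by ring,
    show -z + (x + 1) - g = -z + x - g + 1 by ring,
    show -z - (x + 1) - g = -z - x - g - 1 by ring]
  simp only [dPoch_add_one, dPoch_sub_one]

end Continuation


/-! ### Pinching of the contour at g = nη + mτ/2 -/

section Value

variable {η τ : ℂ}

theorem poleShift_sub_ne_int (hinc : ∀ a b c : ℤ, (a : ℂ) + b * τ + c * (2 * η) = 0 →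
    a = 0 ∧ b = 0 ∧ c = 0) {z : ℂ} (hz : 2 * z ∉ periodGroup η τ) {i j : Bool × ℕ × ℕ}
    (hij : i ≠ j) (a : ℤ) : poleShift η τ z i - poleShift η τ z j ≠ a := by
  obtain ⟨ε, l, k⟩ := i
  obtain ⟨δ, l', k'⟩ := j
  intro h
  simp only [poleShift] at h
  rcases ε <;> rcases δ <;> simp only [cond_true, cond_false] at h
  · obtain ⟨-, h3, h4⟩ := hinc (-a) (l - l') (k - k') (by push_cast; linear_combination h)
    exact hij (by rw [Prod.mk.injEq, Prod.mk.injEq]; exact ⟨rfl, by omega, by omega⟩)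
  · exact hz ⟨-a, l - l', k - k', by push_cast; linear_combination -h⟩
  · exact hz ⟨a, l' - l, k' - k, by push_cast; linear_combination h⟩
  · obtain ⟨-, h3, h4⟩ := hinc (-a) (l - l') (k - k') (by push_cast; linear_combination h)
    exact hij (by rw [Prod.mk.injEq, Prod.mk.injEq]; exact ⟨rfl, by omega, by omega⟩)

theorem injective_expTwoPi_poleShift (hinc : ∀ a b c : ℤ, (a : ℂ) + b * τ + c * (2 * η) = 0 →
    a = 0 ∧ b = 0 ∧ c = 0) {z : ℂ} (hz : 2 * z ∉ periodGroup η τ) :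
    Function.Injective fun i => expTwoPi (poleShift η τ z i) := by
  intro i j hij
  by_contra hne
  obtain ⟨a, ha⟩ := expTwoPi_eq_one_iff.mp
    (show expTwoPi (poleShift η τ z i - poleShift η τ z j) = 1 by
      rw [expTwoPi_sub, show expTwoPi (poleShift η τ z i) = _ from hij,
        div_self (expTwoPi_ne_zero _)])
  exact poleShift_sub_ne_int hinc hz hne a ha

theorem poleShift_add_ne_int {z : ℂ} (hz : 2 * z ∉ periodGroup η τ) {i j : Bool × ℕ × ℕ}
    (hij : i.1 = j.1) (n m : ℕ) (a : ℤ) :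
    poleShift η τ z i + poleShift η τ z j - 2 * (n * η + m * (τ / 2)) ≠ a := by
  obtain ⟨ε, l, k⟩ := i
  obtain ⟨δ, l', k'⟩ := j
  obtain rfl : ε = δ := hij
  intro h
  simp only [poleShift] at h
  rcases ε <;> simp only [cond_true, cond_false] at h
  · exact hz ⟨-a, l + l' - m, k + k' - n, by push_cast; linear_combination -h⟩
  · exact hz ⟨a, m - l - l', n - k - k', by push_cast; linear_combination h⟩

/-- The factor (m,n) of D(-2g) vanishes at this spin, and it is removed only when it is the factor
belonging to the pair. -/
theorem pairCoeff_eq_zero {z : ℂ} {i j : Bool × ℕ × ℕ} {n m : ℕ}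
    (h : ¬(i.1 ≠ j.1 ∧ i.2.1 + j.2.1 = m ∧ i.2.2 + j.2.2 = n)) :
    pairCoeff η τ z i j (n * η + m * (τ / 2)) = 0 := by
  have e : expTwoPi (-2 * (n * η + m * (τ / 2)) + (m * τ + n * (2 * η))) = 1 := by
    rw [show -2 * (n * η + m * (τ / 2)) + (m * τ + n * (2 * η)) = 0 by ring, expTwoPi_zero]
  rw [pairCoeff]
  split_ifs with hij
  · rw [dPoch_eq_zero (Finset.notMem_empty (m, n)) e, zero_div]
  · refine dPoch_eq_zero (i := m) (j := n) ?_ e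
    rw [Finset.mem_singleton, Prod.mk.injEq]
    exact fun h' => h ⟨hij, h'.1.symm, h'.2.symm⟩

theorem pairCoeff_eq_dPochHat {z : ℂ} {i j : Bool × ℕ × ℕ} {n m : ℕ} (h1 : i.1 ≠ j.1)
    (h2 : i.2.1 + j.2.1 = m) (h3 : i.2.2 + j.2.2 = n) :
    pairCoeff η τ z i j (n * η + m * (τ / 2)) = dPochHat τ (2 * η) m n := by
  rw [pairCoeff, if_neg h1, h2, h3, dPochHat]
  congr 1
  ring

theorem analyticAt_pairCoeff (hη : 0 < (2 * η).im) (hτ : 0 < τ.im) {z : ℂ}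
    (hz : 2 * z ∉ periodGroup η τ) (i j : Bool × ℕ × ℕ) (n m : ℕ) :
    AnalyticAt ℂ (pairCoeff η τ z i j) (n * η + m * (τ / 2)) := by
  have hD : ∀ S, AnalyticAt ℂ (fun g => dPoch τ (2 * η) S (-2 * g)) (n * η + m * (τ / 2)) :=
    fun S => ((differentiable_dPoch hτ hη S).comp (by fun_prop)).analyticAt _
  unfold pairCoeff
  split_ifs with hij
  · refine (hD ∅).div (Differentiable.analyticAt ?_ _) ?_
    · exact (differentiable_expTwoPi.comp (by fun_prop)).const_sub 1
    · rw [sub_ne_zero]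
      intro h
      obtain ⟨a, ha⟩ := expTwoPi_eq_one_iff.mp h.symm
      exact poleShift_add_ne_int hz hij n m a ha
  · exact hD _

theorem meromorphicAt_pairCoeff (hη : 0 < (2 * η).im) (hτ : 0 < τ.im) (z : ℂ)
    (i j : Bool × ℕ × ℕ) (g : ℂ) : MeromorphicAt (pairCoeff η τ z i j) g := by
  have hD : ∀ S, MeromorphicAt (fun g => dPoch τ (2 * η) S (-2 * g)) g := fun S =>
    (((differentiable_dPoch hτ hη S).comp (by fun_prop)).analyticAt _).meromorphicAt
  unfold pairCoeff
  split_ifs with hij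
  · refine (hD ∅).div (Differentiable.analyticAt ?_ _).meromorphicAt
    exact (differentiable_expTwoPi.comp (by fun_prop)).const_sub 1
  · exact hD _

/-- The continued integral operator at `g = nη + mτ/2` as a sum over the pairs of poles that
pinch the contour. -/
theorem exists_isIntertwinerValue_sum (hη : 0 < (2 * η).im) (hτ : 0 < τ.im)
    (hinc : ∀ a b c : ℤ, (a : ℂ) + b * τ + c * (2 * η) = 0 → a = 0 ∧ b = 0 ∧ c = 0)
    (n m : ℕ) {z : ℂ} (hz : 2 * z ∉ periodGroup η τ) {Φ : ℂ → ℂ} (hΦ : Differentiable ℂ Φ)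
    (hper : ∀ x, Φ (x + 1) = Φ x) :
    ∃ N : ℕ, m < N ∧ n < N ∧ IsIntertwinerValue η τ (n * η + m * (τ / 2)) Φ z
      (qPoch (nomePow (2 * η) 1) (2 * η) * qPoch (nomePow τ 1) τ / 2
        * (dPoch τ (2 * η) ∅ (τ + 2 * η + 2 * (n * η + m * (τ / 2))))⁻¹
        * ∑ i ∈ Finset.univ ×ˢ (Finset.range (m + 1) ×ˢ Finset.range (n + 1)),
          residueCoeff (Finset.univ ×ˢ (Finset.range N ×ˢ Finset.range N)) (poleShift η τ z) i
          * residueCoeff (Finset.univ ×ˢ (Finset.range N ×ˢ Finset.range N)) (poleShift η τ z)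
            (!i.1, m - i.2.1, n - i.2.2)
          * (dPochHat τ (2 * η) m n * regularKernel η τ (Finset.range N ×ˢ Finset.range N) z Φ
            (n * η + m * (τ / 2) - poleShift η τ z i) (n * η + m * (τ / 2)))) := by
  set g₀ : ℂ := n * η + m * (τ / 2) with hg₀
  have hη' : 0 < η.im := by
    simp only [mul_im, re_ofNat, im_ofNat, zero_mul, add_zero] at hη
    linarith
  have hg0 : 0 ≤ g₀.im := by
    have : g₀.im = n * η.im + m * (τ.im / 2) := by
      rw [hg₀, add_im, ← Complex.ofReal_natCast, ← Complex.ofReal_natCast, Complex.im_ofReal_mul,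
        Complex.im_ofReal_mul, show τ / 2 = τ / (2 : ℝ) by norm_num, Complex.div_ofReal_im]
    rw [this]
    positivity
  have hz1 := neg_abs_le z.im
  have hz2 := le_abs_self z.im
  have hz0 := abs_nonneg z.im
  -- The continuation covers Im g < c. The height y exceeds c + |Im z|, hence the imaginary part of
  -- every pole g - b, and Y > y gives the strip in which the kernel must be holomorphic.
  obtain ⟨c, hc⟩ : ∃ c, c = g₀.im + 1 := ⟨_, rfl⟩
  obtain ⟨y, hy⟩ : ∃ y, y = c + |z.im| + 1 := ⟨_, rfl⟩
  obtain ⟨Y, hY⟩ : ∃ Y, Y = y + 1 := ⟨_, rfl⟩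
  obtain ⟨N₁, hN₁⟩ := exists_nat_gt ((|z.im| + Y + c) / τ.im)
  obtain ⟨N₂, hN₂⟩ := exists_nat_gt ((|z.im| + Y + c) / (2 * η).im)
  -- N₁ and N₂ make the kernel holomorphic; the rest puts all pinching poles into the square.
  set N : ℕ := N₁ + N₂ + m + n + 1 with hN
  rw [div_lt_iff₀ hτ] at hN₁
  rw [div_lt_iff₀ hη] at hN₂
  have hN1 : |z.im| + Y + c < N * τ.im := hN₁.trans_le (by
    have : N₁ ≤ N := by omega
    gcongr)
  have hN2 : |z.im| + Y + c < N * (2 * η).im := hN₂.trans_le (by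
    have : N₂ ≤ N := by omega
    gcongr)
  refine ⟨N, by omega, by omega, ?_⟩
  set S : Finset (ℕ × ℕ) := Finset.range N ×ˢ Finset.range N with hS
  set s : Finset (Bool × ℕ × ℕ) := Finset.univ ×ˢ S with hs
  set b := poleShift η τ z with hb
  set R := regularKernel η τ S z Φ with hR
  set C : ℂ := qPoch (nomePow (2 * η) 1) (2 * η) * qPoch (nomePow τ 1) τ / 2 with hC
  have hRd : DifferentiableOn ℂ (Function.uncurry R) ({x | |x.im| < Y} ×ˢ {g | g.im < c}) :=
    differentiableOn_regularKernel hη hτ hΦ hN1 hN2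
  have hRp : ∀ x g, R (x + 1) g = R x g := regularKernel_add_one S z hper
  have hy0 : 0 < y := by linarith
  have hyY : y < Y := by linarith
  have hbim : ∀ i, -|z.im| ≤ (b i).im := fun i => by
    have e : (b i).im = (cond i.1 z (-z)).im + (i.2.1 * τ.im + i.2.2 * (2 * η).im) := by
      rw [hb, poleShift, add_im, add_im, ← Complex.ofReal_natCast, ← Complex.ofReal_natCast,
        Complex.im_ofReal_mul, Complex.im_ofReal_mul]
    have p1 : 0 ≤ (i.2.1 : ℝ) * τ.im := by positivity
    have p2 : 0 ≤ (i.2.2 : ℝ) * (2 * η).im := by positivity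
    rw [e]
    rcases i.1 <;> simp only [cond_true, cond_false, neg_im] <;> linarith
  have hbc : ∀ i, c - (b i).im < y := fun i => by linarith [hbim i]
  have hUp : ∀ i, DifferentiableOn ℂ (contourUp R y (b i)) {g | g.im < c} := fun i =>
    differentiableOn_contourUp hRd hy0 hyY (hbc i)
  have hDown : ∀ i, DifferentiableOn ℂ (contourDown R y (b i)) {g | g.im < c} := fun i =>
    differentiableOn_contourDown hRd hy0 hyY (hbc i)
  have hUpA : ∀ i g, g.im < c → AnalyticAt ℂ (contourUp R y (b i)) g := fun i g hg =>
    (hUp i).analyticAt ((isOpen_im_lt c).mem_nhds hg)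
  have hDownA : ∀ i g, g.im < c → AnalyticAt ℂ (contourDown R y (b i)) g := fun i g hg =>
    (hDown i).analyticAt ((isOpen_im_lt c).mem_nhds hg)
  have hgc : g₀.im < c := by linarith
  have hDσ : ∀ g, AnalyticAt ℂ (fun g => dPoch τ (2 * η) ∅ (τ + 2 * η + 2 * g)) g := fun g =>
    ((differentiable_dPoch hτ hη ∅).comp (by fun_prop)).analyticAt _
  have hDσ0 : dPoch τ (2 * η) ∅ (τ + 2 * η + 2 * g₀) ≠ 0 :=
    dPoch_ne_zero_of_im_pos hτ hη ∅ (by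
      rw [add_im, add_im, show (2 * g₀).im = 2 * g₀.im by simp]
      linarith)
  refine ⟨fun g => C * (dPoch τ (2 * η) ∅ (τ + 2 * η + 2 * g))⁻¹ * ∑ i ∈ s, ∑ j ∈ s,
    residueCoeff s b i * residueCoeff s b j *
      (pairCoeff η τ z i j g * (contourUp R y (b i) g + contourDown R y (b j) g)),
    c, hgc, ?_, ?_, ?_, ?_⟩
  · intro g hg
    refine ((MeromorphicAt.const C g).mul (hDσ g).meromorphicAt.inv).mul
      (MeromorphicAt.fun_sum fun i _ => MeromorphicAt.fun_sum fun j _ =>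
        (MeromorphicAt.const _ g).mul ((meromorphicAt_pairCoeff hη hτ z i j g).mul
          ((hUpA i g hg).add (hDownA j g hg)).meromorphicAt))
  · exact (analyticAt_const.mul ((hDσ g₀).inv hDσ0)).mul
      (Finset.analyticAt_fun_sum _ fun i _ => Finset.analyticAt_fun_sum _ fun j _ =>
        analyticAt_const.mul ((analyticAt_pairCoeff hη hτ hz i j n m).mul
          ((hUpA i g₀ hgc).add (hDownA j g₀ hgc))))
  · intro g hg hg1 hg2
    have hbg : ∀ i, 0 < (b i - g).im := fun i => by
      simp only [add_im, sub_im, neg_im] at hg1 hg2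
      have : |z.im| < -g.im := abs_lt.mpr ⟨by linarith, by linarith⟩
      rw [sub_im]
      linarith [hbim i]
    have hsn : s.Nonempty := ⟨(true, 0, 0), by simp [hs, hS, hN]⟩
    rw [intertwinerIntegral]
    have h1 := integral_mul_prod_inv_eq hsn (b := b)
      (injective_expTwoPi_poleShift hinc hz).injOn hRd hRp hy0 hyY hg fun i _ => hbg i
    have h2 : ∫ t in (0 : ℝ)..1, ellGamma η τ (z + t - g) * ellGamma η τ (z - t - g)
          * ellGamma η τ (-z + t - g) * ellGamma η τ (-z - t - g)
        / (ellGamma η τ (-2 * g) * ellGamma η τ (2 * t) * ellGamma η τ (-2 * t)) * Φ t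
        = dPoch τ (2 * η) ∅ (-2 * g) * (dPoch τ (2 * η) ∅ (τ + 2 * η + 2 * g))⁻¹
          * ∑ i ∈ s, ∑ j ∈ s, residueCoeff s b i * residueCoeff s b j *
        ((1 - expTwoPi (b i + b j - 2 * g))⁻¹
          * (contourUp R y (b i) g + contourDown R y (b j) g)) := by
      rw [← h1, ← intervalIntegral.integral_const_mul]
      exact intervalIntegral.integral_congr fun t _ => intertwinerIntegrand_eq hη hτ S z Φ t g
    simp only
    rw [h2, mul_comm (dPoch τ (2 * η) ∅ (-2 * g)), mul_assoc, mul_assoc]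
    congr 2
    rw [Finset.mul_sum]
    refine Finset.sum_congr rfl fun i _ => ?_
    rw [Finset.mul_sum]
    refine Finset.sum_congr rfl fun j _ => ?_
    rw [pairCoeff_eq hη hτ z i j (one_sub_expTwoPi_ne_zero (by
      have p1 := hbg i
      have p2 := hbg j
      rw [sub_im] at p1 p2
      rw [sub_im, add_im, show (2 * g).im = 2 * g.im by simp]
      linarith))]
    ring
  · simp only
    congr 1
    symm
    -- Only i with l ≤ m and k ≤ n have a partner, and the partner is unique: opposite sign and
    -- indices m-l, n-k.
    refine Finset.sum_subset_zero_on_sdiff (Finset.product_subset_product_right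
      (Finset.product_subset_product (Finset.range_subset_range.mpr (by omega))
        (Finset.range_subset_range.mpr (by omega)))) (fun i hi => ?_) fun i hi => ?_
    · refine Finset.sum_eq_zero fun j _ => ?_
      rw [pairCoeff_eq_zero, zero_mul, mul_zero]
      rintro ⟨-, h2, h3⟩
      refine (Finset.mem_sdiff.mp hi).2 ?_
      simp only [Finset.mem_product, Finset.mem_univ, Finset.mem_range, true_and]
      omega
    · simp only [Finset.mem_product, Finset.mem_univ, Finset.mem_range, true_and] at hi
      have hj : i.1 ≠ !i.1 := by rcases i.1 <;> simp
      rw [Finset.sum_eq_single (!i.1, m - i.2.1, n - i.2.2)]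
      · rw [pairCoeff_eq_dPochHat hj (by simp only; omega) (by simp only; omega),
          contourUp_add_contourDown hRd hRp hyY hgc (hbc _) (hbc _)]
        rw [hb, poleShift_add_of_ne z hj]
        simp only
        rw [show i.2.1 + (m - i.2.1) = m by omega, show i.2.2 + (n - i.2.2) = n by omega, hg₀]
        ring
      · intro j _ hne
        rw [pairCoeff_eq_zero, zero_mul, mul_zero]
        rintro ⟨h1, h2, h3⟩
        refine hne ?_
        obtain ⟨δ, l, k⟩ := j
        simp only at h1 h2 h3
        rw [Prod.mk.injEq, Prod.mk.injEq]
        refine ⟨?_, by omega, by omega⟩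
        revert h1
        rcases i.1 <;> rcases δ <;> simp
      · intro h
        refine absurd ?_ h
        simp only [hs, hS, Finset.mem_product, Finset.mem_univ, Finset.mem_range, true_and]
        omega

end Value


/-! ## The weights of the residues -/

section Weights

variable {η τ : ℂ}

theorem prod_erase_product (S : Finset (ℕ × ℕ)) (f : Bool × ℕ × ℕ → ℂ) (ε : Bool) (x : ℕ × ℕ) :
    ∏ j ∈ (Finset.univ ×ˢ S).erase (ε, x), f j
      = (∏ y ∈ S.erase x, f (ε, y)) * ∏ y ∈ S, f (!ε, y) := by
  have h : (Finset.univ ×ˢ S).erase (ε, x) = ({ε} ×ˢ S.erase x) ∪ ({!ε} ×ˢ S) := by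
    ext ⟨δ, y⟩
    simp only [Finset.mem_erase, Finset.mem_product, Finset.mem_univ, Finset.mem_union,
      Finset.mem_singleton, true_and, ne_eq, Prod.mk.injEq]
    rcases ε <;> rcases δ <;> simp
  rw [h, Finset.prod_union, Finset.prod_product, Finset.prod_product, Finset.prod_singleton,
    Finset.prod_singleton]
  rw [Finset.disjoint_left]
  rintro ⟨δ, y⟩ h1 h2
  simp only [Finset.mem_product, Finset.mem_singleton] at h1 h2
  rcases ε <;> simp_all

/-- The partial fraction coefficient restores the factors with indices in S: poles of the same sign
complete the first double product except for its zero, those of the opposite sign complete the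
second. -/
theorem residueCoeff_mul_inv (hη : 0 < (2 * η).im) (hτ : 0 < τ.im) {S : Finset (ℕ × ℕ)} (z : ℂ)
    (ε : Bool) {l k : ℕ} (h : (l, k) ∈ S) {w : ℂ} (hw : w = cond ε (-z) z) :
    residueCoeff (Finset.univ ×ˢ S) (poleShift η τ z) (ε, l, k)
      * (dPoch τ (2 * η) S (-(l * τ + k * (2 * η)))
        * dPoch τ (2 * η) S (2 * w - (l * τ + k * (2 * η))))⁻¹
      = (dPochHat τ (2 * η) l k * dPoch τ (2 * η) ∅ (2 * w - (l * τ + k * (2 * η))))⁻¹ := by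
  rw [residueCoeff, prod_erase_product, dPoch_eq_prod_mul hτ hη S, dPochHat,
    dPoch_eq_prod_sdiff_mul hτ hη (Finset.singleton_subset_iff.mpr h),
    Finset.sdiff_singleton_eq_erase]
  have e1 : ∀ y : ℕ × ℕ, poleShift η τ z (ε, y) - poleShift η τ z (ε, l, k)
      = -(l * τ + k * (2 * η)) + (y.1 * τ + y.2 * (2 * η)) := fun y => by
    simp only [poleShift]
    ring
  have e2 : ∀ y : ℕ × ℕ, poleShift η τ z (!ε, y) - poleShift η τ z (ε, l, k)
      = 2 * w - (l * τ + k * (2 * η)) + (y.1 * τ + y.2 * (2 * η)) := fun y => by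
    rw [hw]
    rcases ε <;> simp only [poleShift, Bool.not_true, Bool.not_false, cond_true, cond_false] <;>
      ring
  simp only [e1, e2]
  rw [← mul_inv]
  congr 1
  ring

/-- With X = lτ+2kη and X' = l'τ+2k'η, the arguments of the kernel denominators at the pinched pole
are -X, -X', 2w-X and -2w-X'. The dependence on S then disappears. -/
theorem residueCoeff_mul_regularKernel (hη : 0 < (2 * η).im) (hτ : 0 < τ.im)
    {S : Finset (ℕ × ℕ)} (z : ℂ) (ε : Bool) {l k l' k' n m : ℕ} (hl : l + l' = m) (hk : k + k' = n)
    (h : (l, k) ∈ S) (h' : (l', k') ∈ S) {w : ℂ} (hw : w = cond ε (-z) z) (Φ : ℂ → ℂ) {x : ℂ}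
    (hx : x = w + (n - 2 * k) * η + (m - 2 * l) * (τ / 2)) :
    residueCoeff (Finset.univ ×ˢ S) (poleShift η τ z) (ε, l, k)
        * residueCoeff (Finset.univ ×ˢ S) (poleShift η τ z) (!ε, l', k')
        * regularKernel η τ S z Φ (n * η + m * (τ / 2) - poleShift η τ z (ε, l, k))
          (n * η + m * (τ / 2))
      = (dPoch τ (2 * η) ∅ (τ + 2 * η - 0 + (l * τ + k * (2 * η))) / dPochHat τ (2 * η) l k)
        * (dPoch τ (2 * η) ∅ (τ + 2 * η - 0 + (l' * τ + k' * (2 * η))) / dPochHat τ (2 * η) l' k')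
        * (dPoch τ (2 * η) ∅ (τ + 2 * η - 2 * w + (l * τ + k * (2 * η)))
          / dPoch τ (2 * η) ∅ (2 * w - (l * τ + k * (2 * η))))
        * (dPoch τ (2 * η) ∅ (τ + 2 * η - -(2 * w) + (l' * τ + k' * (2 * η)))
          / dPoch τ (2 * η) ∅ (-(2 * w) - (l' * τ + k' * (2 * η))))
        * (-(thetaR τ * thetaR (2 * η) * theta1 (2 * x) τ * theta1 (2 * x) (2 * η)) * Φ x) := by
  have r1 := residueCoeff_mul_inv hη hτ z ε h hw
  have r2 := residueCoeff_mul_inv hη hτ z (!ε) h' (w := -w) (by rw [hw]; cases ε <;> simp)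
  have hxe : n * η + m * (τ / 2) - poleShift η τ z (ε, l, k) = x := by
    rw [hx, hw]
    cases ε <;> simp only [poleShift, cond_true, cond_false] <;> ring
  have hn : (n : ℂ) = k + k' := by rw [← hk]; push_cast; ring
  have hm : (m : ℂ) = l + l' := by rw [← hl]; push_cast; ring
  set X : ℂ := l * τ + k * (2 * η) with hX
  set X' : ℂ := l' * τ + k' * (2 * η) with hX'
  have hker : regularKernel η τ S z Φ x (n * η + m * (τ / 2))
      = (dPoch τ (2 * η) ∅ (τ + 2 * η - 0 + X) * dPoch τ (2 * η) ∅ (τ + 2 * η - 0 + X')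
        * dPoch τ (2 * η) ∅ (τ + 2 * η - 2 * w + X) * dPoch τ (2 * η) ∅ (τ + 2 * η - -(2 * w) + X'))
        * (dPoch τ (2 * η) S (-X) * dPoch τ (2 * η) S (2 * w - X))⁻¹
        * (dPoch τ (2 * η) S (-X') * dPoch τ (2 * η) S (2 * -w - X'))⁻¹
        * (-(thetaR τ * thetaR (2 * η) * theta1 (2 * x) τ * theta1 (2 * x) (2 * η)) * Φ x) := by
    have a1 : w + x - (n * η + m * (τ / 2)) = 2 * w - X := by rw [hx, hX]; ring
    have a2 : w - x - (n * η + m * (τ / 2)) = -X' := by rw [hx, hX', hn, hm]; ring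
    have a3 : -w + x - (n * η + m * (τ / 2)) = -X := by rw [hx, hX]; ring
    have a4 : -w - x - (n * η + m * (τ / 2)) = 2 * -w - X' := by rw [hx, hX', hn, hm]; ring
    -- The kernel is even in z, so w = ±z may replace z for either sign of the pole.
    have hsym : regularKernel η τ S z Φ x (n * η + m * (τ / 2))
        = regularKernel η τ S w Φ x (n * η + m * (τ / 2)) := by
      rw [hw]
      cases ε
      · rfl
      · simp only [cond_true, regularKernel, neg_neg]
        congr 2 <;> ring
    rw [hsym, regularKernel, a1, a2, a3, a4, div_eq_mul_inv, mul_inv, mul_inv, mul_inv, mul_inv,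
      mul_inv, show τ + 2 * η - (2 * w - X) = τ + 2 * η - 2 * w + X by ring,
      show τ + 2 * η - -X' = τ + 2 * η - 0 + X' by ring,
      show τ + 2 * η - -X = τ + 2 * η - 0 + X by ring,
      show τ + 2 * η - (2 * -w - X') = τ + 2 * η - -(2 * w) + X' by ring]
    ring
  have e : ∀ a b p q r s : ℂ, a * b * (p * q * r * s) = p * (a * q) * (b * r) * s := by
    intros; ring
  rw [hxe, hker, e, r1, r2, show 2 * -w - X' = -(2 * w) - X' by ring]
  simp only [div_eq_mul_inv, mul_inv]
  ring

end Weights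

/-! ## Shifts of the elliptic gamma function -/

/-- The quotient of the values of the elliptic gamma function at `u` and `u - lω₁ - kω₂`. -/
noncomputable def shiftFactor (ω₁ ω₂ u : ℂ) (l k : ℕ) : ℂ :=
  (∏ b ∈ Finset.range k, thetaM (expTwoPi (u - (b + 1) * ω₂)) ω₁)
    * ∏ a ∈ Finset.range l, thetaM (expTwoPi (u - ((a + 1) * ω₁ + k * ω₂))) ω₂

/-- The exponential factor in the expression of `shiftFactor` by theta functions. -/
noncomputable def shiftExp (ω₁ ω₂ u : ℂ) (l k : ℕ) : ℂ :=
  cexp (π * I * (k * u - ω₂ * (k * (k + 1) / 2)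
    + (2 * k + 1) * (l * u - ω₁ * (l * (l + 1) / 2)) - l * (k * (k + 1)) * ω₂))

/-- The product `∏_{b=1}^k θ₁(u - bs|ω)`. -/
noncomputable def thetaProd (s ω u : ℂ) (k : ℕ) : ℂ :=
  ∏ b ∈ Finset.range k, theta1 (u - (b + 1) * s) ω

section Shift

variable {ω₁ ω₂ : ℂ}

/-- B stands for the denominator of the gamma function at u-lω₁-kω₂: the double product for generic
u, and `dPochHat` for u = 0. The path goes k steps in ω₂ at l = 0, then l steps in ω₁. -/
theorem dPoch_div_eq_shiftFactor_mul (h₁ : 0 < ω₁.im) (h₂ : 0 < ω₂.im) {u : ℂ} {B : ℕ → ℕ → ℂ}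
    (hB₁ : ∀ k, B 0 (k + 1) = qPoch (expTwoPi (u - (k + 1) * ω₂)) ω₁ * B 0 k)
    (hB₂ : ∀ l k, B (l + 1) k = qPoch (expTwoPi (u - ((l + 1) * ω₁ + k * ω₂))) ω₂ * B l k)
    (hB₀ : ∀ l k, B l k ≠ 0) (l k : ℕ) :
    dPoch ω₁ ω₂ ∅ (ω₁ + ω₂ - u) / B 0 0
      = shiftFactor ω₁ ω₂ u l k * (dPoch ω₁ ω₂ ∅ (ω₁ + ω₂ - u + (l * ω₁ + k * ω₂)) / B l k) := by
  have hθ : ∀ v ω : ℂ, thetaM (expTwoPi v) ω = qPoch (expTwoPi v) ω * qPoch (expTwoPi (ω - v)) ω :=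
    fun v ω => by rw [thetaM, nomePow_eq_expTwoPi, mul_one, ← expTwoPi_neg, ← expTwoPi_add,
      sub_eq_add_neg]
  have hQ : ∀ a b c d Q : ℂ, Q ≠ 0 → a * (b * c / d) = a * (Q * b) * (c / (Q * d)) :=
    fun a b c d Q hQ => by field_simp
  have hk : ∀ k : ℕ, dPoch ω₁ ω₂ ∅ (ω₁ + ω₂ - u) / B 0 0
      = shiftFactor ω₁ ω₂ u 0 k * (dPoch ω₁ ω₂ ∅ (ω₁ + ω₂ - u + k * ω₂) / B 0 k) := by
    intro k
    induction k with
    | zero => simp [shiftFactor]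
    | succ k ih =>
      rw [ih]
      have hb := hB₁ k
      have hb0 := hB₀ 0 k
      have hb1 := hB₀ 0 (k + 1)
      have hq : qPoch (expTwoPi (u - (k + 1) * ω₂)) ω₁ ≠ 0 := fun h => hb1 (by rw [hb, h, zero_mul])
      simp only [shiftFactor, Finset.prod_range_zero, mul_one, Finset.prod_range_succ]
      rw [hb, hθ, dPoch_add_snd h₁ h₂ (ω₁ + ω₂ - u + k * ω₂),
        show ω₁ + ω₂ - u + k * ω₂ = ω₁ - (u - (k + 1) * ω₂) by ring,
        show ω₁ + ω₂ - u + ((k + 1 : ℕ) : ℂ) * ω₂ = ω₁ - (u - (k + 1) * ω₂) + ω₂ by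
          push_cast; ring]
      exact hQ _ _ _ _ _ hq
  induction l with
  | zero =>
    rw [hk k, Nat.cast_zero, zero_mul, zero_add]
  | succ l ih =>
    rw [ih]
    have hb := hB₂ l k
    have hb0 := hB₀ l k
    have hb1 := hB₀ (l + 1) k
    have hq : qPoch (expTwoPi (u - ((l + 1) * ω₁ + k * ω₂))) ω₂ ≠ 0 := fun h =>
      hb1 (by rw [hb, h, zero_mul])
    simp only [shiftFactor, Finset.prod_range_succ]
    rw [hb, hθ (u - ((l + 1) * ω₁ + k * ω₂)), dPoch_add_fst h₁ h₂ (ω₁ + ω₂ - u + (l * ω₁ + k * ω₂)),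
      show ω₁ + ω₂ - u + (l * ω₁ + k * ω₂) = ω₂ - (u - ((l + 1) * ω₁ + k * ω₂)) by ring,
      show ω₁ + ω₂ - u + (((l + 1 : ℕ) : ℂ) * ω₁ + k * ω₂)
        = ω₂ - (u - ((l + 1) * ω₁ + k * ω₂)) + ω₁ by push_cast; ring, mul_assoc, mul_assoc]
    refine congrArg _ ?_
    exact hQ _ _ _ _ _ hq

/-- In the second product kω₂ is a multiple of the modulus. Its removal by quasi-periodicity of θ₁
produces the sign (-1)^{kl} and the mixed terms of the exponent. -/
theorem shiftFactor_eq (h₁ : 0 < ω₁.im) (h₂ : 0 < ω₂.im) (u : ℂ) (l k : ℕ) :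
    shiftFactor ω₁ ω₂ u l k = (-1) ^ (k * l) * (thetaR ω₁ ^ k * thetaR ω₂ ^ l)
      * shiftExp ω₁ ω₂ u l k
      * (thetaProd ω₂ ω₁ u k * thetaProd ω₁ ω₂ u l) := by
  have e1 : ∏ b ∈ Finset.range k, thetaM (expTwoPi (u - (b + 1) * ω₂)) ω₁
      = thetaR ω₁ ^ k * cexp (π * I * (k * u - ω₂ * (k * (k + 1) / 2)))
        * thetaProd ω₂ ω₁ u k := by
    induction k with
    | zero => simp [thetaProd]
    | succ k ih =>
      rw [Finset.prod_range_succ, ih, expTwoPi, thetaM_exp _ h₁, thetaProd, thetaProd,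
        Finset.prod_range_succ, pow_succ,
        show (π * I * (((k + 1 : ℕ) : ℂ) * u - ω₂ * (((k + 1 : ℕ) : ℂ) * (((k + 1 : ℕ) : ℂ) + 1) / 2)))
          = π * I * (k * u - ω₂ * (k * (k + 1) / 2)) + π * I * (u - (k + 1) * ω₂) by
            push_cast; ring, Complex.exp_add]
      ring
  have e2 : ∏ a ∈ Finset.range l, thetaM (expTwoPi (u - ((a + 1) * ω₁ + k * ω₂))) ω₂
      = (-1) ^ (k * l) * thetaR ω₂ ^ l * cexp (π * I * ((2 * k + 1) * (l * u - ω₁ * (l * (l + 1) / 2))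
        - l * (k * (k + 1)) * ω₂)) * thetaProd ω₁ ω₂ u l := by
    induction l with
    | zero => simp [thetaProd]
    | succ l ih =>
      have hθ := theta1_add_int_mul (u - (l + 1) * ω₁) ω₂ (-k)
      rw [show u - (l + 1) * ω₁ + ((-k : ℤ) : ℂ) * ω₂ = u - ((l + 1) * ω₁ + k * ω₂) by
        push_cast; ring, zpow_neg, zpow_natCast, ← inv_pow,
        show ((-1 : ℂ))⁻¹ = -1 by norm_num] at hθ
      rw [Finset.prod_range_succ, ih, expTwoPi, thetaM_exp _ h₂, hθ, thetaProd, thetaProd,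
        Finset.prod_range_succ, pow_succ, mul_add, mul_one, pow_add,
        show (π * I * ((2 * k + 1) * (((l + 1 : ℕ) : ℂ) * u
            - ω₁ * (((l + 1 : ℕ) : ℂ) * (((l + 1 : ℕ) : ℂ) + 1) / 2))
            - ((l + 1 : ℕ) : ℂ) * (k * (k + 1)) * ω₂))
          = π * I * ((2 * k + 1) * (l * u - ω₁ * (l * (l + 1) / 2)) - l * (k * (k + 1)) * ω₂)
            + π * I * (u - ((l + 1) * ω₁ + k * ω₂)) + (-(π * I * ((-k : ℤ) : ℂ) ^ 2 * ω₂)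
              - 2 * π * I * ((-k : ℤ) : ℂ) * (u - (l + 1) * ω₁)) by
            push_cast; ring, Complex.exp_add, Complex.exp_add]
      ring_nf
  rw [shiftFactor, shiftExp, e1, e2, show (π * I * (k * u - ω₂ * (k * (k + 1) / 2)
        + (2 * k + 1) * (l * u - ω₁ * (l * (l + 1) / 2)) - l * (k * (k + 1)) * ω₂))
      = π * I * (k * u - ω₂ * (k * (k + 1) / 2)) + π * I * ((2 * k + 1)
        * (l * u - ω₁ * (l * (l + 1) / 2)) - l * (k * (k + 1)) * ω₂) by ring, Complex.exp_add]
  ring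

end Shift

/-- The denominators are split at j = k into k factors, θ₁(2z) and k' factors, which is the form in
which the residues arise. -/
theorem shiftCoeff_eq_thetaProd (s ω : ℂ) {n k k' : ℕ} (hk : k + k' = n) (z : ℂ) :
    shiftCoeff s ω n k z = (cexp (π * I * s) / thetaR ω) ^ n
      * (thetaProd (2 * s) ω 0 n / (thetaProd (2 * s) ω 0 k * thetaProd (2 * s) ω 0 k'))
      * (theta1 (2 * z + 2 * s * (n - 2 * k)) ω
        / (thetaProd (2 * s) ω (2 * z) k * theta1 (2 * z) ω
          * ((-1) ^ k' * thetaProd (2 * s) ω (-(2 * z)) k'))) := by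
  have e0 : ∀ j : ℕ, ∏ i ∈ Finset.Icc 1 j, theta1 (2 * s * i) ω
      = (-1) ^ j * thetaProd (2 * s) ω 0 j := fun j => by
    rw [prod_Icc_one_eq_range, thetaProd, ← Finset.card_range j, ← Finset.prod_const,
      Finset.card_range, ← Finset.prod_mul_distrib]
    refine Finset.prod_congr rfl fun b _ => ?_
    rw [neg_one_mul, ← theta1_neg]
    congr 1
    push_cast
    ring
  have e1 : ∏ j ∈ Finset.range (n + 1), theta1 (2 * z - 2 * s * ((k : ℂ) - j)) ω
      = thetaProd (2 * s) ω (2 * z) k * theta1 (2 * z) ω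
        * ((-1) ^ k' * thetaProd (2 * s) ω (-(2 * z)) k') := by
    rw [← hk, add_right_comm, Finset.prod_range_add, Finset.prod_range_succ, sub_self, mul_zero,
      sub_zero]
    congr 1
    · congr 1
      rw [← Finset.prod_range_reflect, thetaProd]
      refine Finset.prod_congr rfl fun b hb => ?_
      have := Finset.mem_range.mp hb
      congr 1
      rw [Nat.cast_sub (by omega), Nat.cast_sub (by omega)]
      push_cast
      ring
    · rw [thetaProd, ← Finset.card_range k', ← Finset.prod_const, Finset.card_range,
        ← Finset.prod_mul_distrib]
      refine Finset.prod_congr rfl fun b _ => ?_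
      rw [neg_one_mul, ← theta1_neg]
      congr 1
      push_cast
      ring
  have e2 : n - k = k' := by omega
  have e3 : ((-1 : ℂ)) ^ n = (-1) ^ k * (-1) ^ k' := by rw [← pow_add, hk]
  rw [shiftCoeff, ellBinom, e0, e0, e0, e1, e2, e3]
  congr 2
  rw [mul_mul_mul_comm ((-1 : ℂ) ^ k), mul_div_mul_left]
  exact mul_ne_zero (pow_ne_zero _ (by norm_num)) (pow_ne_zero _ (by norm_num))


/-! ### Residues as products of shift coefficients -/

section Weights

variable {η τ : ℂ}

theorem dPoch_ne_zero_of_notMem_periodGroup (hη : 0 < (2 * η).im) (hτ : 0 < τ.im) {u v : ℂ}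
    (hu : u ∉ periodGroup η τ) (l k : ℤ) (hv : v = u + (l * τ + k * (2 * η)) ∨
      v = -u + (l * τ + k * (2 * η))) : dPoch τ (2 * η) ∅ v ≠ 0 := by
  refine dPoch_ne_zero hτ hη fun i j _ h => hu ?_
  obtain ⟨a, ha⟩ := expTwoPi_eq_one_iff.mp h
  rcases hv with rfl | rfl
  · exact ⟨a, -l - i, -k - j, by push_cast; linear_combination ha⟩
  · exact ⟨-a, l + i, k + j, by push_cast; linear_combination -ha⟩

/-- The residues in terms of quotients of theta functions. -/
theorem residueWeight_eq (hη : 0 < (2 * η).im) (hτ : 0 < τ.im)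
    (hinc : ∀ a b c : ℤ, (a : ℂ) + b * τ + c * (2 * η) = 0 → a = 0 ∧ b = 0 ∧ c = 0)
    (l k l' k' n m : ℕ) {w : ℂ} (hw : 2 * w ∉ periodGroup η τ) (x φ : ℂ) :
    qPoch (nomePow (2 * η) 1) (2 * η) * qPoch (nomePow τ 1) τ
      * (dPoch τ (2 * η) ∅ (τ + 2 * η + 2 * (n * η + m * (τ / 2))))⁻¹ * (dPochHat τ (2 * η) m n
      * ((dPoch τ (2 * η) ∅ (τ + 2 * η - 0 + (l * τ + k * (2 * η))) / dPochHat τ (2 * η) l k)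
        * (dPoch τ (2 * η) ∅ (τ + 2 * η - 0 + (l' * τ + k' * (2 * η))) / dPochHat τ (2 * η) l' k')
        * (dPoch τ (2 * η) ∅ (τ + 2 * η - 2 * w + (l * τ + k * (2 * η)))
          / dPoch τ (2 * η) ∅ (2 * w - (l * τ + k * (2 * η))))
        * (dPoch τ (2 * η) ∅ (τ + 2 * η - -(2 * w) + (l' * τ + k' * (2 * η)))
          / dPoch τ (2 * η) ∅ (-(2 * w) - (l' * τ + k' * (2 * η))))
        * (-(thetaR τ * thetaR (2 * η) * theta1 (2 * x) τ * theta1 (2 * x) (2 * η)) * φ)))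
      = shiftFactor τ (2 * η) 0 m n / (shiftFactor τ (2 * η) 0 l k * shiftFactor τ (2 * η) 0 l' k'
          * (shiftFactor τ (2 * η) (2 * w) l k * shiftFactor τ (2 * η) (-(2 * w)) l' k'))
        * (theta1 (2 * x) τ * theta1 (2 * x) (2 * η)
          / (theta1 (2 * w) τ * theta1 (2 * w) (2 * η)) * φ) := by
  have hp := qPoch_nomePow_one_ne_zero hτ
  have hq := qPoch_nomePow_one_ne_zero hη
  have hσ : dPoch τ (2 * η) ∅ (τ + 2 * η) ≠ 0 :=
    dPoch_ne_zero_of_im_pos hτ hη ∅ (by rw [add_im]; linarith)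
  have hR1 := thetaR_ne_zero hτ
  have hR2 := thetaR_ne_zero hη
  -- The singular case u = 0 of the shift relation, with `dPochHat` replacing the vanishing
  -- denominators.
  have hG : ∀ l k : ℕ, (qPoch (nomePow (2 * η) 1) (2 * η) * qPoch (nomePow τ 1) τ)⁻¹
      = shiftFactor τ (2 * η) 0 l k * (dPoch τ (2 * η) ∅ (τ + 2 * η - 0 + (l * τ + k * (2 * η)))
        / dPochHat τ (2 * η) l k) := fun l k => by
    rw [← dPoch_div_eq_shiftFactor_mul hτ hη (u := 0) (B := dPochHat τ (2 * η)) (fun k => ?_)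
      (fun l k => ?_) (fun l k => dPochHat_ne_zero hτ hη hinc l k), dPochHat_zero_zero hτ hη,
      sub_zero]
    · field_simp
    · rw [dPochHat_succ_snd hτ hη, Nat.cast_zero, zero_mul, zero_add, zero_sub]
    · rw [← dPochHat_swap hτ hη, dPochHat_succ_snd hη hτ, dPochHat_swap hτ hη, zero_sub,
        add_comm ((k : ℂ) * (2 * η))]
  have hGam : ∀ v : ℂ, v ∉ periodGroup η τ → ∀ l k : ℕ, ellGamma η τ v
      = shiftFactor τ (2 * η) v l k * (dPoch τ (2 * η) ∅ (τ + 2 * η - v + (l * τ + k * (2 * η)))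
        / dPoch τ (2 * η) ∅ (v - (l * τ + k * (2 * η)))) := fun v hv l k => by
    rw [← dPoch_div_eq_shiftFactor_mul hτ hη (u := v)
      (B := fun l k => dPoch τ (2 * η) ∅ (v - (l * τ + k * (2 * η)))) (fun k => ?_)
      (fun l k => ?_) (fun l k => ?_), ellGamma_eq hη hτ]
    · simp
    · rw [dPoch_add_snd hτ hη]
      congr 3 <;> push_cast <;> ring
    · rw [dPoch_add_fst hτ hη]
      congr 3 <;> push_cast <;> ring
    · exact dPoch_ne_zero_of_notMem_periodGroup hη hτ hv (-l) (-k)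
        (Or.inl (by push_cast; ring))
  have hw' : -(2 * w) ∉ periodGroup η τ := fun ⟨a, b, c, h⟩ =>
    hw ⟨-a, -b, -c, by push_cast; linear_combination -h⟩
  have hΓ := inv_ellGamma_mul_ellGamma_neg (u := 2 * w) hη hτ
    (dPoch_ne_zero_of_notMem_periodGroup hη hτ hw 1 1 (Or.inl (by push_cast; ring)))
    (dPoch_ne_zero_of_notMem_periodGroup hη hτ hw 1 1 (Or.inr (by push_cast; ring)))
  have hθ1 : theta1 (2 * w) τ ≠ 0 := theta1_ne_zero hτ fun a b h =>
    hw ⟨a, b, 0, by push_cast; linear_combination h⟩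
  have hθ2 : theta1 (2 * w) (2 * η) ≠ 0 := theta1_ne_zero hη fun a b h =>
    hw ⟨a, 0, b, by push_cast; linear_combination h⟩
  rw [hGam _ hw l k, hGam _ hw' l' k'] at hΓ
  have h0 := hG m n
  have h1 := hG l k
  have h2 := hG l' k'
  have hH := dPochHat_ne_zero hτ hη hinc m n
  rw [show τ + 2 * η - 0 + (m * τ + n * (2 * η)) = τ + 2 * η + 2 * (n * η + m * (τ / 2)) by
    ring] at h0
  have hD : dPoch τ (2 * η) ∅ (τ + 2 * η + 2 * (n * η + m * (τ / 2))) ≠ 0 := fun h => by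
    rw [h, zero_div, mul_zero] at h0
    exact inv_ne_zero (mul_ne_zero hq hp) h0
  generalize shiftFactor τ (2 * η) 0 m n = T0 at h0 ⊢
  generalize shiftFactor τ (2 * η) 0 l k = T1 at h1 ⊢
  generalize shiftFactor τ (2 * η) 0 l' k' = T2 at h2 ⊢
  generalize shiftFactor τ (2 * η) (2 * w) l k = T3 at hΓ ⊢
  generalize shiftFactor τ (2 * η) (-(2 * w)) l' k' = T4 at hΓ ⊢
  generalize dPoch τ (2 * η) ∅ (τ + 2 * η - 0 + (l * τ + k * (2 * η))) / dPochHat τ (2 * η) l k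
    = G1 at h1 ⊢
  generalize dPoch τ (2 * η) ∅ (τ + 2 * η - 0 + (l' * τ + k' * (2 * η))) / dPochHat τ (2 * η) l' k'
    = G2 at h2 ⊢
  generalize dPoch τ (2 * η) ∅ (τ + 2 * η - 2 * w + (l * τ + k * (2 * η)))
          / dPoch τ (2 * η) ∅ (2 * w - (l * τ + k * (2 * η))) = G3 at hΓ ⊢
  generalize dPoch τ (2 * η) ∅ (τ + 2 * η - -(2 * w) + (l' * τ + k' * (2 * η)))
          / dPoch τ (2 * η) ∅ (-(2 * w) - (l' * τ + k' * (2 * η))) = G4 at hΓ ⊢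
  generalize dPoch τ (2 * η) ∅ (τ + 2 * η + 2 * (n * η + m * (τ / 2))) = D0 at h0 hD ⊢
  generalize dPochHat τ (2 * η) m n = H0 at h0 hH ⊢
  generalize qPoch (nomePow (2 * η) 1) (2 * η) = q at *
  generalize qPoch (nomePow τ 1) τ = p at *
  generalize theta1 (2 * w) τ = a at *
  generalize theta1 (2 * w) (2 * η) = b at *
  generalize thetaR τ = R1 at *
  generalize thetaR (2 * η) = R2 at *
  have hqp : (q * p)⁻¹ ≠ 0 := inv_ne_zero (mul_ne_zero hq hp)
  have hT1 : T1 ≠ 0 := fun h => hqp (by rw [h1, h, zero_mul])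
  have hT2 : T2 ≠ 0 := fun h => hqp (by rw [h2, h, zero_mul])
  have hT0 : T0 ≠ 0 := fun h => hqp (by rw [h0, h, zero_mul])
  have hk : -(R1 * R2 * a * b) ≠ 0 := neg_ne_zero.mpr (by positivity)
  have hT3 : T3 ≠ 0 := fun h => hk (by rw [← hΓ, h, zero_mul, zero_mul, inv_zero])
  have hT4 : T4 ≠ 0 := fun h => hk (by rw [← hΓ, h, zero_mul, mul_zero, inv_zero])
  have g1 : G1 = (q * p)⁻¹ / T1 := by rw [h1]; field_simp
  have g2 : G2 = (q * p)⁻¹ / T2 := by rw [h2]; field_simp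
  have g34 : G3 * G4 = -(R1 * R2 * a * b)⁻¹ / (T3 * T4) := by
    rw [neg_inv, ← hΓ, inv_inv]
    field_simp
  have g0 : D0⁻¹ * H0 = q * p * T0 := by
    field_simp at h0
    field_simp
    linear_combination h0
  rw [show q * p * D0⁻¹ * (H0 * (G1 * G2 * G3 * G4 * (-(R1 * R2 * theta1 (2 * x) τ
      * theta1 (2 * x) (2 * η)) * φ))) = q * p * (D0⁻¹ * H0) * (G1 * G2 * (G3 * G4) * (-(R1 * R2
      * theta1 (2 * x) τ * theta1 (2 * x) (2 * η)) * φ)) by ring, g0, g1, g2, g34]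
  field_simp

theorem thetaProd_ne_zero {s ω u : ℂ} (hω : 0 < ω.im) (k : ℕ)
    (h : ∀ a b : ℤ, ∀ c : ℕ, u - (c + 1) * s ≠ a + b * ω) : thetaProd s ω u k ≠ 0 :=
  Finset.prod_ne_zero_iff.mpr fun c _ => theta1_ne_zero hω fun a b => h a b c

theorem neg_one_zpow_sub_two_mul (m l : ℕ) : ((-1 : ℂ)) ^ ((m : ℤ) - 2 * l) = (-1) ^ m := by
  rw [zpow_sub₀ (by norm_num), zpow_mul, zpow_natCast]
  norm_num

/-- The residues, for a product of functions with the transformation laws of theta functions. -/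
theorem residueWeight_eq_shiftCoeff (hη : 0 < (2 * η).im) (hτ : 0 < τ.im)
    (hinc : ∀ a b c : ℤ, (a : ℂ) + b * τ + c * (2 * η) = 0 → a = 0 ∧ b = 0 ∧ c = 0)
    {l k l' k' n m : ℕ} (hl : l + l' = m) (hk : k + k' = n) {w : ℂ} (hw : 2 * w ∉ periodGroup η τ)
    {α β : ℤ} (hnα : Even ((n : ℤ) - α)) (hmβ : Even ((m : ℤ) - β)) {F G : ℂ → ℂ}
    (hF : HasThetaQuasiPeriod τ (n - 1) F) (hG : HasThetaQuasiPeriod (2 * η) (m - 1) G)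
    {x : ℂ} (hx : x = w + (n - 2 * k) * η + (m - 2 * l) * (τ / 2)) :
    shiftFactor τ (2 * η) 0 m n / (shiftFactor τ (2 * η) 0 l k * shiftFactor τ (2 * η) 0 l' k'
          * (shiftFactor τ (2 * η) (2 * w) l k * shiftFactor τ (2 * η) (-(2 * w)) l' k'))
        * (theta1 (2 * x) τ * theta1 (2 * x) (2 * η)
          / (theta1 (2 * w) τ * theta1 (2 * w) (2 * η)) * (F x * G x))
      = (-1) ^ (n * m) * cexp (-(π * I * τ / 2) * m ^ 2 * n - π * I * η * n ^ 2 * m)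
        * ((-1) ^ k * shiftCoeff η τ n k w * halfShift τ (n - 1) β F (w + (n - 2 * k) * η))
        * ((-1) ^ l * shiftCoeff (τ / 2) (2 * η) m l w
          * halfShift (2 * η) (m - 1) α G (w + (m - 2 * l) * (τ / 2))) := by
  have hn : (n : ℂ) = k + k' := by rw [← hk]; push_cast; ring
  have hm : (m : ℂ) = l + l' := by rw [← hl]; push_cast; ring
  have evenM : Even (((m : ℤ) - 2 * l) - β) := by
    rw [show ((m : ℤ) - 2 * l) - β = ((m : ℤ) - β) - 2 * l by ring]
    exact hmβ.sub (even_two_mul _)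
  have evenN : Even (((n : ℤ) - 2 * k) - α) := by
    rw [show ((n : ℤ) - 2 * k) - α = ((n : ℤ) - α) - 2 * k by ring]
    exact hnα.sub (even_two_mul _)
  have hFx := hF.apply_add_half evenM (w + (n - 2 * k) * η)
  have hGx := hG.apply_add_half evenN (w + (m - 2 * l) * (τ / 2))
  have hθ1 := theta1_add_int_mul (2 * w + 2 * η * (n - 2 * k)) τ ((m : ℤ) - 2 * l)
  have hθ2 := theta1_add_int_mul (2 * w + 2 * (τ / 2) * (m - 2 * l)) (2 * η) ((n : ℤ) - 2 * k)
  rw [show (w + (n - 2 * k) * η) + (((m : ℤ) - 2 * l : ℤ) : ℂ) * (τ / 2) = x by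
    rw [hx]; push_cast; ring] at hFx
  rw [show (w + (m - 2 * l) * (τ / 2)) + (((n : ℤ) - 2 * k : ℤ) : ℂ) * (2 * η / 2) = x by
    rw [hx]; push_cast; ring] at hGx
  rw [show (2 * w + 2 * η * (n - 2 * k)) + (((m : ℤ) - 2 * l : ℤ) : ℂ) * τ = 2 * x by
    rw [hx]; push_cast; ring, neg_one_zpow_sub_two_mul] at hθ1
  rw [show (2 * w + 2 * (τ / 2) * (m - 2 * l)) + (((n : ℤ) - 2 * k : ℤ) : ℂ) * (2 * η) = 2 * x by
    rw [hx]; push_cast; ring, neg_one_zpow_sub_two_mul] at hθ2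
  have hw1 : theta1 (2 * w) τ ≠ 0 := theta1_ne_zero hτ fun a b h =>
    hw ⟨a, b, 0, by push_cast; linear_combination h⟩
  have hw2 : theta1 (2 * w) (2 * η) ≠ 0 := theta1_ne_zero hη fun a b h =>
    hw ⟨a, 0, b, by push_cast; linear_combination h⟩
  have hR1 := thetaR_ne_zero hτ
  have hR2 := thetaR_ne_zero hη
  have p01 : ∀ k, thetaProd (2 * η) τ 0 k ≠ 0 := fun k => thetaProd_ne_zero hτ k fun a b c h => by
    have := (hinc a b (c + 1) (by push_cast; linear_combination -h)).2.2
    omega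
  have p02 : ∀ k, thetaProd τ (2 * η) 0 k ≠ 0 := fun k => thetaProd_ne_zero hη k fun a b c h => by
    have := (hinc a (c + 1) b (by push_cast; linear_combination -h)).2.1
    omega
  have p11 : ∀ k, thetaProd (2 * η) τ (2 * w) k ≠ 0 := fun k =>
    thetaProd_ne_zero hτ k fun a b c h => hw ⟨a, b, c + 1, by push_cast; linear_combination h⟩
  have p12 : ∀ k, thetaProd τ (2 * η) (2 * w) k ≠ 0 := fun k =>
    thetaProd_ne_zero hη k fun a b c h => hw ⟨a, c + 1, b, by push_cast; linear_combination h⟩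
  have p21 : ∀ k, thetaProd (2 * η) τ (-(2 * w)) k ≠ 0 := fun k =>
    thetaProd_ne_zero hτ k fun a b c h =>
      hw ⟨-a, -b, -(c + 1), by push_cast; linear_combination -h⟩
  have p22 : ∀ k, thetaProd τ (2 * η) (-(2 * w)) k ≠ 0 := fun k =>
    thetaProd_ne_zero hη k fun a b c h =>
      hw ⟨-a, -(c + 1), -b, by push_cast; linear_combination -h⟩
  rw [shiftCoeff_eq_thetaProd η τ hk, shiftCoeff_eq_thetaProd (τ / 2) (2 * η) hl, hFx, hGx, hθ1,
    hθ2, shiftFactor_eq hτ hη, shiftFactor_eq hτ hη, shiftFactor_eq hτ hη, shiftFactor_eq hτ hη,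
    shiftFactor_eq hτ hη, show 2 * (τ / 2) = τ by ring]
  -- The balance of all exponentials: shift factors, the two values of θ₁ at 2x and the half-period
  -- shifts of F and G. It is a polynomial identity after n = k+k' and m = l+l'.
  have hexp : shiftExp τ (2 * η) 0 m n
      * (cexp (-(π * I * (((m : ℤ) - 2 * l : ℤ) : ℂ) ^ 2 * τ)
        - 2 * π * I * (((m : ℤ) - 2 * l : ℤ) : ℂ) * (2 * w + 2 * η * (n - 2 * k)))
      * cexp (-(π * I * (((n : ℤ) - 2 * k : ℤ) : ℂ) ^ 2 * (2 * η))
        - 2 * π * I * (((n : ℤ) - 2 * k : ℤ) : ℂ) * (2 * w + τ * (m - 2 * l))))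
      * (cexp (-((((n : ℤ) - 1 : ℤ) : ℂ) * (π * I * τ * (((m : ℤ) - 2 * l : ℤ) : ℂ) ^ 2 / 2
        + 2 * π * I * (((m : ℤ) - 2 * l : ℤ) : ℂ) * (w + (n - 2 * k) * η))))
      * cexp (-((((m : ℤ) - 1 : ℤ) : ℂ) * (π * I * (2 * η) * (((n : ℤ) - 2 * k : ℤ) : ℂ) ^ 2 / 2
        + 2 * π * I * (((n : ℤ) - 2 * k : ℤ) : ℂ) * (w + (m - 2 * l) * (τ / 2))))))
      = cexp (-(π * I * τ / 2) * m ^ 2 * n - π * I * η * n ^ 2 * m)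
        * cexp (π * I * η) ^ n * cexp (π * I * (τ / 2)) ^ m
        * (shiftExp τ (2 * η) 0 l k * shiftExp τ (2 * η) 0 l' k'
          * (shiftExp τ (2 * η) (2 * w) l k * shiftExp τ (2 * η) (-(2 * w)) l' k')) := by
    simp only [shiftExp, ← Complex.exp_add, ← Complex.exp_nat_mul]
    congr 1
    push_cast
    rw [hn, hm]
    ring
  have hsq : ∀ j : ℕ, ((-1 : ℂ) ^ j) * (-1) ^ j = 1 := fun j => by
    rw [← mul_pow]; norm_num
  have hne : ∀ j : ℕ, ((-1 : ℂ) ^ j) ≠ 0 := fun j => pow_ne_zero _ (by norm_num)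
  have hsn : ((-1 : ℂ)) ^ n = (-1) ^ k * (-1) ^ k' := by rw [← pow_add, hk]
  have hsm : ((-1 : ℂ)) ^ m = (-1) ^ l * (-1) ^ l' := by rw [← pow_add, hl]
  -- The signs on the left come from the quasi-periods of θ₁ at 2x. Those with exponents kl and k'l'
  -- occur twice and cancel.
  have hsign : ((-1 : ℂ)) ^ m * (-1) ^ n
      = (-1) ^ k / (-1) ^ k' * ((-1) ^ l / (-1) ^ l') * ((-1) ^ (k * l) * (-1) ^ (k' * l')
        * ((-1) ^ (k * l) * (-1) ^ (k' * l'))) := by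
    rw [hsn, hsm, mul_mul_mul_comm ((-1 : ℂ) ^ (k * l)), hsq, hsq, mul_one, mul_one]
    have h1 := hsq k'
    have h2 := hsq l'
    have h3 := hne k'
    have h4 := hne l'
    field_simp
    linear_combination ((-1 : ℂ) ^ l' * (-1) ^ l') * h1 + h2
  have hS : ((-1 : ℂ)) ^ (n * m) ≠ 0 := hne _
  rw [div_pow, div_pow, show thetaR τ ^ n = thetaR τ ^ k * thetaR τ ^ k' by rw [← pow_add, hk],
    show thetaR (2 * η) ^ m = thetaR (2 * η) ^ l * thetaR (2 * η) ^ l' by rw [← pow_add, hl]]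
  have q1 := pow_ne_zero k hR1
  have q2 := pow_ne_zero k' hR1
  have q3 := pow_ne_zero l hR2
  have q4 := pow_ne_zero l' hR2
  have p1 := p01 k
  have p2 := p01 k'
  have p3 := p02 l
  have p4 := p02 l'
  have p5 := p11 k
  have p6 := p12 l
  have p7 := p21 k'
  have p8 := p22 l'
  have s1 := hne (k * l)
  have s2 := hne (k' * l')
  have s3 := hne k'
  have s4 := hne l'
  have x1 : shiftExp τ (2 * η) 0 l k ≠ 0 := Complex.exp_ne_zero _
  have x2 : shiftExp τ (2 * η) 0 l' k' ≠ 0 := Complex.exp_ne_zero _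
  have x3 : shiftExp τ (2 * η) (2 * w) l k ≠ 0 := Complex.exp_ne_zero _
  have x4 : shiftExp τ (2 * η) (-(2 * w)) l' k' ≠ 0 := Complex.exp_ne_zero _
  clear hFx hGx hθ1 hθ2 hsn hsm hne hsq p01 p02 p11 p12 p21 p22 hR1 hR2 hF hG
  generalize cexp (-(π * I * (((m : ℤ) - 2 * l : ℤ) : ℂ) ^ 2 * τ)
        - 2 * π * I * (((m : ℤ) - 2 * l : ℤ) : ℂ) * (2 * w + 2 * η * (n - 2 * k))) = E1 at hexp ⊢
  generalize cexp (-(π * I * (((n : ℤ) - 2 * k : ℤ) : ℂ) ^ 2 * (2 * η))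
        - 2 * π * I * (((n : ℤ) - 2 * k : ℤ) : ℂ) * (2 * w + τ * (m - 2 * l))) = E2 at hexp ⊢
  generalize cexp (-((((n : ℤ) - 1 : ℤ) : ℂ) * (π * I * τ * (((m : ℤ) - 2 * l : ℤ) : ℂ) ^ 2 / 2
        + 2 * π * I * (((m : ℤ) - 2 * l : ℤ) : ℂ) * (w + (n - 2 * k) * η)))) = E3 at hexp ⊢
  generalize cexp (-((((m : ℤ) - 1 : ℤ) : ℂ) * (π * I * (2 * η) * (((n : ℤ) - 2 * k : ℤ) : ℂ) ^ 2
        / 2 + 2 * π * I * (((n : ℤ) - 2 * k : ℤ) : ℂ) * (w + (m - 2 * l) * (τ / 2))))) = E4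
        at hexp ⊢
  generalize cexp (-(π * I * τ / 2) * m ^ 2 * n - π * I * η * n ^ 2 * m) = E5 at hexp ⊢
  generalize cexp (π * I * η) ^ n = E6 at hexp ⊢
  generalize cexp (π * I * (τ / 2)) ^ m = E7 at hexp ⊢
  generalize shiftExp τ (2 * η) 0 m n = X0 at *
  generalize shiftExp τ (2 * η) 0 l k = X1 at *
  generalize shiftExp τ (2 * η) 0 l' k' = X2 at *
  generalize shiftExp τ (2 * η) (2 * w) l k = X3 at *
  generalize shiftExp τ (2 * η) (-(2 * w)) l' k' = X4 at *
  generalize thetaProd (2 * η) τ 0 k = P1 at *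
  generalize thetaProd (2 * η) τ 0 k' = P2 at *
  generalize thetaProd τ (2 * η) 0 l = P3 at *
  generalize thetaProd τ (2 * η) 0 l' = P4 at *
  generalize thetaProd (2 * η) τ (2 * w) k = P5 at *
  generalize thetaProd τ (2 * η) (2 * w) l = P6 at *
  generalize thetaProd (2 * η) τ (-(2 * w)) k' = P7 at *
  generalize thetaProd τ (2 * η) (-(2 * w)) l' = P8 at *
  generalize thetaProd (2 * η) τ 0 n = P9 at *
  generalize thetaProd τ (2 * η) 0 m = P0 at *
  generalize thetaR τ ^ k = R1 at *
  generalize thetaR τ ^ k' = R2 at *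
  generalize thetaR (2 * η) ^ l = R3 at *
  generalize thetaR (2 * η) ^ l' = R4 at *
  generalize theta1 (2 * w) τ = T1 at *
  generalize theta1 (2 * w) (2 * η) = T2 at *
  generalize theta1 (2 * w + 2 * η * (n - 2 * k)) τ = T3 at *
  generalize theta1 (2 * w + τ * (m - 2 * l)) (2 * η) = T4 at *
  generalize halfShift τ (n - 1) β F (w + (n - 2 * k) * η) = F1 at *
  generalize halfShift (2 * η) (m - 1) α G (w + (m - 2 * l) * (τ / 2)) = G1 at *
  generalize ((-1 : ℂ)) ^ (n * m) = S0 at *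
  generalize ((-1 : ℂ)) ^ (k * l) = S1 at *
  generalize ((-1 : ℂ)) ^ (k' * l') = S2 at *
  generalize ((-1 : ℂ)) ^ k' = S3 at *
  generalize ((-1 : ℂ)) ^ l' = S4 at *
  generalize ((-1 : ℂ)) ^ k = S5 at *
  generalize ((-1 : ℂ)) ^ l = S6 at *
  generalize ((-1 : ℂ)) ^ n = S7 at *
  generalize ((-1 : ℂ)) ^ m = S8 at *
  have hA : (R1 * R2 * R3 * R4) * (R1 * R2 * R3 * R4 * (R1 * R2 * R3 * R4))⁻¹
      = (R1 * R2 * R3 * R4)⁻¹ := by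
    have : R1 * R2 * R3 * R4 ≠ 0 := mul_ne_zero (mul_ne_zero (mul_ne_zero q1 q2) q3) q4
    rw [mul_inv, mul_inv_cancel_left₀ this]
  have hσ : S1 * S2 * (S1 * S2) ≠ 0 := mul_ne_zero (mul_ne_zero s1 s2) (mul_ne_zero s1 s2)
  have hχ : X1 * X2 * (X3 * X4) ≠ 0 := mul_ne_zero (mul_ne_zero x1 x2) (mul_ne_zero x3 x4)
  have hcancel : ∀ c σ e χ a r : ℂ, σ ≠ 0 → χ ≠ 0 →
      (c * σ) * (e * χ) * a * (σ⁻¹ * χ⁻¹ * r) = c * e * a * r := fun c σ e χ a r h1 h2 => by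
    field_simp
  calc _ = (S8 * S7) * (X0 * (E1 * E2) * (E3 * E4))
        * ((R1 * R2 * R3 * R4) * (R1 * R2 * R3 * R4 * (R1 * R2 * R3 * R4))⁻¹)
        * ((S1 * S2 * (S1 * S2))⁻¹ * (X1 * X2 * (X3 * X4))⁻¹ * (S0 * P9 * P0 * T3 * T4 * F1 * G1
          * (P1⁻¹ * P2⁻¹ * P3⁻¹ * P4⁻¹ * P5⁻¹ * P6⁻¹ * P7⁻¹ * P8⁻¹ * T1⁻¹ * T2⁻¹))) := by
        simp only [div_eq_mul_inv, mul_inv]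
        ring
    _ = (S5 / S3 * (S6 / S4)) * (E5 * E6 * E7) * (R1 * R2 * R3 * R4)⁻¹
        * (S0 * P9 * P0 * T3 * T4 * F1 * G1
          * (P1⁻¹ * P2⁻¹ * P3⁻¹ * P4⁻¹ * P5⁻¹ * P6⁻¹ * P7⁻¹ * P8⁻¹ * T1⁻¹ * T2⁻¹)) := by
        rw [hexp, hsign, hA, hcancel _ _ _ _ _ _ hσ hχ]
    _ = _ := by
        simp only [div_eq_mul_inv, mul_inv]
        ring

end Weights


/-! ### Assembly of the residues -/

section Values

variable {η τ : ℂ}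

theorem theta1_fst_ne_zero (hτ : 0 < τ.im) {u : ℂ} (hu : u ∉ periodGroup η τ) (j : ℤ) :
    theta1 (u + 2 * η * j) τ ≠ 0 :=
  theta1_ne_zero hτ fun a b h => hu ⟨a, b, -j, by push_cast; linear_combination h⟩

theorem theta1_snd_ne_zero (hη : 0 < (2 * η).im) {u : ℂ} (hu : u ∉ periodGroup η τ) (j : ℤ) :
    theta1 (u + 2 * (τ / 2) * j) (2 * η) ≠ 0 :=
  theta1_ne_zero hη fun a b h => hu ⟨a, -j, b, by push_cast; linear_combination h⟩

theorem theta1_fst_mul_ne_zero (hτ : 0 < τ.im)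
    (hinc : ∀ a b c : ℤ, (a : ℂ) + b * τ + c * (2 * η) = 0 → a = 0 ∧ b = 0 ∧ c = 0)
    {j : ℤ} (hj : j ≠ 0) : theta1 (2 * η * j) τ ≠ 0 :=
  theta1_ne_zero hτ fun a b h => hj
    (neg_eq_zero.mp (hinc a b (-j) (by push_cast; linear_combination -h)).2.2)

theorem theta1_snd_mul_ne_zero (hη : 0 < (2 * η).im)
    (hinc : ∀ a b c : ℤ, (a : ℂ) + b * τ + c * (2 * η) = 0 → a = 0 ∧ b = 0 ∧ c = 0)
    {j : ℤ} (hj : j ≠ 0) : theta1 (2 * (τ / 2) * j) (2 * η) ≠ 0 :=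
  theta1_ne_zero hη fun a b h => hj
    (neg_eq_zero.mp (hinc a (-j) b (by push_cast; linear_combination -h)).2.1)

/-- For one sign of the pole each residue is a function of k times a function of l, so the double
sum is a product of two sums. -/
theorem sum_residues_eq_additiveForm (hη : 0 < (2 * η).im) (hτ : 0 < τ.im)
    (hinc : ∀ a b c : ℤ, (a : ℂ) + b * τ + c * (2 * η) = 0 → a = 0 ∧ b = 0 ∧ c = 0)
    {n m N : ℕ} (hm : m < N) (hn : n < N) {α β : ℤ} (hnα : Even ((n : ℤ) - α))
    (hmβ : Even ((m : ℤ) - β)) {F G : ℂ → ℂ} (hF : HasThetaQuasiPeriod τ (n - 1) F)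
    (hG : HasThetaQuasiPeriod (2 * η) (m - 1) G) {z w : ℂ} (ε : Bool) (hw : w = cond ε (-z) z)
    (hwΛ : 2 * w ∉ periodGroup η τ) :
    qPoch (nomePow (2 * η) 1) (2 * η) * qPoch (nomePow τ 1) τ
        * (dPoch τ (2 * η) ∅ (τ + 2 * η + 2 * (n * η + m * (τ / 2))))⁻¹
        * ∑ i ∈ Finset.range (m + 1) ×ˢ Finset.range (n + 1),
          residueCoeff (Finset.univ ×ˢ (Finset.range N ×ˢ Finset.range N)) (poleShift η τ z) (ε, i)
          * residueCoeff (Finset.univ ×ˢ (Finset.range N ×ˢ Finset.range N)) (poleShift η τ z)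
            (!ε, m - i.1, n - i.2)
          * (dPochHat τ (2 * η) m n * regularKernel η τ (Finset.range N ×ˢ Finset.range N) z
            (fun x => F x * G x) (n * η + m * (τ / 2) - poleShift η τ z (ε, i))
            (n * η + m * (τ / 2)))
      = additiveForm η τ n m α β F G w := by
  rw [additiveForm_eq, coreSum, coreSum, mul_assoc ((-1) ^ (n * m) * _), Finset.sum_mul_sum,
    Finset.mul_sum, Finset.mul_sum, Finset.sum_product, Finset.sum_comm]
  refine Finset.sum_congr rfl fun k hk => ?_
  rw [Finset.mul_sum]
  refine Finset.sum_congr rfl fun l hl => ?_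
  rw [Finset.mem_range] at hk hl
  have hl' : l + (m - l) = m := by omega
  have hk' : k + (n - k) = n := by omega
  rw [mul_left_comm (residueCoeff _ _ _ * _), residueCoeff_mul_regularKernel hη hτ z ε hl' hk'
    (by simp; omega) (by simp; omega) hw _ rfl, residueWeight_eq hη hτ hinc l k _ _ n m hwΛ,
    residueWeight_eq_shiftCoeff hη hτ hinc hl' hk' hwΛ hnα hmβ hF hG rfl, mul_assoc]

/-- The value of the continued integral operator. -/
theorem isIntertwinerValue_additiveForm (hη : 0 < (2 * η).im) (hτ : 0 < τ.im)
    (hinc : ∀ a b c : ℤ, (a : ℂ) + b * τ + c * (2 * η) = 0 → a = 0 ∧ b = 0 ∧ c = 0)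
    {n m : ℕ} {α β : ℤ} (hnα : Even ((n : ℤ) - α)) (hmβ : Even ((m : ℤ) - β)) {F G : ℂ → ℂ}
    (hF : IsThetaFunction τ (n - 1) F) (hG : IsThetaFunction (2 * η) (m - 1) G) {z : ℂ}
    (hz : 2 * z ∉ periodGroup η τ) :
    IsIntertwinerValue η τ (n * η + m * (τ / 2)) (fun x => F x * G x) z
      (additiveForm η τ n m α β F G z) := by
  obtain ⟨N, hm, hn, h⟩ := exists_isIntertwinerValue_sum hη hτ hinc n m hz
    (Φ := fun x => F x * G x) (hF.holomorphic.mul hG.holomorphic) fun x => by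
      rw [hF.period_one, hG.period_one]
  have hz' : 2 * -z ∉ periodGroup η τ := fun ⟨a, b, c, h⟩ =>
    hz ⟨-a, -b, -c, by push_cast; linear_combination -h⟩
  have h1 := sum_residues_eq_additiveForm hη hτ hinc hm hn hnα hmβ hF.quasiPeriod hG.quasiPeriod
    true (w := -z) rfl hz'
  have h2 := sum_residues_eq_additiveForm hη hτ hinc hm hn hnα hmβ hF.quasiPeriod hG.quasiPeriod
    false (w := z) rfl hz
  -- Both core sums are odd in z. The two signs of the pole therefore contribute equally, which
  -- absorbs the factor 1/2 of the operator.
  have h3 : additiveForm η τ n m α β F G (-z) = additiveForm η τ n m α β F G z := by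
    rw [additiveForm_eq, additiveForm_eq,
      coreSum_neg_of_isThetaFunction hτ (hF.halfShift β) (theta1_fst_ne_zero hτ hz)
        (fun j hj => theta1_fst_mul_ne_zero hτ hinc hj),
      coreSum_neg_of_isThetaFunction hη (hG.halfShift α) (theta1_snd_ne_zero hη hz)
        (fun j hj => theta1_snd_mul_ne_zero hη hinc hj)]
    ring
  rw [h3] at h1
  convert h using 1
  rw [Finset.sum_product, Fintype.sum_bool]
  linear_combination -(h1 + h2) / 2

end Values

end EllipticDouble

theorem mainTheorem6 (η τ : ℂ) (hη : 0 < η.im) (hτ : 0 < τ.im)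
    (hinc : ∀ a b c : ℤ, (a : ℂ) + b * τ + c * (2 * η) = 0 → a = 0 ∧ b = 0 ∧ c = 0)
    (n m : ℕ) (α β : ℤ)
    (hα : α = 0 ∨ α = 1 ∨ α = -1) (hβ : β = 0 ∨ β = 1 ∨ β = -1)
    (hnα : Even ((n : ℤ) - α)) (hmβ : Even ((m : ℤ) - β))
    (F G : ℂ → ℂ) :
    (IsThetaFunction τ ((n : ℤ) - 1) F → IsThetaFunction (2 * η) ((m : ℤ) - 1) G →
      ∀ z : ℂ, 2 * z ∉ periodGroup η τ →
        IsIntertwinerValue η τ (n * η + m * (τ / 2)) (fun x => F x * G x) z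
            (additiveForm η τ n m α β F G z) ∧
        IsIntertwinerValue η τ (n * η + m * (τ / 2)) (fun x => F x * G x) z
            (multiplicativeForm η τ n m α β F G z) ∧
        (α = 1 → β = 1 →
          IsIntertwinerValue η τ (n * η + m * (τ / 2)) (fun x => F x * G x) z
            (residueForm η τ n m F G z))) ∧
    (HasThetaQuasiPeriod τ ((n : ℤ) - 1) F → HasThetaQuasiPeriod (2 * η) ((m : ℤ) - 1) G →
      ∀ ϑ : ℂ → ℂ → ℂ, ϑ = theta3 ∨ ϑ = theta4 →
      ∀ z : ℂ, 4 * z ∉ periodGroup η τ →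
        intertwinerDiff ϑ η τ n m (fun x => F x * G x) z
            = additiveForm η τ n m α β F G z ∧
        intertwinerDiff ϑ η τ n m (fun x => F x * G x) z
            = multiplicativeForm η τ n m α β F G z ∧
        (α = 1 → β = 1 →
          intertwinerDiff ϑ η τ n m (fun x => F x * G x) z = residueForm η τ n m F G z)) := by
  have hη2 : 0 < (2 * η).im := by simpa using hη
  have hs1 : ∀ j : ℤ, j ≠ 0 → theta1 (2 * η * j) τ ≠ 0 := fun j hj =>
    theta1_fst_mul_ne_zero hτ hinc hj
  have hs2 : ∀ j : ℤ, j ≠ 0 → theta1 (2 * (τ / 2) * j) (2 * η) ≠ 0 := fun j hj =>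
    theta1_snd_mul_ne_zero hη2 hinc hj
  have hmul : ∀ z : ℂ, 2 * z ∉ periodGroup η τ → ∀ α β : ℤ,
      multiplicativeForm η τ n m α β F G z = additiveForm η τ n m α β F G z := fun z hz α β =>
    multiplicativeForm_eq_additiveForm hη2 hτ (theta1_fst_ne_zero hτ hz)
      (theta1_snd_ne_zero hη2 hz) hs1 hs2 n m α β F G
  constructor
  · intro hF hG z hz
    have hA := isIntertwinerValue_additiveForm hη2 hτ hinc hnα hmβ hF hG hz
    refine ⟨hA, by rwa [hmul z hz], ?_⟩
    rintro rfl rfl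
    rwa [residueForm_eq_multiplicativeForm, hmul z hz]
  · intro hF hG ϑ hϑ z hz
    have hz2 : 2 * z ∉ periodGroup η τ := fun ⟨a, b, c, h⟩ =>
      hz ⟨2 * a, 2 * b, 2 * c, by push_cast; linear_combination 2 * h⟩
    obtain ⟨ε, hε⟩ : ∃ ε, IsEvenTheta ϑ ε := by
      rcases hϑ with h | h
      · exact ⟨1, Or.inl ⟨h, rfl⟩⟩
      · exact ⟨-1, Or.inr ⟨h, rfl⟩⟩
    have hA := intertwinerDiff_eq_additiveForm hε hη hτ hnα hmβ hF hG hs1 hs2 hz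
    refine ⟨hA, by rw [hmul z hz2, hA], ?_⟩
    rintro rfl rfl
    rw [residueForm_eq_multiplicativeForm, hmul z hz2, hA]
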